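/- **Setting.** Let $X\subseteq\mathbb R^{d_x}$, $Y\subseteq\mathbb R^{d_y}$ be closed and convex, with $\|y\|\le D$ on $Y$ ($D>0$). Let $f,g$ be twice continuously differentiable around $X\times Y$, with $\|\nabla^2 f\|\le l_f$, $\|\nabla^2 g\|\le l_g$ (joint Hessians, $l_f,l_g>0$) and $|f|\le C_f$ on $X\times Y$. Put $h_\sigma=\sigma f+g$ and $T(x,\sigma)=\arg\min_{y\in Y}h_\sigma(x,y)$. For a proximal parameter $\rho>0$ let $\mathrm{prox}_{\rho\phi}(\theta)=\arg\min_{w\in Y}\{\rho\phi(w)+\frac12\|w-\theta\|^2\}$, $$h^*_{\sigma,\rho}(x,y)=\min_{w\in Y}\Big(h_\sigma(x,w)+\tfrac{\|w-y\|^2}{2\rho}\Big),\quad g^*_\rho(x,z)=\min_{w\in Y}\Big(g(x,w)+\tfrac{\|w-z\|^2}{2\rho}\Big),\quad g^*(x)=\min_{w\in Y}g(x,w).$$ Assume the $(\mu,\delta)$-proximal error bound, $\mu,\delta>0$: for all $x\in X$, $\sigma\in[0,\bar\sigma]$ and $y\in Y$, $$\rho^{-1}\|y-\mathrm{prox}_{\rho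 h_\sigma(x,\cdot)}(y)\|\le\delta\ \Longrightarrow\ \rho^{-1}\|y-\mathrm{prox}_{\rho h_\sigma(x,\cdot)}(y)\|\ge\mu\inf_{p\in T(x,\sigma)}\|y-p\|;$$ assume also $\rho\mu\le1$ (automatic unless $f(x,\cdot)$ and $g(x,\cdot)$ are constant on $Y$ for all $x\in X$). The stochastic gradients $\nabla f(x,y;\zeta)$ and $\nabla g(x,y;\xi)$ are (jointly measurable) unbiased estimators of $\nabla f(x,y)$ and $\nabla g(x,y)$ on $X\times Y$, with variances at most $\sigma_f^2$ and $\sigma_g^2$. **Algorithm.** Given $\alpha_k,\gamma_k>0$, $\beta_k\in(0,1]$, integers $T_k,M_k\ge1$, nonincreasing penalties $\sigma_k\in(0,\bar\sigma]$, and $x_0\in X$, $y_0,z_0\in Y$, set $w_{y,0}=y_0$, $w_{z,0}=z_0$. For $k=0,1,\dots$ let $u_0=w_{y,k}$, $v_0=w_{z,k}$; for $t=0,\dots,T_k-1$ let $$u_{t+1}=\Pi_Y\big(u_t-\gamma_k(\sigma_k\nabla_yf(x_k,u_t;\zeta_{wy}^{k,t})+\nabla_yg(x_k,u_t;\xi_{wy}^{k,t})+\rho^{-1}(u_t-y_k))\big),$$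 $$v_{t+1}=\Pi_Y\big(v_t-\gamma_k(\nabla_yg(x_k,v_t;\xi_{wz}^{k,t})+\rho^{-1}(v_t-z_k))\big);$$ then $w_{y,k+1}=u_{T_k}$, $w_{z,k+1}=v_{T_k}$, $y_{k+1}=(1-\beta_k)y_k+\beta_kw_{y,k+1}$, $z_{k+1}=(1-\beta_k)z_k+\beta_kw_{z,k+1}$, and $$x_{k+1}=\Pi_X\Big(x_k-\tfrac{\alpha_k}{M_k}\sum_{m=1}^{M_k}\big(\sigma_k\nabla_xf(x_k,w_{y,k+1};\zeta_x^{k,m})+\nabla_xg(x_k,w_{y,k+1};\xi_{xy}^{k,m})-\nabla_xg(x_k,w_{z,k+1};\xi_{xz}^{k,m})\big)\Big).$$ The draws $(\zeta_{wy}^{k,t},\xi_{wy}^{k,t},\xi_{wz}^{k,t})$ and $(\zeta_x^{k,m},\xi_{xy}^{k,m},\xi_{xz}^{k,m})$, over all indices, are independent of each other (inside one draw any dependence is allowed). **Residuals and potential.** Let $w^*_{y,k}=\mathrm{prox}_{\rho h_{\sigma_k}(x_k,\cdot)}(y_k)$, $w^*_{z,k}=\mathrm{prox}_{\rho g(x_k,\cdot)}(z_k)$,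 and $$\Delta_k^y=\rho^{-1}(y_k-w^*_{y,k}),\qquad \Delta_k^z=\rho^{-1}(z_k-w^*_{z,k}),$$ $$\Delta_k^x=\alpha_k^{-1}\Big(x_k-\Pi_X\big(x_k-\alpha_k(\nabla_xh_{\sigma_k}(x_k,w^*_{y,k})-\nabla_xg(x_k,w^*_{z,k}))\big)\Big).$$ For constants $C,C_w$ and $\lambda_k=T_k\gamma_k/(4\rho)$ put $$\mathbb V_k=\frac{h^*_{\sigma_k,\rho}(x_k,y_k)-g^*_\rho(x_k,z_k)}{\sigma_k}+\frac{C}{\sigma_k}\big(g^*_\rho(x_k,z_k)-g^*(x_k)\big)+\frac{C_w\lambda_k}{\sigma_k\rho}\big(\|w_{y,k}-w^*_{y,k}\|^2+\|w_{z,k}-w^*_{z,k}\|^2\big).$$ **Theorem.** For every $C\ge4$ there are universal constants $C_{w,0},B>0$ such that for every $C_w\ge C_{w,0}$ there are universal constants $c_1,\dots,c_9,B'>0$ (all depending on nothing but $C$ and, for $c_1,\dots,c_9,B'$, on $C_w$) with the following property. In the setting above, suppose that for all $k\ge0$ $$\rho<\frac{c_2}{l_g},\quad \sigma_k<\frac{c_1l_g}{l_f},\quad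 T_k\gamma_k<c_3\rho,\quad \beta_k\le c_4,\quad \alpha_k\le c_5\rho(1+l_g/\mu)^{-1},$$ $$\alpha_k\le c_6\rho^3\min(\mu^2,\delta^2/D^2)\beta_k,\qquad \frac{\sigma_k-\sigma_{k+1}}{\sigma_{k+1}}\le c_7\rho^2\min(\mu^2,\delta^2/D^2)\beta_k,$$ $$\max(1,\rho)\,(\rho\beta_k+\alpha_k)\le c_8T_k^2\gamma_k^2,\qquad T_{k+1}\gamma_{k+1}\le\Big(1+c_9\frac{T_k\gamma_k}{\rho}\Big)T_k\gamma_k$$ (the last condition holds in particular when $T_k\gamma_k$ is nonincreasing in $k$). Then for every $K\ge0$ the random variables under the two expectations on the first line below are integrable and $$\mathbb E\Big[\sum_{k=0}^{K-1}\frac{\alpha_k}{16\sigma_k}\|\Delta_k^x\|^2+\frac{\rho\beta_k}{16\sigma_k}\big(\|\Delta_k^y\|^2+\|\Delta_k^z\|^2\big)\Big]\le\mathbb E[\mathbb V_0-\mathbb V_K]$$ $$\qquad+B'C_f\sum_{k=0}^{K-1}\frac{\sigma_k-\sigma_{k+1}}{\sigma_{k+1}}+\frac{B(l_g/\mu+C_w)}{\rho}\sum_{k=0}^{K-1}\sigma_k^{-1}\Big(\max(1,\rho)\frac{\alpha_k}{M_k}+\rho^{-1}T_k^2\gamma_k^3\Big)(\sigma_k^2\sigma_f^2+\sigma_g^2).$$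 -/

import Mathlib

open MeasureTheory ProbabilityTheory

noncomputable section

namespace BilevelSGD

/-- Euclidean space of dimension `n`. -/
abbrev Vec (n : ℕ) : Type := EuclideanSpace ℝ (Fin n)

/-! ### Minimisers, projections, proximal operators -/

/-- The set of minimisers of `φ` over `Y`. -/
def argminSet {V : Type*} (Y : Set V) (φ : V → ℝ) : Set V :=
  {w | w ∈ Y ∧ ∀ v ∈ Y, φ w ≤ φ v}

/-- The minimal value of `φ` over `Y`. -/
def minValue {V : Type*} (Y : Set V) (φ : V → ℝ) : ℝ := ⨅ w : Y, φ w

/-- The set of values of the proximal operator of `ρ φ` over `Y` at `θ`: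
the minimisers over `Y` of `ρ φ(w) + ‖w - θ‖² / 2`. -/
def proxSet {n : ℕ} (Y : Set (Vec n)) (ρ : ℝ) (φ : Vec n → ℝ) (θ : Vec n) : Set (Vec n) :=
  argminSet Y fun w => ρ * φ w + (1 / 2) * ‖w - θ‖ ^ 2

/-- The proximal operator (the point of `proxSet`, which is a singleton when `ρ φ` is smooth with
a constant below one and `Y` is closed, convex and nonempty). -/
def prox {n : ℕ} (Y : Set (Vec n)) (ρ : ℝ) (φ : Vec n → ℝ) (θ : Vec n) : Vec n :=
  Classical.epsilon fun w => w ∈ proxSet Y ρ φ θ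

/-- Euclidean projection onto a closed convex nonempty set `S`. -/
def proj {n : ℕ} (S : Set (Vec n)) (θ : Vec n) : Vec n :=
  Classical.epsilon fun p => p ∈ argminSet S fun q => ‖q - θ‖

/-- The proximal (Moreau) envelope `min_{w ∈ Y} φ(w) + ‖w - θ‖² / (2ρ)`. -/
def envelope {n : ℕ} (Y : Set (Vec n)) (ρ : ℝ) (φ : Vec n → ℝ) (θ : Vec n) : ℝ :=
  minValue Y fun w => φ w + ‖w - θ‖ ^ 2 / (2 * ρ)

/-! ### The bilevel problem -/

/-- The data of the bilevel problem: minimise `f x y` over `x ∈ X` and `y ∈ Y`, where `y` minimises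
`g x` over `Y`. -/
structure Problem (m n : ℕ) where
  X : Set (Vec m)
  Y : Set (Vec n)
  f : Vec m → Vec n → ℝ
  g : Vec m → Vec n → ℝ

/-- A function of two variables, as a function on the product with its Euclidean norm. -/
def joint {m n : ℕ} (φ : Vec m → Vec n → ℝ) : WithLp 2 (Vec m × Vec n) → ℝ :=
  fun p => φ p.fst p.snd

/-- Partial gradient in the first variable. -/
def gradX {m n : ℕ} (φ : Vec m → Vec n → ℝ) (x : Vec m) (y : Vec n) : Vec m :=
  gradient (fun x' => φ x' y) x

/-- Partial gradient in the second variable. -/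
def gradY {m n : ℕ} (φ : Vec m → Vec n → ℝ) (x : Vec m) (y : Vec n) : Vec n :=
  gradient (fun y' => φ x y') y

/-- `φ` is twice continuously differentiable around `X × Y`, with `‖∇²φ‖ ≤ l` (operator norm of the
joint Hessian) on `X × Y`. -/
def SmoothOn {m n : ℕ} (X : Set (Vec m)) (Y : Set (Vec n)) (φ : Vec m → Vec n → ℝ) (l : ℝ) : Prop :=
  ∀ x ∈ X, ∀ y ∈ Y,
    ContDiffAt ℝ 2 (joint φ) (WithLp.toLp 2 (x, y)) ∧
    ‖fderiv ℝ (fderiv ℝ (joint φ)) (WithLp.toLp 2 (x, y))‖ ≤ l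

namespace Problem

variable {m n : ℕ} (P : Problem m n)

/-- The perturbed lower-level objective `h_σ = σ f + g`. -/
def h (σ : ℝ) (x : Vec m) (y : Vec n) : ℝ := σ * P.f x y + P.g x y

/-- The solution set `T(x, σ)` of the perturbed lower-level problem. -/
def solSet (x : Vec m) (σ : ℝ) : Set (Vec n) := argminSet P.Y (P.h σ x)

/-- The `(μ, δ)`-proximal error bound with proximal parameter `ρ`, for all `x ∈ X` and all
`σ ∈ [0, σmax]`. -/
def ProxErrorBound (ρ μ δ σmax : ℝ) : Prop :=
  ∀ x ∈ P.X, ∀ σ ∈ Set.Icc 0 σmax, ∀ y ∈ P.Y, ∀ p ∈ proxSet P.Y ρ (P.h σ x) y,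
    ρ⁻¹ * ‖y - p‖ ≤ δ → μ * Metric.infDist y (P.solSet x σ) ≤ ρ⁻¹ * ‖y - p‖

/-- Regularity of the objectives and of the domains; `lf`, `lg` are the smoothness constants of
`f`, `g`, `D` bounds `Y` and `Cf` bounds `|f|` on `X × Y`. -/
structure Regular (lf lg D Cf : ℝ) : Prop where
  closed_X : IsClosed P.X
  convex_X : Convex ℝ P.X
  closed_Y : IsClosed P.Y
  convex_Y : Convex ℝ P.Y
  lf_pos : 0 < lf
  lg_pos : 0 < lg
  D_pos : 0 < D
  smooth_f : SmoothOn P.X P.Y P.f lf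
  smooth_g : SmoothOn P.X P.Y P.g lg
  bound_Y : ∀ y ∈ P.Y, ‖y‖ ≤ D
  bound_f : ∀ x ∈ P.X, ∀ y ∈ P.Y, |P.f x y| ≤ Cf

/-- `Φ_{σ,ρ}(x, y, z)`, with the constant `C`. -/
def Phi (C ρ σ : ℝ) (x : Vec m) (y z : Vec n) : ℝ :=
  (envelope P.Y ρ (P.h σ x) y - envelope P.Y ρ (P.g x) z) / σ
    + (C / σ) * (envelope P.Y ρ (P.g x) z - minValue P.Y (P.g x))

end Problem

/-! ### Stochastic first-order oracles -/

/-- A stochastic gradient oracle: estimators of the two partial gradients at `(x, y)`, as functions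
of the random sample in `Z`. -/
structure Oracle (m n : ℕ) (Z : Type*) where
  dx : Vec m → Vec n → Z → Vec m
  dy : Vec m → Vec n → Z → Vec n

/-- The oracle is measurable and, on `X × Y`, it is unbiased for `∇φ` with variance at most `s²`
when the sample has law `Q`. -/
structure Oracle.IsUnbiased {m n : ℕ} {Z : Type*} [MeasurableSpace Z] (G : Oracle m n Z)
    (Q : Measure Z) (X : Set (Vec m)) (Y : Set (Vec n)) (φ : Vec m → Vec n → ℝ) (s : ℝ) : Prop where
  measurable_dx : Measurable fun p : Vec m × Vec n × Z => G.dx p.1 p.2.1 p.2.2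
  measurable_dy : Measurable fun p : Vec m × Vec n × Z => G.dy p.1 p.2.1 p.2.2
  integrable_dx : ∀ x ∈ X, ∀ y ∈ Y, Integrable (G.dx x y) Q
  integrable_dy : ∀ x ∈ X, ∀ y ∈ Y, Integrable (G.dy x y) Q
  mean_dx : ∀ x ∈ X, ∀ y ∈ Y, ∫ ζ, G.dx x y ζ ∂Q = gradX φ x y
  mean_dy : ∀ x ∈ X, ∀ y ∈ Y, ∫ ζ, G.dy x y ζ ∂Q = gradY φ x y
  integrable_sq : ∀ x ∈ X, ∀ y ∈ Y,
    Integrable (fun ζ => ‖G.dx x y ζ - gradX φ x y‖ ^ 2 + ‖G.dy x y ζ - gradY φ x y‖ ^ 2) Q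
  variance_le : ∀ x ∈ X, ∀ y ∈ Y,
    ∫ ζ, (‖G.dx x y ζ - gradX φ x y‖ ^ 2 + ‖G.dy x y ζ - gradY φ x y‖ ^ 2) ∂Q ≤ s ^ 2

/-- Indices of the samples drawn by the algorithm: `Sum.inl (k, t)` is inner step `t` of outer
iteration `k`, and `Sum.inr (k, j)` is batch element `j` of outer iteration `k`. -/
abbrev SampleIndex : Type := (ℕ × ℕ) ⊕ (ℕ × ℕ)

/-- One draw: a sample for the oracle of `f` and two samples for the oracle of `g`.
For an inner step it is `(ζ_wy, ξ_wy, ξ_wz)`, for a batch element it is `(ζ_x, ξ_xy, ξ_xz)`. -/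
abbrev Draw (Zf Zg : Type*) : Type _ := Zf × Zg × Zg

/-- The draws at different indices are independent, and in each draw the three samples have the laws
`Qf`, `Qg`, `Qg`.  (Nothing is required of the dependence inside one draw.) -/
structure IsSampling {Ω Zf Zg : Type*} [MeasurableSpace Ω] [MeasurableSpace Zf] [MeasurableSpace Zg]
    (Pr : Measure Ω) (Qf : Measure Zf) (Qg : Measure Zg)
    (S : SampleIndex → Ω → Draw Zf Zg) : Prop where
  measurable : ∀ i, Measurable (S i)
  indep : iIndepFun S Pr
  law_f : ∀ i, Pr.map (fun ω => (S i ω).1) = Qf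
  law_g : ∀ i, Pr.map (fun ω => (S i ω).2.1) = Qg
  law_g' : ∀ i, Pr.map (fun ω => (S i ω).2.2) = Qg

/-! ### The double-loop algorithm -/

/-- Parameters of the algorithm: `α k`, `γ k` step sizes, `β k` proximal-smoothing parameters, `σ k`
penalty parameters, `T k` inner-loop lengths, `M k` batch sizes, `ρ` proximal parameter. -/
structure Params where
  ρ : ℝ
  α : ℕ → ℝ
  β : ℕ → ℝ
  γ : ℕ → ℝ
  σ : ℕ → ℝ
  T : ℕ → ℕ
  M : ℕ → ℕ

/-- The variables of the algorithm: `x_k`, `y_k`, `z_k`, `w_{y,k}`, `w_{z,k}`. -/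
structure State (m n : ℕ) where
  x : Vec m
  y : Vec n
  z : Vec n
  wy : Vec n
  wz : Vec n

section Algorithm

variable {m n : ℕ} {Zf Zg : Type*} (P : Problem m n) (A : Params)
  (Gf : Oracle m n Zf) (Gg : Oracle m n Zg)

/-- The inner iterates `u_t` of outer iteration `k`, from the current variables `s`;
`d t` is the draw of inner step `t`. -/
def innerU (k : ℕ) (s : State m n) (d : ℕ → Draw Zf Zg) : ℕ → Vec n
  | 0 => s.wy
  | t + 1 =>
    let u := innerU k s d t
    proj P.Y (u - A.γ k • (A.σ k • Gf.dy s.x u (d t).1 + Gg.dy s.x u (d t).2.1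
      + A.ρ⁻¹ • (u - s.y)))

/-- The inner iterates `v_t` of outer iteration `k`. -/
def innerV (k : ℕ) (s : State m n) (d : ℕ → Draw Zf Zg) : ℕ → Vec n
  | 0 => s.wz
  | t + 1 =>
    let v := innerV k s d t
    proj P.Y (v - A.γ k • (Gg.dy s.x v (d t).2.2 + A.ρ⁻¹ • (v - s.z)))

/-- One outer iteration; `d` holds the draws of the inner loops and `e` those of the batch. -/
def outerStep (k : ℕ) (s : State m n) (d e : ℕ → Draw Zf Zg) : State m n :=
  let wy' := innerU P A Gf Gg k s d (A.T k)
  let wz' := innerV P A Gg k s d (A.T k)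
  { x := proj P.X (s.x - (A.α k / A.M k) • ∑ j ∈ Finset.range (A.M k),
      (A.σ k • Gf.dx s.x wy' (e j).1 + Gg.dx s.x wy' (e j).2.1 - Gg.dx s.x wz' (e j).2.2))
    y := (1 - A.β k) • s.y + A.β k • wy'
    z := (1 - A.β k) • s.z + A.β k • wz'
    wy := wy'
    wz := wz' }

/-- The iterates of the algorithm started from `(x₀, y₀, z₀)`, as a function of the draws. -/
def iterate (x₀ : Vec m) (y₀ z₀ : Vec n) (S : SampleIndex → Draw Zf Zg) : ℕ → State m n
  | 0 => { x := x₀, y := y₀, z := z₀, wy := y₀, wz := z₀ }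
  | k + 1 => outerStep P A Gf Gg k (iterate x₀ y₀ z₀ S k)
      (fun t => S (Sum.inl (k, t))) (fun j => S (Sum.inr (k, j)))

end Algorithm

/-! ### Stationarity residuals and potential -/

section Residuals

variable {m n : ℕ} (P : Problem m n) (A : Params) (k : ℕ) (s : State m n)

/-- `prox_{ρ h_{σ_k}(x_k, ·)}(y_k)`. -/
def proxY : Vec n := prox P.Y A.ρ (P.h (A.σ k) s.x) s.y

/-- `prox_{ρ g(x_k, ·)}(z_k)`. -/
def proxZ : Vec n := prox P.Y A.ρ (P.g s.x) s.z

/-- The residual `Δ_k^y`. -/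
def resY : Vec n := A.ρ⁻¹ • (s.y - proxY P A k s)

/-- The residual `Δ_k^z`. -/
def resZ : Vec n := A.ρ⁻¹ • (s.z - proxZ P A s)

/-- The exact projected gradient step `x̂_k`. -/
def xHat : Vec m :=
  proj P.X (s.x - A.α k •
    (gradX (P.h (A.σ k)) s.x (proxY P A k s) - gradX P.g s.x (proxZ P A s)))

/-- The residual `Δ_k^x`. -/
def resX : Vec m := (A.α k)⁻¹ • (s.x - xHat P A k s)

/-- `λ_k = T_k γ_k / (4 ρ)`. -/
def rate : ℝ := A.T k * A.γ k / (4 * A.ρ)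

/-- The potential `𝕍_k`, with the constants `C` and `Cw`. -/
def potential (C Cw : ℝ) : ℝ :=
  P.Phi C A.ρ (A.σ k) s.x s.y s.z
    + Cw * rate A k / (A.σ k * A.ρ)
      * (‖s.wy - proxY P A k s‖ ^ 2 + ‖s.wz - proxZ P A s‖ ^ 2)

/-- The weighted squared residuals of iteration `k`. -/
def weightedResidual : ℝ :=
  A.α k / (16 * A.σ k) * ‖resX P A k s‖ ^ 2
    + A.ρ * A.β k / (16 * A.σ k) * (‖resY P A k s‖ ^ 2 + ‖resZ P A s‖ ^ 2)

end Residuals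

/-! ### Conditions on the parameters -/

/-- Ranges of the parameters: positive step sizes, `β_k ∈ (0, 1]`, at least one inner step and one
batch element, and nonincreasing penalty parameters in `(0, σmax]`. -/
structure Params.Admissible (A : Params) (σmax : ℝ) : Prop where
  ρ_pos : 0 < A.ρ
  α_pos : ∀ k, 0 < A.α k
  β_pos : ∀ k, 0 < A.β k
  β_le_one : ∀ k, A.β k ≤ 1
  γ_pos : ∀ k, 0 < A.γ k
  T_pos : ∀ k, 1 ≤ A.T k
  M_pos : ∀ k, 1 ≤ A.M k
  σ_pos : ∀ k, 0 < A.σ k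
  σ_le : ∀ k, A.σ k ≤ σmax
  σ_anti : ∀ k, A.σ (k + 1) ≤ A.σ k

/-- The step-size conditions, with constants `c₁, …, c₉`. -/
structure Params.StepConditions (A : Params) (lf lg μ δ D : ℝ)
    (c₁ c₂ c₃ c₄ c₅ c₆ c₇ c₈ c₉ : ℝ) : Prop where
  ρ_lt : A.ρ < c₂ / lg
  σ_lt : ∀ k, A.σ k < c₁ * lg / lf
  inner_lt : ∀ k, A.T k * A.γ k < c₃ * A.ρ
  β_le : ∀ k, A.β k ≤ c₄
  α_le : ∀ k, A.α k ≤ c₅ * A.ρ * (1 + lg / μ)⁻¹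
  α_le_β : ∀ k, A.α k ≤ c₆ * A.ρ ^ 3 * min (μ ^ 2) (δ ^ 2 / D ^ 2) * A.β k
  σ_decay : ∀ k, (A.σ k - A.σ (k + 1)) / A.σ (k + 1)
    ≤ c₇ * A.ρ ^ 2 * min (μ ^ 2) (δ ^ 2 / D ^ 2) * A.β k
  compact : ∀ k, max 1 A.ρ * (A.ρ * A.β k + A.α k) ≤ c₈ * (A.T k : ℝ) ^ 2 * A.γ k ^ 2
  /- slow growth of `T_k γ_k`; it holds in particular when `T_k γ_k` is nonincreasing -/
  inner_growth : ∀ k, A.T (k + 1) * A.γ (k + 1)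
    ≤ (1 + c₉ * (A.T k * A.γ k / A.ρ)) * (A.T k * A.γ k)

end BilevelSGD

end

namespace BilevelSGD

open scoped InnerProductSpace

/-! ### Projections -/

section Projection

variable {n : ℕ} {S : Set (Vec n)}

lemma proj_mem_argminSet (hS : IsClosed S) (hne : S.Nonempty) (θ : Vec n) :
    proj S θ ∈ argminSet S fun q => ‖q - θ‖ := by
  apply Classical.epsilon_spec (p := fun p => p ∈ argminSet S fun q => ‖q - θ‖)
  obtain ⟨y, hy, h⟩ := hS.exists_infDist_eq_dist hne θ
  refine ⟨y, hy, fun v hv => ?_⟩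
  have := Metric.infDist_le_dist_of_mem (x := θ) hv
  rw [h] at this
  simpa [dist_eq_norm, norm_sub_rev] using this

lemma proj_mem (hS : IsClosed S) (hne : S.Nonempty) (θ : Vec n) : proj S θ ∈ S :=
  (proj_mem_argminSet hS hne θ).1

lemma inner_sub_proj_le (hS : IsClosed S) (hc : Convex ℝ S) (hne : S.Nonempty) (θ : Vec n)
    {q : Vec n} (hq : q ∈ S) : ⟪θ - proj S θ, q - proj S θ⟫_ℝ ≤ 0 := by
  have h := proj_mem_argminSet hS hne θ
  refine (norm_eq_iInf_iff_real_inner_le_zero hc h.1).1 ?_ q hq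
  have : Nonempty S := ⟨⟨_, h.1⟩⟩
  refine le_antisymm (le_ciInf fun w => ?_)
    (ciInf_le ⟨0, by rintro _ ⟨w, rfl⟩; exact norm_nonneg _⟩ (⟨_, h.1⟩ : S))
  simpa [norm_sub_rev] using h.2 w w.2

lemma norm_proj_sub_proj_le (hS : IsClosed S) (hc : Convex ℝ S) (hne : S.Nonempty)
    (a b : Vec n) : ‖proj S a - proj S b‖ ≤ ‖a - b‖ := by
  have h1 := inner_sub_proj_le hS hc hne a (proj_mem hS hne b)
  have h2 := inner_sub_proj_le hS hc hne b (proj_mem hS hne a)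
  have h3 : ‖proj S a - proj S b‖ ^ 2 ≤ ⟪a - b, proj S a - proj S b⟫_ℝ := by
    rw [← real_inner_self_eq_norm_sq]
    simp only [inner_sub_left, inner_sub_right] at *
    linarith
  have h4 := real_inner_le_norm (a - b) (proj S a - proj S b)
  by_contra! hlt
  nlinarith [norm_nonneg (a - b)]

lemma continuous_proj (hS : IsClosed S) (hc : Convex ℝ S) (hne : S.Nonempty) :
    Continuous (proj S) :=
  (LipschitzWith.of_dist_le_mul (K := 1) fun a b => by
    simpa [dist_eq_norm] using norm_proj_sub_proj_le hS hc hne a b).continuous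

/-- A point satisfying the variational inequality of a gradient step is fixed by that step. -/
lemma proj_sub_smul_eq (hS : IsClosed S) (hc : Convex ℝ S) {w v : Vec n} (hw : w ∈ S)
    (h : ∀ q ∈ S, 0 ≤ ⟪v, q - w⟫_ℝ) {γ : ℝ} (hγ : 0 ≤ γ) : proj S (w - γ • v) = w := by
  have hp := proj_mem hS ⟨w, hw⟩ (w - γ • v)
  have h1 := inner_sub_proj_le hS hc ⟨w, hw⟩ (w - γ • v) hw
  have h2 := mul_nonneg hγ (h _ hp)
  set p := proj S (w - γ • v)
  have h3 : ‖w - p‖ ^ 2 ≤ 0 := by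
    rw [← real_inner_self_eq_norm_sq]
    simp only [inner_sub_left, inner_sub_right, inner_smul_left, conj_trivial] at *
    linarith
  have : ‖w - p‖ = 0 := by nlinarith [norm_nonneg (w - p)]
  exact (sub_eq_zero.1 (norm_eq_zero.1 this)).symm

end Projection

/-! ### Gradients of smooth functions -/

section Gradient

variable {m n : ℕ} {X : Set (Vec m)} {Y : Set (Vec n)} {φ ψ : Vec m → Vec n → ℝ} {l l' : ℝ}

lemma SmoothOn.differentiableAt (h : SmoothOn X Y φ l) {x : Vec m} {y : Vec n} (hx : x ∈ X)
    (hy : y ∈ Y) : DifferentiableAt ℝ (joint φ) (WithLp.toLp 2 (x, y)) :=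
  (h x hx y hy).1.differentiableAt (by norm_num)

lemma hasFDerivAt_left {x : Vec m} {y : Vec n}
    (h : DifferentiableAt ℝ (joint φ) (WithLp.toLp 2 (x, y))) :
    HasFDerivAt (fun x' => φ x' y) ((fderiv ℝ (joint φ) (WithLp.toLp 2 (x, y))).comp
      ((WithLp.prodContinuousLinearEquiv 2 ℝ (Vec m) (Vec n)).symm.toContinuousLinearMap.comp
        (ContinuousLinearMap.inl ℝ (Vec m) (Vec n)))) x := by
  have h2 : HasFDerivAt (fun x' : Vec m =>
      (WithLp.prodContinuousLinearEquiv 2 ℝ (Vec m) (Vec n)).symm (x', y))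
      ((WithLp.prodContinuousLinearEquiv 2 ℝ (Vec m) (Vec n)).symm.toContinuousLinearMap.comp
        (ContinuousLinearMap.inl ℝ (Vec m) (Vec n))) x :=
    (ContinuousLinearEquiv.hasFDerivAt _).comp x (hasFDerivAt_prodMk_left x y)
  exact HasFDerivAt.comp (g := joint φ) x h.hasFDerivAt h2

lemma hasFDerivAt_right {x : Vec m} {y : Vec n}
    (h : DifferentiableAt ℝ (joint φ) (WithLp.toLp 2 (x, y))) :
    HasFDerivAt (fun y' => φ x y') ((fderiv ℝ (joint φ) (WithLp.toLp 2 (x, y))).comp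
      ((WithLp.prodContinuousLinearEquiv 2 ℝ (Vec m) (Vec n)).symm.toContinuousLinearMap.comp
        (ContinuousLinearMap.inr ℝ (Vec m) (Vec n)))) y := by
  have h2 : HasFDerivAt (fun y' : Vec n =>
      (WithLp.prodContinuousLinearEquiv 2 ℝ (Vec m) (Vec n)).symm (x, y'))
      ((WithLp.prodContinuousLinearEquiv 2 ℝ (Vec m) (Vec n)).symm.toContinuousLinearMap.comp
        (ContinuousLinearMap.inr ℝ (Vec m) (Vec n))) y :=
    (ContinuousLinearEquiv.hasFDerivAt _).comp y (hasFDerivAt_prodMk_right x y)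
  exact HasFDerivAt.comp (g := joint φ) y h.hasFDerivAt h2

lemma inner_gradX {x : Vec m} {y : Vec n}
    (h : DifferentiableAt ℝ (joint φ) (WithLp.toLp 2 (x, y))) (v : Vec m) :
    ⟪gradX φ x y, v⟫_ℝ = fderiv ℝ (joint φ) (WithLp.toLp 2 (x, y)) (WithLp.toLp 2 (v, 0)) := by
  rw [gradX, gradient, (hasFDerivAt_left h).fderiv, InnerProductSpace.toDual_symm_apply]
  rfl

lemma inner_gradY {x : Vec m} {y : Vec n}
    (h : DifferentiableAt ℝ (joint φ) (WithLp.toLp 2 (x, y))) (v : Vec n) :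
    ⟪gradY φ x y, v⟫_ℝ = fderiv ℝ (joint φ) (WithLp.toLp 2 (x, y)) (WithLp.toLp 2 (0, v)) := by
  rw [gradY, gradient, (hasFDerivAt_right h).fderiv, InnerProductSpace.toDual_symm_apply]
  rfl

lemma hasFDerivAt_gradX {x : Vec m} {y : Vec n}
    (h : DifferentiableAt ℝ (joint φ) (WithLp.toLp 2 (x, y))) :
    HasFDerivAt (fun x' => φ x' y) (innerSL ℝ (gradX φ x y)) x :=
  (hasFDerivAt_left h).congr_fderiv
    (ContinuousLinearMap.ext fun v => (inner_gradX h v).symm)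

lemma hasFDerivAt_gradY {x : Vec m} {y : Vec n}
    (h : DifferentiableAt ℝ (joint φ) (WithLp.toLp 2 (x, y))) :
    HasFDerivAt (fun y' => φ x y') (innerSL ℝ (gradY φ x y)) y :=
  (hasFDerivAt_right h).congr_fderiv
    (ContinuousLinearMap.ext fun v => (inner_gradY h v).symm)

lemma norm_toLp_le (u : Vec m) (v : Vec n) : ‖WithLp.toLp 2 (u, v)‖ ≤ ‖u‖ + ‖v‖ := by
  have h : WithLp.toLp 2 (u, v) = WithLp.toLp 2 (u, (0 : Vec n)) + WithLp.toLp 2 ((0 : Vec m), v) := by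
    rw [← WithLp.toLp_add]; simp
  rw [h]
  refine (norm_add_le _ _).trans ?_
  rw [WithLp.norm_toLp_fst, WithLp.norm_toLp_snd]

lemma SmoothOn.norm_fderiv_sub_le (h : SmoothOn X Y φ l) (hX : Convex ℝ X) (hY : Convex ℝ Y)
    (hl : 0 ≤ l) {x x' : Vec m} {y y' : Vec n} (hx : x ∈ X) (hx' : x' ∈ X) (hy : y ∈ Y)
    (hy' : y' ∈ Y) :
    ‖fderiv ℝ (joint φ) (WithLp.toLp 2 (x', y')) - fderiv ℝ (joint φ) (WithLp.toLp 2 (x, y))‖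
      ≤ l * (‖x' - x‖ + ‖y' - y‖) := by
  have hconv : Convex ℝ ((WithLp.prodContinuousLinearEquiv 2 ℝ (Vec m) (Vec n)) ⁻¹' (X ×ˢ Y)) :=
    (hX.prod hY).is_linear_preimage
      (WithLp.prodContinuousLinearEquiv 2 ℝ (Vec m) (Vec n)).toLinearMap.isLinear
  have key := hconv.norm_image_sub_le_of_norm_hasFDerivWithin_le (𝕜 := ℝ)
    (f := fderiv ℝ (joint φ)) (f' := fderiv ℝ (fderiv ℝ (joint φ))) (C := l)
    (x := WithLp.toLp 2 (x, y)) (y := WithLp.toLp 2 (x', y'))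
    (fun p hp => (((h p.fst hp.1 p.snd hp.2).1.fderiv_right (m := 1) (by norm_num)
      ).differentiableAt (by norm_num)).hasFDerivAt.hasFDerivWithinAt)
    (fun p hp => (h p.fst hp.1 p.snd hp.2).2) ⟨hx, hy⟩ ⟨hx', hy'⟩
  refine key.trans (mul_le_mul_of_nonneg_left ?_ hl)
  rw [← WithLp.toLp_sub]
  exact norm_toLp_le _ _

lemma norm_le_of_inner_self_le {k : ℕ} {v : Vec k} {c : ℝ} (hc : 0 ≤ c)
    (h : ⟪v, v⟫_ℝ ≤ c * ‖v‖) : ‖v‖ ≤ c := by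
  rw [real_inner_self_eq_norm_sq] at h
  by_contra! hlt
  nlinarith [norm_nonneg v]

lemma SmoothOn.gradX_lip (h : SmoothOn X Y φ l) (hX : Convex ℝ X) (hY : Convex ℝ Y)
    (hl : 0 ≤ l) {x x' : Vec m} {y y' : Vec n} (hx : x ∈ X) (hx' : x' ∈ X) (hy : y ∈ Y)
    (hy' : y' ∈ Y) : ‖gradX φ x' y' - gradX φ x y‖ ≤ l * (‖x' - x‖ + ‖y' - y‖) := by
  apply norm_le_of_inner_self_le (by positivity)
  rw [inner_sub_left, inner_gradX (h.differentiableAt hx' hy'), inner_gradX (h.differentiableAt hx hy),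
    ← sub_apply]
  refine (Real.le_norm_self _).trans ((ContinuousLinearMap.le_opNorm _ _).trans ?_)
  rw [WithLp.norm_toLp_fst]
  exact mul_le_mul_of_nonneg_right (h.norm_fderiv_sub_le hX hY hl hx hx' hy hy') (norm_nonneg _)

lemma SmoothOn.gradY_lip (h : SmoothOn X Y φ l) (hX : Convex ℝ X) (hY : Convex ℝ Y)
    (hl : 0 ≤ l) {x x' : Vec m} {y y' : Vec n} (hx : x ∈ X) (hx' : x' ∈ X) (hy : y ∈ Y)
    (hy' : y' ∈ Y) : ‖gradY φ x' y' - gradY φ x y‖ ≤ l * (‖x' - x‖ + ‖y' - y‖) := by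
  apply norm_le_of_inner_self_le (by positivity)
  rw [inner_sub_left, inner_gradY (h.differentiableAt hx' hy'), inner_gradY (h.differentiableAt hx hy),
    ← sub_apply]
  refine (Real.le_norm_self _).trans ((ContinuousLinearMap.le_opNorm _ _).trans ?_)
  rw [WithLp.norm_toLp_snd]
  exact mul_le_mul_of_nonneg_right (h.norm_fderiv_sub_le hX hY hl hx hx' hy hy') (norm_nonneg _)

/-- First-order expansion on a convex set, for a function with Lipschitz gradient. -/
lemma abs_sub_sub_inner_le {k : ℕ} {S : Set (Vec k)} (hS : Convex ℝ S) {F : Vec k → ℝ}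
    {G : Vec k → Vec k} (hl : 0 ≤ l) (hF : ∀ u ∈ S, HasFDerivAt F (innerSL ℝ (G u)) u)
    (hG : ∀ u ∈ S, ∀ v ∈ S, ‖G v - G u‖ ≤ l * ‖v - u‖) {u v : Vec k} (hu : u ∈ S) (hv : v ∈ S) :
    |F v - F u - ⟪G u, v - u⟫_ℝ| ≤ l * ‖v - u‖ ^ 2 := by
  have hseg : segment ℝ u v ⊆ S := hS.segment_subset hu hv
  have key := (convex_segment u v).norm_image_sub_le_of_norm_hasFDerivWithin_le' (𝕜 := ℝ)
    (f := F) (f' := fun w => innerSL ℝ (G w)) (φ := innerSL ℝ (G u)) (C := l * ‖v - u‖)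
    (fun w hw => (hF w (hseg hw)).hasFDerivWithinAt)
    (fun w hw => by
      rw [← map_sub, innerSL_apply_norm]
      refine (hG u hu w (hseg hw)).trans (mul_le_mul_of_nonneg_left ?_ hl)
      obtain ⟨t, ht, rfl⟩ := (segment_eq_image' ℝ u v) ▸ hw
      rw [add_sub_cancel_left, norm_smul, Real.norm_of_nonneg ht.1]
      exact mul_le_of_le_one_left (norm_nonneg _) ht.2)
    (left_mem_segment ℝ u v) (right_mem_segment ℝ u v)
  rw [innerSL_apply_apply, Real.norm_eq_abs] at key
  rw [pow_two, ← mul_assoc]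
  exact key

lemma SmoothOn.quadX (h : SmoothOn X Y φ l) (hX : Convex ℝ X) (hY : Convex ℝ Y)
    (hl : 0 ≤ l) {x x' : Vec m} {y : Vec n} (hx : x ∈ X) (hx' : x' ∈ X) (hy : y ∈ Y) :
    |φ x' y - φ x y - ⟪gradX φ x y, x' - x⟫_ℝ| ≤ l * ‖x' - x‖ ^ 2 :=
  abs_sub_sub_inner_le (F := fun x => φ x y) (G := fun x => gradX φ x y) hX hl
    (fun _ hu => hasFDerivAt_gradX (h.differentiableAt hu hy))
    (fun u hu v hv => by simpa using h.gradX_lip hX hY hl hu hv hy hy) hx hx'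

lemma SmoothOn.quadY (h : SmoothOn X Y φ l) (hX : Convex ℝ X) (hY : Convex ℝ Y)
    (hl : 0 ≤ l) {x : Vec m} {y y' : Vec n} (hx : x ∈ X) (hy : y ∈ Y) (hy' : y' ∈ Y) :
    |φ x y' - φ x y - ⟪gradY φ x y, y' - y⟫_ℝ| ≤ l * ‖y' - y‖ ^ 2 :=
  abs_sub_sub_inner_le (F := fun y => φ x y) (G := fun y => gradY φ x y) hY hl
    (fun _ hu => hasFDerivAt_gradY (h.differentiableAt hx hu))
    (fun u hu v hv => by simpa using h.gradY_lip hX hY hl hx hx hu hv) hy hy'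

lemma SmoothOn.continuousOn (h : SmoothOn X Y φ l) :
    ContinuousOn (fun p : Vec m × Vec n => φ p.1 p.2) (X ×ˢ Y) := by
  intro p hp
  have h1 : ContinuousAt (joint φ)
      ((WithLp.prodContinuousLinearEquiv 2 ℝ (Vec m) (Vec n)).symm p) :=
    (h p.1 hp.1 p.2 hp.2).1.continuousAt
  exact (ContinuousAt.comp (g := joint φ) h1
    (WithLp.prodContinuousLinearEquiv 2 ℝ (Vec m) (Vec n)).symm.continuous.continuousAt
    ).continuousWithinAt

lemma gradX_h {P : Problem m n} {x : Vec m} {y : Vec n}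
    (hf : DifferentiableAt ℝ (joint P.f) (WithLp.toLp 2 (x, y)))
    (hg : DifferentiableAt ℝ (joint P.g) (WithLp.toLp 2 (x, y))) (σ : ℝ) :
    gradX (P.h σ) x y = σ • gradX P.f x y + gradX P.g x y := by
  have := ((hasFDerivAt_gradX hf).const_mul σ).add (hasFDerivAt_gradX hg)
  rw [← map_smul, ← map_add] at this
  exact (hasGradientAt_iff_hasFDerivAt.2 this).gradient

lemma gradY_h {P : Problem m n} {x : Vec m} {y : Vec n}
    (hf : DifferentiableAt ℝ (joint P.f) (WithLp.toLp 2 (x, y)))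
    (hg : DifferentiableAt ℝ (joint P.g) (WithLp.toLp 2 (x, y))) (σ : ℝ) :
    gradY (P.h σ) x y = σ • gradY P.f x y + gradY P.g x y := by
  have := ((hasFDerivAt_gradY hf).const_mul σ).add (hasFDerivAt_gradY hg)
  rw [← map_smul, ← map_add] at this
  exact (hasGradientAt_iff_hasFDerivAt.2 this).gradient

lemma SmoothOn.mono (h : SmoothOn X Y φ l) (hl : l ≤ l') : SmoothOn X Y φ l' :=
  fun x hx y hy => ⟨(h x hx y hy).1, (h x hx y hy).2.trans hl⟩

lemma norm_fderiv_const_smul_add_le {E W : Type*} [NormedAddCommGroup E] [NormedSpace ℝ E]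
    [NormedAddCommGroup W] [NormedSpace ℝ W] {F G : E → W} {p : E} (hF : DifferentiableAt ℝ F p)
    (hG : DifferentiableAt ℝ G p) {σ : ℝ} (hσ : 0 ≤ σ) (hl : ‖fderiv ℝ F p‖ ≤ l)
    (hl' : ‖fderiv ℝ G p‖ ≤ l') : ‖fderiv ℝ (σ • F + G) p‖ ≤ σ * l + l' := by
  rw [fderiv_add (hF.const_smul σ) hG, fderiv_const_smul hF]
  refine (norm_add_le _ _).trans (add_le_add ?_ hl')
  rw [norm_smul, Real.norm_of_nonneg hσ]
  exact mul_le_mul_of_nonneg_left hl hσ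

lemma norm_fderiv_fderiv_const_smul_add_le {E : Type*} [NormedAddCommGroup E] [NormedSpace ℝ E]
    {F G : E → ℝ} {p : E} (hF : ContDiffAt ℝ 2 F p) (hG : ContDiffAt ℝ 2 G p) {σ : ℝ}
    (hσ : 0 ≤ σ) (hl : ‖fderiv ℝ (fderiv ℝ F) p‖ ≤ l) (hl' : ‖fderiv ℝ (fderiv ℝ G) p‖ ≤ l') :
    ‖fderiv ℝ (fderiv ℝ (σ • F + G)) p‖ ≤ σ * l + l' := by
  have hev : fderiv ℝ (σ • F + G) =ᶠ[nhds p] σ • fderiv ℝ F + fderiv ℝ G := by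
    filter_upwards [hF.eventually (by norm_num), hG.eventually (by norm_num)] with q h1 h2
    have d1 : DifferentiableAt ℝ F q := h1.differentiableAt (by norm_num)
    have d2 : DifferentiableAt ℝ G q := h2.differentiableAt (by norm_num)
    rw [fderiv_add (d1.const_smul σ) d2, fderiv_const_smul d1]
    rfl
  rw [hev.fderiv_eq]
  exact norm_fderiv_const_smul_add_le
    ((hF.fderiv_right (m := 1) (by norm_num)).differentiableAt (by norm_num))
    ((hG.fderiv_right (m := 1) (by norm_num)).differentiableAt (by norm_num)) hσ hl hl'

lemma SmoothOn.const_mul_add (hφ : SmoothOn X Y φ l) (hψ : SmoothOn X Y ψ l') {σ : ℝ}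
    (hσ : 0 ≤ σ) : SmoothOn X Y (fun x y => σ * φ x y + ψ x y) (σ * l + l') :=
  fun x hx y hy => ⟨((hφ x hx y hy).1.const_smul σ).add (hψ x hx y hy).1,
    norm_fderiv_fderiv_const_smul_add_le (hφ x hx y hy).1 (hψ x hx y hy).1 hσ
      (hφ x hx y hy).2 (hψ x hx y hy).2⟩

end Gradient

end BilevelSGD

namespace BilevelSGD

open scoped InnerProductSpace

/-! ### Minimal values, proximal points and envelopes -/

lemma minValue_eq {V : Type*} {Y : Set V} {φ : V → ℝ} {w : V} (hw : w ∈ argminSet Y φ) :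
    minValue Y φ = φ w := by
  have : Nonempty Y := ⟨⟨w, hw.1⟩⟩
  refine le_antisymm (ciInf_le ⟨φ w, ?_⟩ (⟨w, hw.1⟩ : Y)) (le_ciInf fun v => hw.2 v v.2)
  rintro _ ⟨v, rfl⟩
  exact hw.2 v v.2

section Prox

variable {m n : ℕ} {X : Set (Vec m)} {Y : Set (Vec n)} {φ : Vec m → Vec n → ℝ} {L ρ : ℝ}

lemma SmoothOn.continuousOn_right (h : SmoothOn X Y φ L) {x : Vec m} (hx : x ∈ X) :
    ContinuousOn (φ x) Y :=
  h.continuousOn.comp (f := fun y => (x, y)) (by fun_prop) fun _ hy => ⟨hx, hy⟩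

lemma exists_mem_argminSet {ψ : Vec n → ℝ} (hY : IsCompact Y) (hne : Y.Nonempty)
    (hψ : ContinuousOn ψ Y) : (argminSet Y ψ).Nonempty := by
  obtain ⟨w, hw, h⟩ := hY.exists_isMinOn hne hψ
  exact ⟨w, hw, fun v hv => h hv⟩

lemma prox_mem_proxSet (hY : IsCompact Y) (hne : Y.Nonempty) {ψ : Vec n → ℝ}
    (hψ : ContinuousOn ψ Y) (θ : Vec n) : prox Y ρ ψ θ ∈ proxSet Y ρ ψ θ :=
  Classical.epsilon_spec (p := fun w => w ∈ proxSet Y ρ ψ θ)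
    (exists_mem_argminSet hY hne ((hψ.const_smul ρ).add (by fun_prop)))

lemma prox_mem (hY : IsCompact Y) (hne : Y.Nonempty) {ψ : Vec n → ℝ}
    (hψ : ContinuousOn ψ Y) (θ : Vec n) : prox Y ρ ψ θ ∈ Y :=
  (prox_mem_proxSet hY hne hψ θ).1

lemma prox_mem_argminSet (hρ : 0 < ρ) (hY : IsCompact Y) (hne : Y.Nonempty) {ψ : Vec n → ℝ}
    (hψ : ContinuousOn ψ Y) (θ : Vec n) :
    prox Y ρ ψ θ ∈ argminSet Y fun w => ψ w + ‖w - θ‖ ^ 2 / (2 * ρ) := by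
  have h := prox_mem_proxSet (ρ := ρ) hY hne hψ θ
  refine ⟨h.1, fun v hv => ?_⟩
  have h2 := h.2 v hv
  simp only at h2
  have e : ∀ w : Vec n, ψ w + ‖w - θ‖ ^ 2 / (2 * ρ)
      = ρ⁻¹ * (ρ * ψ w + 1 / 2 * ‖w - θ‖ ^ 2) := fun w => by field_simp
  simp only [e]
  exact mul_le_mul_of_nonneg_left h2 (by positivity)

lemma envelope_eq (hρ : 0 < ρ) (hY : IsCompact Y) (hne : Y.Nonempty) {ψ : Vec n → ℝ}
    (hψ : ContinuousOn ψ Y) (θ : Vec n) :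
    envelope Y ρ ψ θ = ψ (prox Y ρ ψ θ) + ‖prox Y ρ ψ θ - θ‖ ^ 2 / (2 * ρ) :=
  minValue_eq (prox_mem_argminSet hρ hY hne hψ θ)

lemma envelope_le (hρ : 0 < ρ) (hY : IsCompact Y) {ψ : Vec n → ℝ}
    (hψ : ContinuousOn ψ Y) (θ : Vec n) {v : Vec n} (hv : v ∈ Y) :
    envelope Y ρ ψ θ ≤ ψ v + ‖v - θ‖ ^ 2 / (2 * ρ) := by
  rw [envelope_eq hρ hY ⟨v, hv⟩ hψ]
  exact (prox_mem_argminSet hρ hY ⟨v, hv⟩ hψ θ).2 v hv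

lemma minValue_le (hY : IsCompact Y) {ψ : Vec n → ℝ} (hψ : ContinuousOn ψ Y) {v : Vec n}
    (hv : v ∈ Y) : minValue Y ψ ≤ ψ v := by
  obtain ⟨w, hw⟩ := exists_mem_argminSet hY ⟨v, hv⟩ hψ
  rw [minValue_eq hw]
  exact hw.2 v hv

lemma minValue_le_envelope (hρ : 0 < ρ) (hY : IsCompact Y) (hne : Y.Nonempty) {ψ : Vec n → ℝ}
    (hψ : ContinuousOn ψ Y) (θ : Vec n) : minValue Y ψ ≤ envelope Y ρ ψ θ := by
  rw [envelope_eq hρ hY hne hψ]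
  exact (minValue_le hY hψ (prox_mem hY hne hψ θ)).trans (le_add_of_nonneg_right (by positivity))

/-- Variational inequality of the proximal point. -/
lemma SmoothOn.prox_inner_nonneg (h : SmoothOn X Y φ L) (hY : IsCompact Y) (hYc : Convex ℝ Y)
    (hρ : 0 < ρ) {x : Vec m} (hx : x ∈ X) (θ : Vec n) {q : Vec n} (hq : q ∈ Y) :
    0 ≤ ⟪gradY φ x (prox Y ρ (φ x) θ) + ρ⁻¹ • (prox Y ρ (φ x) θ - θ),
      q - prox Y ρ (φ x) θ⟫_ℝ := by
  have hm := prox_mem_proxSet (ρ := ρ) hY ⟨q, hq⟩ (h.continuousOn_right hx) θ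
  set w := prox Y ρ (φ x) θ
  have hd1 := (hasFDerivAt_gradY (h.differentiableAt hx hm.1)).const_mul ρ
  have hd2 := (((hasFDerivAt_id (𝕜 := ℝ) w).sub_const θ).norm_sq).const_mul (1 / 2)
  have key := IsLocalMinOn.hasFDerivWithinAt_nonneg (y := q - w)
    (isMinOn_iff.2 hm.2).localize (hd1.add hd2).hasFDerivWithinAt
    (sub_mem_posTangentConeAt_of_segment_subset (hYc.segment_subset hm.1 hq))
  simp only [one_div, id_eq, nsmul_eq_mul, Nat.cast_ofNat, _root_.add_apply,
    _root_.smul_apply, innerSL_apply_apply, smul_eq_mul] at key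
  have e : ⟪gradY φ x w + ρ⁻¹ • (w - θ), q - w⟫_ℝ
      = ρ⁻¹ * (ρ * ⟪gradY φ x w, q - w⟫_ℝ + ⟪w - θ, q - w⟫_ℝ) := by
    rw [inner_add_left, inner_smul_left]
    simp only [conj_trivial]
    field_simp
  rw [e]
  refine mul_nonneg (by positivity) (key.trans_eq ?_)
  simp [inner_sub_left]

lemma norm_sub_sq_expand {k : ℕ} (w θ q : Vec k) :
    ‖q - θ‖ ^ 2 = ‖w - θ‖ ^ 2 + 2 * ⟪w - θ, q - w⟫_ℝ + ‖q - w‖ ^ 2 := by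
  rw [← norm_add_sq_real, sub_add_sub_comm, add_comm w q, add_sub_add_right_eq_sub]

/-- Quadratic growth of the proximal objective. -/
lemma SmoothOn.prox_growth (h : SmoothOn X Y φ L) (hX : Convex ℝ X) (hY : IsCompact Y)
    (hYc : Convex ℝ Y) (hL : 0 ≤ L) (hρ : 0 < ρ) {x : Vec m} (hx : x ∈ X) (θ : Vec n)
    {q : Vec n} (hq : q ∈ Y) :
    φ x (prox Y ρ (φ x) θ) + ‖prox Y ρ (φ x) θ - θ‖ ^ 2 / (2 * ρ)
      + (1 / (2 * ρ) - L) * ‖q - prox Y ρ (φ x) θ‖ ^ 2 ≤ φ x q + ‖q - θ‖ ^ 2 / (2 * ρ) := by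
  have hv := h.prox_inner_nonneg hY hYc hρ hx θ hq
  have hw := prox_mem (ρ := ρ) hY ⟨q, hq⟩ (h.continuousOn_right hx) θ
  set w := prox Y ρ (φ x) θ
  have h2 := (abs_le.1 (h.quadY hX hYc hL hx hw hq)).1
  have h3 := norm_sub_sq_expand w θ q
  rw [inner_add_left, inner_smul_left, conj_trivial] at hv
  have h4 : ‖q - θ‖ ^ 2 / (2 * ρ) = ‖w - θ‖ ^ 2 / (2 * ρ) + ρ⁻¹ * ⟪w - θ, q - w⟫_ℝ
      + 1 / (2 * ρ) * ‖q - w‖ ^ 2 := by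
    rw [h3]; field_simp
  linarith

/-- The proximal point is Lipschitz in the outer variable and in the centre. -/
lemma SmoothOn.prox_lip (h : SmoothOn X Y φ L) (hX : Convex ℝ X) (hY : IsCompact Y)
    (hYc : Convex ℝ Y) (hL : 0 ≤ L) (hρ : 0 < ρ) (hρL : ρ * L ≤ 1 / 2) {x x' : Vec m}
    (hx : x ∈ X) (hx' : x' ∈ X) (hne : Y.Nonempty) (θ θ' : Vec n) :
    ‖prox Y ρ (φ x') θ' - prox Y ρ (φ x) θ‖ ≤ 2 * (ρ * L) * ‖x' - x‖ + 2 * ‖θ' - θ‖ := by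
  have hw := prox_mem (ρ := ρ) hY hne (h.continuousOn_right hx) θ
  have hw' := prox_mem (ρ := ρ) hY hne (h.continuousOn_right hx') θ'
  have v1 := h.prox_inner_nonneg hY hYc hρ hx θ hw'
  have v2 := h.prox_inner_nonneg hY hYc hρ hx' θ' hw
  set w := prox Y ρ (φ x) θ
  set w' := prox Y ρ (φ x') θ'
  have hg := h.gradY_lip hX hYc hL hx hx' hw hw'
  have c1 := real_inner_le_norm (gradY φ x w - gradY φ x' w') (w' - w)
  have c2 := real_inner_le_norm (θ' - θ) (w' - w)
  rw [norm_sub_rev] at hg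
  have hsq : ‖w' - w‖ ^ 2 ≤ ρ * ⟪gradY φ x w - gradY φ x' w', w' - w⟫_ℝ
      + ⟪θ' - θ, w' - w⟫_ℝ := by
    rw [← real_inner_self_eq_norm_sq]
    have h1 := mul_nonneg hρ.le (add_nonneg v1 v2)
    simp only [inner_sub_left, inner_sub_right, inner_add_left, inner_smul_left, conj_trivial]
      at h1 ⊢
    have e : ρ * ρ⁻¹ = 1 := mul_inv_cancel₀ hρ.ne'
    linear_combination h1 - (⟪w', w'⟫_ℝ - ⟪θ', w'⟫_ℝ - ⟪w', w⟫_ℝ + ⟪θ', w⟫_ℝ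
      - ⟪w, w'⟫_ℝ + ⟪θ, w'⟫_ℝ + ⟪w, w⟫_ℝ - ⟪θ, w⟫_ℝ) * e
  set d := ‖w' - w‖
  have hd : 0 ≤ d := norm_nonneg _
  have h3 : ‖gradY φ x w - gradY φ x' w'‖ * d ≤ L * (‖x' - x‖ + d) * d :=
    mul_le_mul_of_nonneg_right hg hd
  have h4 : d ^ 2 ≤ (ρ * L * ‖x' - x‖ + ‖θ' - θ‖ + d / 2) * d := by
    have := mul_le_mul_of_nonneg_left (c1.trans h3) hρ.le
    have h5 : ρ * L * (d * d) ≤ 1 / 2 * (d * d) := mul_le_mul_of_nonneg_right hρL (by positivity)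
    nlinarith
  by_contra! hlt
  have hb : 0 ≤ 2 * (ρ * L) * ‖x' - x‖ + 2 * ‖θ' - θ‖ := by positivity
  nlinarith

end Prox

/-! ### Standing assumptions on the deterministic problem -/

/-- Consequences of the regularity assumptions and of the proximal error bound, for penalties
up to `s`; `L` is a common smoothness constant and `2 / q` the error bound constant. -/
structure Problem.Tame {m n : ℕ} (P : Problem m n) (ρ L q Cf s : ℝ) : Prop where
  closed_X : IsClosed P.X
  convex_X : Convex ℝ P.X
  compact_Y : IsCompact P.Y
  convex_Y : Convex ℝ P.Y
  ρ_pos : 0 < ρ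
  L_pos : 0 < L
  ρL_le : ρ * L ≤ 1 / 8
  q_pos : 0 < q
  ρq_le : ρ * q ≤ 1
  smooth_g : SmoothOn P.X P.Y P.g L
  smooth_h : ∀ σ ∈ Set.Icc 0 s, SmoothOn P.X P.Y (P.h σ) L
  bound_f : ∀ x ∈ P.X, ∀ y ∈ P.Y, |P.f x y| ≤ Cf
  error_bound : ∀ x ∈ P.X, ∀ σ ∈ Set.Icc 0 s, ∀ y ∈ P.Y,
    Metric.infDist y (P.solSet x σ) ≤ 2 / q * (ρ⁻¹ * ‖y - prox P.Y ρ (P.h σ x) y‖)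

namespace Problem.Tame

variable {m n : ℕ} {P : Problem m n} {ρ L q Cf s : ℝ}

lemma s_nonneg_mem (hs : 0 ≤ s) : (0 : ℝ) ∈ Set.Icc 0 s := ⟨le_rfl, hs⟩

lemma h_zero (x : Vec m) : P.h 0 x = P.g x := by
  ext y; simp [Problem.h]

lemma two_div_q (hP : P.Tame ρ L q Cf s) : ρ ≤ 2 / q := by
  rw [le_div_iff₀ hP.q_pos]
  linarith [hP.ρq_le]

lemma prox_h_mem (hP : P.Tame ρ L q Cf s) {x : Vec m} (hx : x ∈ P.X) (hne : P.Y.Nonempty) {σ : ℝ}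
    (hσ : σ ∈ Set.Icc 0 s) (y : Vec n) : prox P.Y ρ (P.h σ x) y ∈ P.Y :=
  prox_mem hP.compact_Y hne ((hP.smooth_h σ hσ).continuousOn_right hx) y

lemma prox_g_mem (hP : P.Tame ρ L q Cf s) {x : Vec m} (hx : x ∈ P.X) (hne : P.Y.Nonempty)
    (y : Vec n) : prox P.Y ρ (P.g x) y ∈ P.Y :=
  prox_mem hP.compact_Y hne (hP.smooth_g.continuousOn_right hx) y

/-- The perturbed solution set moves in a controlled way with the outer variable. -/
lemma exists_mem_solSet (hP : P.Tame ρ L q Cf s) {x x' : Vec m} (hx : x ∈ P.X) (hx' : x' ∈ P.X)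
    {σ : ℝ} (hσ : σ ∈ Set.Icc 0 s) {y : Vec n} (hy : y ∈ P.Y) :
    ∃ p ∈ P.solSet x' σ, ‖p - y‖
      ≤ 2 / q * (ρ⁻¹ * ‖y - prox P.Y ρ (P.h σ x) y‖ + 2 * L * ‖x' - x‖) := by
  have hc := (hP.smooth_h σ hσ).continuousOn_right hx'
  obtain ⟨p0, hp0⟩ := exists_mem_argminSet hP.compact_Y ⟨y, hy⟩ hc
  have hset : P.solSet x' σ = {v ∈ P.Y | P.h σ x' v ∈ Set.Iic (P.h σ x' p0)} := by
    ext v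
    exact ⟨fun hv => ⟨hv.1, hv.2 p0 hp0.1⟩, fun hv => ⟨hv.1, fun u hu => hv.2.trans (hp0.2 u hu)⟩⟩
  have hclosed : IsClosed (P.solSet x' σ) := by
    rw [hset]
    exact hc.preimage_isClosed_of_isClosed hP.compact_Y.isClosed isClosed_Iic
  obtain ⟨p, hp, hd⟩ := hclosed.exists_infDist_eq_dist ⟨p0, hp0⟩ y
  refine ⟨p, hp, ?_⟩
  rw [← dist_eq_norm, dist_comm, ← hd]
  refine (hP.error_bound x' hx' σ hσ y hy).trans
    (mul_le_mul_of_nonneg_left ?_ (div_nonneg zero_le_two hP.q_pos.le))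
  have hl := (hP.smooth_h σ hσ).prox_lip hP.convex_X hP.compact_Y hP.convex_Y hP.L_pos.le hP.ρ_pos
    (hP.ρL_le.trans (by norm_num)) hx hx' ⟨y, hy⟩ y y
  rw [sub_self, norm_zero, mul_zero, add_zero] at hl
  have h1 := norm_sub_le_norm_sub_add_norm_sub y (prox P.Y ρ (P.h σ x) y)
    (prox P.Y ρ (P.h σ x') y)
  rw [norm_sub_rev (prox P.Y ρ (P.h σ x) y)] at h1
  have h2 : ρ⁻¹ * ‖y - prox P.Y ρ (P.h σ x') y‖
      ≤ ρ⁻¹ * (‖y - prox P.Y ρ (P.h σ x) y‖ + 2 * (ρ * L) * ‖x' - x‖) :=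
    mul_le_mul_of_nonneg_left (h1.trans (by linarith)) (inv_nonneg.2 hP.ρ_pos.le)
  refine h2.trans_eq ?_
  have := hP.ρ_pos.ne'
  field_simp

/-- The proximal point is Hölder continuous in the penalty. -/
lemma prox_penalty_sq_le (hP : P.Tame ρ L q Cf s) {x : Vec m} (hx : x ∈ P.X) {y : Vec n}
    (hne : P.Y.Nonempty) {σ σ' : ℝ} (hσ : σ ∈ Set.Icc 0 s) (hσ' : σ' ∈ Set.Icc 0 s)
    (hle : σ' ≤ σ) :
    ‖prox P.Y ρ (P.h σ' x) y - prox P.Y ρ (P.h σ x) y‖ ^ 2 ≤ 4 * ρ * (σ - σ') * Cf := by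
  have hw := hP.prox_h_mem hx hne hσ y
  have hw' := hP.prox_h_mem hx hne hσ' y
  have g1 := (hP.smooth_h σ hσ).prox_growth hP.convex_X hP.compact_Y hP.convex_Y hP.L_pos.le
    hP.ρ_pos hx y hw'
  have g2 := (hP.smooth_h σ' hσ').prox_growth hP.convex_X hP.compact_Y hP.convex_Y hP.L_pos.le
    hP.ρ_pos hx y hw
  set w := prox P.Y ρ (P.h σ x) y
  set w' := prox P.Y ρ (P.h σ' x) y
  have f1 := (abs_le.1 (hP.bound_f x hx w hw)).1
  have f2 := (abs_le.1 (hP.bound_f x hx w' hw')).2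
  rw [norm_sub_rev w w'] at g2
  simp only [Problem.h] at g1 g2
  have hρ := hP.ρ_pos
  have hL : L ≤ 1 / (8 * ρ) := by
    rw [le_div_iff₀ (by positivity)]; linarith [hP.ρL_le]
  have h1 : 1 / (4 * ρ) ≤ 1 / (2 * ρ) - L := by
    have e : 1 / (2 * ρ) - 1 / (8 * ρ) = 1 / (4 * ρ) + 1 / (8 * ρ) := by field_simp; norm_num
    have : 0 < 1 / (8 * ρ) := by positivity
    linarith
  have h2 : 2 * (1 / (4 * ρ)) * ‖w' - w‖ ^ 2 ≤ (σ - σ') * (2 * Cf) := by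
    have h3 := mul_le_mul_of_nonneg_right h1 (sq_nonneg ‖w' - w‖)
    have h4 := mul_le_mul_of_nonneg_left (show P.f x w' - P.f x w ≤ 2 * Cf by linarith)
      (sub_nonneg.2 hle)
    linarith
  have h5 := mul_le_mul_of_nonneg_left h2 (show 0 ≤ 2 * ρ by positivity)
  have e : 2 * ρ * (2 * (1 / (4 * ρ)) * ‖w' - w‖ ^ 2) = ‖w' - w‖ ^ 2 := by field_simp; norm_num
  linarith

/-- Movement of the proximal point of the penalised objective over one outer iteration. -/
lemma prox_h_drift (hP : P.Tame ρ L q Cf s) {x x' : Vec m} (hx : x ∈ P.X) (hx' : x' ∈ P.X)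
    (hne : P.Y.Nonempty) (y y' : Vec n) {σ σ' : ℝ} (hσ : σ ∈ Set.Icc 0 s)
    (hσ' : σ' ∈ Set.Icc 0 s) (hle : σ' ≤ σ) :
    ‖prox P.Y ρ (P.h σ' x') y' - prox P.Y ρ (P.h σ x) y‖ ^ 2
      ≤ 12 * ((ρ * L) ^ 2 * ‖x' - x‖ ^ 2 + ‖y' - y‖ ^ 2 + ρ * (σ - σ') * Cf) := by
  have h1 := hP.prox_penalty_sq_le hx' (y := y') hne hσ hσ' hle
  have h2 := (hP.smooth_h σ hσ).prox_lip hP.convex_X hP.compact_Y hP.convex_Y hP.L_pos.le hP.ρ_pos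
    (hP.ρL_le.trans (by norm_num)) hx hx' hne y y'
  have h3 := norm_sub_le_norm_sub_add_norm_sub (prox P.Y ρ (P.h σ' x') y')
    (prox P.Y ρ (P.h σ x') y') (prox P.Y ρ (P.h σ x) y)
  have hd := norm_nonneg (prox P.Y ρ (P.h σ' x') y' - prox P.Y ρ (P.h σ x) y)
  have h4 := pow_le_pow_left₀ hd (h3.trans (add_le_add_right h2 _)) 2
  refine h4.trans ?_
  generalize ‖prox P.Y ρ (P.h σ' x') y' - prox P.Y ρ (P.h σ x') y'‖ = d at *
  have h5 := sq_nonneg (d - 2 * (ρ * L) * ‖x' - x‖)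
  have h6 := sq_nonneg (d - 2 * ‖y' - y‖)
  have h7 := sq_nonneg (2 * (ρ * L) * ‖x' - x‖ - 2 * ‖y' - y‖)
  linarith

/-- Movement of the proximal point of the unpenalised objective over one outer iteration. -/
lemma prox_g_drift (hP : P.Tame ρ L q Cf s) {x x' : Vec m} (hx : x ∈ P.X) (hx' : x' ∈ P.X)
    (hne : P.Y.Nonempty) (z z' : Vec n) :
    ‖prox P.Y ρ (P.g x') z' - prox P.Y ρ (P.g x) z‖ ^ 2
      ≤ 12 * ((ρ * L) ^ 2 * ‖x' - x‖ ^ 2 + ‖z' - z‖ ^ 2) := by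
  have h2 := hP.smooth_g.prox_lip hP.convex_X hP.compact_Y hP.convex_Y hP.L_pos.le hP.ρ_pos
    (hP.ρL_le.trans (by norm_num)) hx hx' hne z z'
  have h4 := pow_le_pow_left₀ (norm_nonneg _) h2 2
  refine h4.trans ?_
  have h7 := sq_nonneg (2 * (ρ * L) * ‖x' - x‖ - 2 * ‖z' - z‖)
  have h8 := sq_nonneg (ρ * L * ‖x' - x‖)
  have h9 := sq_nonneg ‖z' - z‖
  linarith

/-- Upper first-order expansion of an envelope. -/
lemma envelope_step (hP : P.Tame ρ L q Cf s) {φ : Vec m → Vec n → ℝ} (hφ : SmoothOn P.X P.Y φ L)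
    {x x' : Vec m} (hx : x ∈ P.X) (hx' : x' ∈ P.X) (hne : P.Y.Nonempty) (y y' : Vec n) :
    envelope P.Y ρ (φ x') y' ≤ envelope P.Y ρ (φ x) y
      + ⟪gradX φ x (prox P.Y ρ (φ x) y), x' - x⟫_ℝ + L * ‖x' - x‖ ^ 2
      + (⟪ρ⁻¹ • (y - prox P.Y ρ (φ x) y), y' - y⟫_ℝ + ‖y' - y‖ ^ 2 / (2 * ρ)) := by
  have hw := prox_mem (ρ := ρ) hP.compact_Y hne (hφ.continuousOn_right hx) y
  rw [envelope_eq hP.ρ_pos hP.compact_Y hne (hφ.continuousOn_right hx)]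
  refine (envelope_le hP.ρ_pos hP.compact_Y (hφ.continuousOn_right hx') y' hw).trans ?_
  set w := prox P.Y ρ (φ x) y
  have h1 := (abs_le.1 (hφ.quadX hP.convex_X hP.convex_Y hP.L_pos.le hx hx' hw)).2
  have h2 : ‖w - y'‖ ^ 2 = ‖w - y‖ ^ 2 + 2 * ⟪y - w, y' - y⟫_ℝ + ‖y' - y‖ ^ 2 := by
    rw [norm_sub_rev w y', norm_sub_rev w y, norm_sub_sq_expand y w y']
  have h3 : ‖w - y'‖ ^ 2 / (2 * ρ) = ‖w - y‖ ^ 2 / (2 * ρ) + ρ⁻¹ * ⟪y - w, y' - y⟫_ℝ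
      + ‖y' - y‖ ^ 2 / (2 * ρ) := by
    have := hP.ρ_pos.ne'
    rw [h2]; field_simp
  rw [inner_smul_left, conj_trivial]
  linarith

/-- Lower first-order expansion of the lower-level value function. -/
lemma minValue_step (hP : P.Tame ρ L q Cf s) (hs : 0 ≤ s) {x x' : Vec m} (hx : x ∈ P.X)
    (hx' : x' ∈ P.X) {z : Vec n} (hz : z ∈ P.Y) :
    minValue P.Y (P.g x) + ⟪gradX P.g x (prox P.Y ρ (P.g x) z), x' - x⟫_ℝ
      - L * (2 * (2 / q) * (ρ⁻¹ * ‖z - prox P.Y ρ (P.g x) z‖ + 2 * L * ‖x' - x‖)) * ‖x' - x‖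
      - L * ‖x' - x‖ ^ 2 ≤ minValue P.Y (P.g x') := by
  obtain ⟨p, hp, hpz⟩ := hP.exists_mem_solSet hx hx' (s_nonneg_mem hs) hz
  rw [Problem.solSet, h_zero] at hp
  rw [h_zero] at hpz
  rw [minValue_eq hp]
  have hw := hP.prox_g_mem hx ⟨z, hz⟩ z
  set w := prox P.Y ρ (P.g x) z
  have h1 := (abs_le.1 (hP.smooth_g.quadX hP.convex_X hP.convex_Y hP.L_pos.le hx hx' hp.1)).1
  have h2 := minValue_le hP.compact_Y (hP.smooth_g.continuousOn_right hx) hp.1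
  have h3 := hP.smooth_g.gradX_lip hP.convex_X hP.convex_Y hP.L_pos.le hx hx hp.1 hw
  rw [sub_self, norm_zero, zero_add] at h3
  have h4 : ‖w - p‖ ≤ 2 * (2 / q) * (ρ⁻¹ * ‖z - w‖ + 2 * L * ‖x' - x‖) := by
    have e : ‖z - w‖ ≤ 2 / q * (ρ⁻¹ * ‖z - w‖) := by
      have h5 := mul_le_mul_of_nonneg_right hP.two_div_q
        (show 0 ≤ ρ⁻¹ * ‖z - w‖ from mul_nonneg (inv_nonneg.2 hP.ρ_pos.le) (norm_nonneg _))
      rwa [mul_inv_cancel_left₀ hP.ρ_pos.ne'] at h5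
    have h6 := norm_sub_le_norm_sub_add_norm_sub w z p
    rw [norm_sub_rev w z, norm_sub_rev z p] at h6
    have h7 : 0 ≤ 2 / q * (2 * L * ‖x' - x‖) := by
      have := hP.L_pos.le; have := hP.q_pos.le; positivity
    linarith
  have h5 := real_inner_le_norm (gradX P.g x w - gradX P.g x p) (x' - x)
  rw [inner_sub_left] at h5
  have h6 : ‖gradX P.g x w - gradX P.g x p‖ * ‖x' - x‖
      ≤ L * (2 * (2 / q) * (ρ⁻¹ * ‖z - w‖ + 2 * L * ‖x' - x‖)) * ‖x' - x‖ :=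
    mul_le_mul_of_nonneg_right (h3.trans (mul_le_mul_of_nonneg_left h4 hP.L_pos.le))
      (norm_nonneg _)
  linarith

/-- The envelope exceeds the lower-level value by a multiple of the squared residual. -/
lemma envelope_h_le (hP : P.Tame ρ L q Cf s) {x x' : Vec m} (hx : x ∈ P.X)
    (hx' : x' ∈ P.X) {σ : ℝ} (hσ : σ ∈ Set.Icc 0 s) {y : Vec n} (hy : y ∈ P.Y) (y' : Vec n) :
    envelope P.Y ρ (P.h σ x') y' ≤ minValue P.Y (P.g x') + σ * Cf
      + 3 / (2 * ρ) * ((2 / q) ^ 2 * (ρ⁻¹ * ‖y - prox P.Y ρ (P.h σ x) y‖) ^ 2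
        + 4 * (2 / q) ^ 2 * L ^ 2 * ‖x' - x‖ ^ 2 + ‖y' - y‖ ^ 2) := by
  obtain ⟨p, hp, hpy⟩ := hP.exists_mem_solSet hx hx' hσ hy
  have hρ := hP.ρ_pos
  obtain ⟨v, hv⟩ := exists_mem_argminSet hP.compact_Y ⟨y, hy⟩
    (hP.smooth_g.continuousOn_right hx')
  refine (envelope_le hρ hP.compact_Y ((hP.smooth_h σ hσ).continuousOn_right hx') y' hp.1).trans ?_
  have h1 := hp.2 v hv.1
  have h2 := mul_le_mul_of_nonneg_left (abs_le.1 (hP.bound_f x' hx' v hv.1)).2 hσ.1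
  have h3 : P.h σ x' v = σ * P.f x' v + P.g x' v := rfl
  rw [minValue_eq hv]
  have h4 := norm_sub_le_norm_sub_add_norm_sub p y y'
  rw [norm_sub_rev y y'] at h4
  have h5 := pow_le_pow_left₀ (norm_nonneg _) (h4.trans (add_le_add_left hpy _)) 2
  have h6 : ‖p - y'‖ ^ 2 ≤ 3 * ((2 / q) ^ 2 * (ρ⁻¹ * ‖y - prox P.Y ρ (P.h σ x) y‖) ^ 2
        + 4 * (2 / q) ^ 2 * L ^ 2 * ‖x' - x‖ ^ 2 + ‖y' - y‖ ^ 2) := by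
    refine h5.trans ?_
    generalize ρ⁻¹ * ‖y - prox P.Y ρ (P.h σ x) y‖ = d
    generalize 2 / q = κ
    have := sq_nonneg (κ * d - 2 * κ * L * ‖x' - x‖)
    have := sq_nonneg (κ * d - ‖y' - y‖)
    have := sq_nonneg (2 * κ * L * ‖x' - x‖ - ‖y' - y‖)
    linarith
  have h7 := div_le_div_of_nonneg_right h6 (show 0 ≤ 2 * ρ by positivity)
  rw [mul_div_right_comm] at h7
  linarith

end Problem.Tame

end BilevelSGD

namespace BilevelSGD

open scoped InnerProductSpace

/-! ### Scalar inequalities of one outer iteration -/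

lemma two_mul_mul_le {c : ℝ} (hc : 0 < c) (t a : ℝ) : 2 * t * a ≤ a ^ 2 / c + c * t ^ 2 := by
  have h : a ^ 2 / c + c * t ^ 2 - 2 * t * a = (a - c * t) ^ 2 / c := by
    field_simp; ring
  have : 0 ≤ (a - c * t) ^ 2 / c := by positivity
  linarith

lemma sq_le_of_le_add {r e d c : ℝ} (hc : 0 < c) (hr : 0 ≤ r) (h : r ≤ e + d) :
    r ^ 2 ≤ (1 + c) * e ^ 2 + (1 + c⁻¹) * d ^ 2 := by
  have h1 := two_mul_mul_le hc e d
  have h2 := pow_le_pow_left₀ hr h 2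
  rw [div_eq_inv_mul] at h1
  linarith

/-- The smallness conditions on the parameters of one outer iteration; `κ` is the constant of the
error bound, `lam` and `lam'` are the contraction rates of this and of the next inner loop. -/
structure StepSmall (C Cw ρ L κ α β σ σ' lam lam' : ℝ) : Prop where
  C_ge : 4 ≤ C
  Cw_ge : 1 ≤ Cw
  ρ_pos : 0 < ρ
  L_pos : 0 < L
  α_pos : 0 < α
  β_pos : 0 < β
  σ'_pos : 0 < σ'
  lam_pos : 0 < lam
  σ_le : σ' ≤ σ
  lip : 2 * C * L * α ≤ 1 / 16
  lip_sq : 4 * C * L ^ 2 * κ * α ≤ 1 / 16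
  cross : 16 * C ^ 2 * L ^ 2 * κ ^ 2 * α ≤ ρ * β / 16
  decay : 3 * C / (2 * ρ) * ((σ - σ') / σ') * κ ^ 2 ≤ ρ * β / 16
  decay_x : 8 * (α * ρ * β * L ^ 2) ≤ 1
  decay_rate : (σ - σ') / σ' ≤ lam / 8
  lam_le : lam ≤ 1 / 4
  drift_x : 240 * Cw * ρ * L ^ 2 * α ≤ 1 / 8
  drift_y : (4 * C + 240 * Cw) * β ≤ 1 / 8
  absorb : (C + 1) * (β / ρ) + 4 * α * L ^ 2 ≤ Cw * lam ^ 2 / (4 * ρ)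
  growth : lam' ≤ (1 + lam / 8) * lam

namespace StepSmall

variable {C Cw ρ L κ α β σ σ' lam lam' : ℝ}

lemma decay_nonneg (h : StepSmall C Cw ρ L κ α β σ σ' lam lam') : 0 ≤ (σ - σ') / σ' :=
  div_nonneg (sub_nonneg.2 h.σ_le) h.σ'_pos.le

lemma σ_pos (h : StepSmall C Cw ρ L κ α β σ σ' lam lam') : 0 < σ := h.σ'_pos.trans_le h.σ_le

lemma inv_eq (h : StepSmall C Cw ρ L κ α β σ σ' lam lam') :
    σ'⁻¹ = (1 + (σ - σ') / σ') * σ⁻¹ := by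
  have := h.σ_pos.ne'; have := h.σ'_pos.ne'
  field_simp; ring

/-- Decrease of the smoothed merit function at a fixed penalty. -/
lemma merit_le (h : StepSmall C Cw ρ L κ α β σ σ' lam lam')
    {F F' ip iy iz a Dy Dz ey ez by' bz gg : ℝ}
    (hF : F' ≤ F + ip + 2 * C * L * a ^ 2 + C * (L * (2 * κ * (Dz + 2 * L * a)) * a)
      + (iy + by' ^ 2 / (2 * ρ)) + (C - 1) * (iz + bz ^ 2 / (2 * ρ)))
    (hip : ip ≤ -(a ^ 2 / α) + gg * a)
    (hiy : iy ≤ -(β * ρ * Dy ^ 2) + β * (Dy * ey))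
    (hiz : iz ≤ -(β * ρ * Dz ^ 2) + β * (Dz * ez)) :
    F' ≤ F - 9 / 16 * (a ^ 2 / α) + α * gg ^ 2 - 11 / 16 * (β * ρ) * (Dy ^ 2 + Dz ^ 2)
      + C * (β / ρ) * (ey ^ 2 + ez ^ 2) + C / (2 * ρ) * (by' ^ 2 + bz ^ 2) := by
  have hα := h.α_pos
  have hβ := h.β_pos
  have hρ := h.ρ_pos
  have hC := h.C_ge
  have hA : a ^ 2 = α * (a ^ 2 / α) := by field_simp
  have hA0 : 0 ≤ a ^ 2 / α := by positivity
  have y1 : gg * a ≤ 1 / 4 * (a ^ 2 / α) + α * gg ^ 2 := by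
    have := two_mul_mul_le (c := 4 * α) (by positivity) (gg / 2) a
    have e : a ^ 2 / (4 * α) = 1 / 4 * (a ^ 2 / α) := by field_simp
    rw [e] at this
    linarith
  have y2 : 2 * (C * L * κ * Dz) * a ≤ 1 / 16 * (a ^ 2 / α) + ρ * β / 16 * Dz ^ 2 := by
    have h1 := two_mul_mul_le (c := 16 * α) (by positivity) (C * L * κ * Dz) a
    have e : a ^ 2 / (16 * α) = 1 / 16 * (a ^ 2 / α) := by field_simp
    rw [e] at h1
    have h2 := mul_le_mul_of_nonneg_right h.cross (sq_nonneg Dz)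
    linarith
  have y3 : 2 * C * L * a ^ 2 ≤ 1 / 16 * (a ^ 2 / α) := by
    have := mul_le_mul_of_nonneg_right h.lip hA0
    rwa [mul_assoc _ α, ← hA] at this
  have y4 : 4 * C * L ^ 2 * κ * a ^ 2 ≤ 1 / 16 * (a ^ 2 / α) := by
    have := mul_le_mul_of_nonneg_right h.lip_sq hA0
    rwa [mul_assoc _ α, ← hA] at this
  have yd : ∀ d e : ℝ, β * (d * e) ≤ 1 / 4 * (β * ρ * d ^ 2) + β / ρ * e ^ 2 := by
    intro d e
    have h1 := mul_le_mul_of_nonneg_left (two_mul_mul_le hρ (d / 2) e) hβ.le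
    have e1 : β * (e ^ 2 / ρ) = β / ρ * e ^ 2 := by ring
    linarith
  have y5 := yd Dy ey
  have y6 := yd Dz ez
  have y7 : (C - 1) * (iz + bz ^ 2 / (2 * ρ)) ≤ -(3 / 4 * (β * ρ * Dz ^ 2))
      + C * (β / ρ * ez ^ 2) + C * (bz ^ 2 / (2 * ρ)) := by
    have p1 : 0 ≤ β * ρ * Dz ^ 2 := by positivity
    have p2 : 0 ≤ β / ρ * ez ^ 2 := by positivity
    have p3 : 0 ≤ bz ^ 2 / (2 * ρ) := by positivity
    have q1 : iz ≤ -(3 / 4 * (β * ρ * Dz ^ 2)) + β / ρ * ez ^ 2 := by linarith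
    have q2 := mul_le_mul_of_nonneg_left (add_le_add_left q1 (bz ^ 2 / (2 * ρ)))
      (show 0 ≤ C - 1 by linarith)
    nlinarith
  have y10 : 0 ≤ β * ρ * Dy ^ 2 := by positivity
  have y8 : β / ρ * ey ^ 2 ≤ C * (β / ρ * ey ^ 2) :=
    le_mul_of_one_le_left (by positivity) (by linarith)
  have y9 : by' ^ 2 / (2 * ρ) ≤ C * (by' ^ 2 / (2 * ρ)) :=
    le_mul_of_one_le_left (by positivity) (by linarith)
  have e1 : C / (2 * ρ) * (by' ^ 2 + bz ^ 2)
    = C * (by' ^ 2 / (2 * ρ)) + C * (bz ^ 2 / (2 * ρ)) := by ring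
  linarith

/-- Decrease of the merit function divided by the penalty, when the penalty changes too. -/
lemma merit_div_le (h : StepSmall C Cw ρ L κ α β σ σ' lam lam')
    {F F' F₂ a Dy Dz ey ez by' bz gg Cf : ℝ}
    (hF : F' ≤ F - 9 / 16 * (a ^ 2 / α) + α * gg ^ 2 - 11 / 16 * (β * ρ) * (Dy ^ 2 + Dz ^ 2)
      + C * (β / ρ) * (ey ^ 2 + ez ^ 2) + C / (2 * ρ) * (by' ^ 2 + bz ^ 2))
    (hF₂ : F₂ ≤ F' + (σ - σ') * Cf)
    (hG : F' ≤ σ * Cf + 3 / (2 * ρ) * (κ ^ 2 * Dy ^ 2 + 4 * κ ^ 2 * L ^ 2 * a ^ 2 + by' ^ 2)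
      + (C - 1) * (3 / (2 * ρ) * (κ ^ 2 * Dz ^ 2 + 4 * κ ^ 2 * L ^ 2 * a ^ 2 + bz ^ 2))) :
    F₂ / σ' ≤ σ⁻¹ * (F - 1 / 2 * (a ^ 2 / α) + α * gg ^ 2 - 5 / 8 * (β * ρ) * (Dy ^ 2 + Dz ^ 2)
      + C * (β / ρ) * (ey ^ 2 + ez ^ 2) + 2 * C / ρ * (by' ^ 2 + bz ^ 2))
      + 2 * Cf * ((σ - σ') / σ') := by
  have hα := h.α_pos
  have hρ := h.ρ_pos
  have hC := h.C_ge
  have hσ := h.σ_pos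
  have hσ' := h.σ'_pos
  have hL := h.L_pos
  have hβ := h.β_pos
  have hτ := h.decay_nonneg
  have hτ1 : (σ - σ') / σ' ≤ 1 := by linarith [h.decay_rate, h.lam_le]
  have hdec := h.decay
  have hinv := h.inv_eq
  have hCf' : (σ - σ') * Cf / σ' = Cf * ((σ - σ') / σ') := by ring
  generalize (σ - σ') / σ' = τ at *
  have hA0 : 0 ≤ a ^ 2 / α := by positivity
  have hA : a ^ 2 = α * (a ^ 2 / α) := by field_simp
  have hG' : F' ≤ σ * Cf + 3 * C / (2 * ρ) * (κ ^ 2 * (Dy ^ 2 + Dz ^ 2)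
      + 4 * κ ^ 2 * L ^ 2 * a ^ 2 + (by' ^ 2 + bz ^ 2)) := by
    have p1 : 0 ≤ 3 / (2 * ρ) * (κ ^ 2 * Dy ^ 2 + by' ^ 2) := by positivity
    have p2 : 0 ≤ 3 / (2 * ρ) * (κ ^ 2 * Dz ^ 2 + bz ^ 2) := by positivity
    have p3 := mul_nonneg (show 0 ≤ C - 1 by linarith) p1
    have e : 3 * C / (2 * ρ) = C * (3 / (2 * ρ)) := by ring
    rw [e]
    linarith
  have k1 : τ * F' ≤ τ * (σ * Cf) + ρ * β / 16 * (Dy ^ 2 + Dz ^ 2) + 1 / 16 * (a ^ 2 / α)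
      + 3 * C / (2 * ρ) * (by' ^ 2 + bz ^ 2) := by
    have q1 := mul_le_mul_of_nonneg_left hG' hτ
    have q2 := mul_le_mul_of_nonneg_right hdec (show 0 ≤ Dy ^ 2 + Dz ^ 2 by positivity)
    have q3 := mul_le_mul_of_nonneg_right hdec (show 0 ≤ 4 * L ^ 2 * a ^ 2 by positivity)
    have q4 : ρ * β / 16 * (4 * L ^ 2 * a ^ 2) ≤ 1 / 16 * (a ^ 2 / α) := by
      have := mul_le_mul_of_nonneg_right h.decay_x hA0
      have e : ρ * β / 16 * (4 * L ^ 2 * a ^ 2)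
        = 1 / 32 * (8 * (α * ρ * β * L ^ 2) * (a ^ 2 / α)) := by field_simp; ring
      rw [e]
      linarith
    have q5 : τ * (3 * C / (2 * ρ) * (by' ^ 2 + bz ^ 2)) ≤ 3 * C / (2 * ρ) * (by' ^ 2 + bz ^ 2) :=
      mul_le_of_le_one_left (by positivity) hτ1
    linarith
  have k2 : F₂ / σ' ≤ σ⁻¹ * (F' + τ * F') + Cf * τ := by
    have q1 := div_le_div_of_nonneg_right hF₂ hσ'.le
    rw [add_div, hCf', div_eq_mul_inv F', hinv] at q1
    linarith
  have k3 : σ⁻¹ * (F' + τ * F') ≤ σ⁻¹ * (F - 1 / 2 * (a ^ 2 / α) + α * gg ^ 2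
      - 5 / 8 * (β * ρ) * (Dy ^ 2 + Dz ^ 2) + C * (β / ρ) * (ey ^ 2 + ez ^ 2)
      + 2 * C / ρ * (by' ^ 2 + bz ^ 2) + τ * (σ * Cf)) := by
    apply mul_le_mul_of_nonneg_left _ (inv_nonneg.2 hσ.le)
    have e : 2 * C / ρ * (by' ^ 2 + bz ^ 2) = C / (2 * ρ) * (by' ^ 2 + bz ^ 2)
        + 3 * C / (2 * ρ) * (by' ^ 2 + bz ^ 2) := by field_simp; ring
    rw [e]
    linarith
  rw [mul_add σ⁻¹ _ (τ * (σ * Cf))] at k3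
  have e : σ⁻¹ * (τ * (σ * Cf)) = Cf * τ := by field_simp
  linarith

/-- Growth of the tracking error from the end of an inner loop to the start of the next. -/
lemma tracking_le (h : StepSmall C Cw ρ L κ α β σ σ' lam lam')
    {a ey ez by' bz ry rz dy dz Cf : ℝ} (hCf : 0 ≤ Cf) (hry : 0 ≤ ry) (hrz : 0 ≤ rz)
    (hy : ry ≤ ey + dy) (hz : rz ≤ ez + dz)
    (hdy : dy ^ 2 ≤ 12 * ((ρ * L) ^ 2 * a ^ 2 + by' ^ 2 + ρ * (σ - σ') * Cf))
    (hdz : dz ^ 2 ≤ 12 * ((ρ * L) ^ 2 * a ^ 2 + bz ^ 2)) :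
    Cw * lam' / (σ' * ρ) * (ry ^ 2 + rz ^ 2)
      ≤ Cw * lam / (σ * ρ) * (1 + 3 / 4 * lam) * (ey ^ 2 + ez ^ 2)
        + σ⁻¹ * (240 * Cw * ρ * L ^ 2 * a ^ 2 + 120 * Cw / ρ * (by' ^ 2 + bz ^ 2))
        + 120 * Cw * Cf * ((σ - σ') / σ') := by
  have hρ := h.ρ_pos
  have hσ := h.σ_pos
  have hσ' := h.σ'_pos
  have hl := h.lam_pos
  have hl4 := h.lam_le
  have hCw := h.Cw_ge
  have hτ := h.decay_nonneg
  have hσσ := h.σ_le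
  have hS : ry ^ 2 + rz ^ 2 ≤ (1 + lam / 4) * (ey ^ 2 + ez ^ 2)
      + (1 + 4 / lam) * (12 * (2 * (ρ * L) ^ 2 * a ^ 2 + (by' ^ 2 + bz ^ 2)
        + ρ * (σ - σ') * Cf)) := by
    have q1 := sq_le_of_le_add (c := lam / 4) (by positivity) hry hy
    have q2 := sq_le_of_le_add (c := lam / 4) (by positivity) hrz hz
    rw [inv_div] at q1 q2
    have q3 := mul_le_mul_of_nonneg_left (add_le_add hdy hdz)
      (show 0 ≤ 1 + 4 / lam by positivity)
    linarith
  have hcoef : Cw * lam' / (σ' * ρ) ≤ Cw / (σ * ρ) * ((1 + lam / 8) ^ 2 * lam) := by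
    have e : Cw * lam' / (σ' * ρ) = Cw / (σ * ρ) * (lam' * (1 + (σ - σ') / σ')) := by
      rw [div_eq_mul_inv, mul_inv, h.inv_eq]
      field_simp
    rw [e]
    apply mul_le_mul_of_nonneg_left _ (by positivity)
    have q := mul_le_mul h.growth (add_le_add_right h.decay_rate 1) (by positivity) (by positivity)
    linarith
  have hS0 : 0 ≤ 12 * (2 * (ρ * L) ^ 2 * a ^ 2 + (by' ^ 2 + bz ^ 2) + ρ * (σ - σ') * Cf) := by
    have := sub_nonneg.2 hσσ
    positivity
  have k1 := mul_le_mul hcoef hS (by positivity) (by positivity)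
  have f1 : (1 + lam / 8) ^ 2 * lam * (1 + lam / 4) ≤ lam * (1 + 3 / 4 * lam) := by
    have : (1 + lam / 8) ^ 2 * (1 + lam / 4) ≤ 1 + 3 / 4 * lam := by
      have q1 := mul_nonneg hl.le (sub_nonneg.2 hl4)
      have q2 := mul_nonneg (mul_nonneg hl.le hl.le) (sub_nonneg.2 hl4)
      linarith
    have := mul_le_mul_of_nonneg_left this hl.le
    linarith
  have f2 : (1 + lam / 8) ^ 2 * lam * (1 + 4 / lam) ≤ 10 := by
    have e : (1 + lam / 8) ^ 2 * lam * (1 + 4 / lam) = (1 + lam / 8) ^ 2 * (lam + 4) := by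
      field_simp
    rw [e]
    have q1 : (1 + lam / 8) ^ 2 ≤ (33 / 32) ^ 2 :=
      pow_le_pow_left₀ (by positivity) (by linarith) 2
    have q2 := mul_le_mul q1 (show lam + 4 ≤ 17 / 4 by linarith) (by positivity) (by positivity)
    linarith
  have k2 := mul_le_mul_of_nonneg_right f1 (show 0 ≤ ey ^ 2 + ez ^ 2 by positivity)
  have k3 := mul_le_mul_of_nonneg_right f2 hS0
  have k4 := mul_le_mul_of_nonneg_left (add_le_add k2 k3) (show 0 ≤ Cw / (σ * ρ) by positivity)
  have k5 : Cw / (σ * ρ) * (10 * (12 * (ρ * (σ - σ') * Cf))) ≤ 120 * Cw * Cf * ((σ - σ') / σ') := by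
    have e : Cw / (σ * ρ) * (10 * (12 * (ρ * (σ - σ') * Cf))) = 120 * Cw * Cf * ((σ - σ') / σ) := by
      field_simp; ring
    rw [e]
    have := sub_nonneg.2 hσσ
    gcongr
  have e1 : σ⁻¹ * (240 * Cw * ρ * L ^ 2 * a ^ 2 + 120 * Cw / ρ * (by' ^ 2 + bz ^ 2))
      = Cw / (σ * ρ) * (10 * (12 * (2 * (ρ * L) ^ 2 * a ^ 2 + (by' ^ 2 + bz ^ 2)))) := by
    field_simp; ring
  have e2 : Cw * lam / (σ * ρ) * (1 + 3 / 4 * lam) * (ey ^ 2 + ez ^ 2)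
      = Cw / (σ * ρ) * (lam * (1 + 3 / 4 * lam) * (ey ^ 2 + ez ^ 2)) := by ring
  rw [e1, e2]
  linarith

/-- The scalar form of the one-step inequality. -/
lemma total_le (h : StepSmall C Cw ρ L κ α β σ σ' lam lam')
    {F Φ' W' a Dx Dy Dz ey ez by' bz gg N Cf : ℝ} (hDx0 : 0 ≤ Dx)
    (hby0 : 0 ≤ by') (hbz0 : 0 ≤ bz)
    (hΦ : Φ' ≤ σ⁻¹ * (F - 1 / 2 * (a ^ 2 / α) + α * gg ^ 2
      - 5 / 8 * (β * ρ) * (Dy ^ 2 + Dz ^ 2)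
      + C * (β / ρ) * (ey ^ 2 + ez ^ 2) + 2 * C / ρ * (by' ^ 2 + bz ^ 2))
      + 2 * Cf * ((σ - σ') / σ'))
    (hW : W' ≤ Cw * lam / (σ * ρ) * (1 + 3 / 4 * lam) * (ey ^ 2 + ez ^ 2)
        + σ⁻¹ * (240 * Cw * ρ * L ^ 2 * a ^ 2 + 120 * Cw / ρ * (by' ^ 2 + bz ^ 2))
        + 120 * Cw * Cf * ((σ - σ') / σ'))
    (hDx : α * Dx ≤ a + α * gg)
    (hgg : gg ^ 2 ≤ 3 * (N ^ 2 + L ^ 2 * ey ^ 2 + L ^ 2 * ez ^ 2))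
    (hby : by' ≤ β * (ρ * Dy + ey)) (hbz : bz ≤ β * (ρ * Dz + ez)) :
    α / (16 * σ) * Dx ^ 2 + ρ * β / (16 * σ) * (Dy ^ 2 + Dz ^ 2) + (Φ' + W')
      ≤ F / σ + Cw * lam / (σ * ρ) * (1 + lam) * (ey ^ 2 + ez ^ 2)
        + (2 + 120 * Cw) * Cf * ((σ - σ') / σ') + 4 * (α / σ) * N ^ 2 := by
  have hα := h.α_pos
  have hβ := h.β_pos
  have hρ := h.ρ_pos
  have hσ := h.σ_pos
  have hC := h.C_ge
  have hCw := h.Cw_ge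
  have hA0 : 0 ≤ a ^ 2 / α := by positivity
  have hA : a ^ 2 = α * (a ^ 2 / α) := by field_simp
  have s1 : 1 / 16 * (α * Dx ^ 2) ≤ 1 / 8 * (a ^ 2 / α) + 1 / 8 * (α * gg ^ 2) := by
    have q := pow_le_pow_left₀ (by positivity) hDx 2
    have q2 : (α * Dx) ^ 2 ≤ 2 * a ^ 2 + 2 * (α * gg) ^ 2 := by
      have := sq_nonneg (a - α * gg)
      linarith
    have e : α * Dx ^ 2 = (α * Dx) ^ 2 / α := by field_simp
    have e2 : (2 * a ^ 2 + 2 * (α * gg) ^ 2) / α = 2 * (a ^ 2 / α) + 2 * (α * gg ^ 2) := by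
      field_simp
    have q3 := div_le_div_of_nonneg_right q2 hα.le
    rw [e2, ← e] at q3
    linarith
  have sb : ∀ b d e : ℝ, 0 ≤ b → b ≤ β * (ρ * d + e) →
      (2 * C + 120 * Cw) / ρ * b ^ 2 ≤ 1 / 8 * (β * ρ * d ^ 2) + 1 / 8 * (β / ρ * e ^ 2) := by
    intro b d e hb0 hb
    have q := pow_le_pow_left₀ hb0 hb 2
    have q2 : b ^ 2 ≤ 2 * β ^ 2 * (ρ ^ 2 * d ^ 2 + e ^ 2) := by
      have := mul_nonneg (sq_nonneg β) (sq_nonneg (ρ * d - e))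
      linarith
    have q3 := mul_le_mul_of_nonneg_left q2 (show 0 ≤ (2 * C + 120 * Cw) / ρ by positivity)
    have q4 := mul_le_mul_of_nonneg_right h.drift_y
      (show 0 ≤ β / ρ * (ρ ^ 2 * d ^ 2 + e ^ 2) by positivity)
    have e1 : (2 * C + 120 * Cw) / ρ * (2 * β ^ 2 * (ρ ^ 2 * d ^ 2 + e ^ 2))
      = (4 * C + 240 * Cw) * β * (β / ρ * (ρ ^ 2 * d ^ 2 + e ^ 2)) := by ring
    have e2 : β / ρ * (ρ ^ 2 * d ^ 2 + e ^ 2) = β * ρ * d ^ 2 + β / ρ * e ^ 2 := by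
      field_simp
    rw [e1] at q3
    rw [e2] at q3 q4
    linarith
  have s2 := sb by' Dy ey hby0 hby
  have s3 := sb bz Dz ez hbz0 hbz
  have s4 : 240 * Cw * ρ * L ^ 2 * a ^ 2 ≤ 1 / 8 * (a ^ 2 / α) := by
    have := mul_le_mul_of_nonneg_right h.drift_x hA0
    rwa [mul_assoc _ α, ← hA] at this
  have s5 := mul_le_mul_of_nonneg_left hgg hα.le
  have s6 := mul_le_mul_of_nonneg_right h.absorb (show 0 ≤ ey ^ 2 + ez ^ 2 by positivity)
  have p1 : 0 ≤ β * ρ * (Dy ^ 2 + Dz ^ 2) := by positivity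
  have p2 : 0 ≤ β / ρ * (ey ^ 2 + ez ^ 2) := by positivity
  have p3 : 0 ≤ α * N ^ 2 := by positivity
  have p4 : 0 ≤ α * L ^ 2 * (ey ^ 2 + ez ^ 2) := by positivity
  have eb : 2 * C / ρ * (by' ^ 2 + bz ^ 2) + 120 * Cw / ρ * (by' ^ 2 + bz ^ 2)
    = (2 * C + 120 * Cw) / ρ * by' ^ 2 + (2 * C + 120 * Cw) / ρ * bz ^ 2 := by ring
  have key : 1 / 16 * (α * Dx ^ 2) + ρ * β / 16 * (Dy ^ 2 + Dz ^ 2)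
      + (F - 1 / 2 * (a ^ 2 / α) + α * gg ^ 2
        - 5 / 8 * (β * ρ) * (Dy ^ 2 + Dz ^ 2)
        + C * (β / ρ) * (ey ^ 2 + ez ^ 2) + 2 * C / ρ * (by' ^ 2 + bz ^ 2))
      + (240 * Cw * ρ * L ^ 2 * a ^ 2 + 120 * Cw / ρ * (by' ^ 2 + bz ^ 2))
      ≤ F + Cw * lam ^ 2 / (4 * ρ) * (ey ^ 2 + ez ^ 2) + 4 * α * N ^ 2 := by
    linarith
  have k := mul_le_mul_of_nonneg_left key (inv_nonneg.2 hσ.le)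
  have e1 : α / (16 * σ) * Dx ^ 2 + ρ * β / (16 * σ) * (Dy ^ 2 + Dz ^ 2)
    = σ⁻¹ * (1 / 16 * (α * Dx ^ 2) + ρ * β / 16 * (Dy ^ 2 + Dz ^ 2)) := by
    field_simp
  have e2 : σ⁻¹ * (F + Cw * lam ^ 2 / (4 * ρ) * (ey ^ 2 + ez ^ 2) + 4 * α * N ^ 2)
    = F / σ + Cw * lam / (σ * ρ) * (1 / 4 * lam) * (ey ^ 2 + ez ^ 2) + 4 * (α / σ) * N ^ 2 := by
    field_simp
  rw [e1]
  rw [e2] at k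
  linarith

end StepSmall

end BilevelSGD

namespace BilevelSGD

open scoped InnerProductSpace

/-! ### The pathwise one-step inequality -/

section OneStep

variable {m n : ℕ} {P : Problem m n} {ρ L q Cf s : ℝ}

/-- The merit function, `σ` times `Φ_{σ,ρ}`. -/
noncomputable def Problem.merit (P : Problem m n) (C ρ σ : ℝ) (x : Vec m) (y z : Vec n) : ℝ :=
  envelope P.Y ρ (P.h σ x) y - envelope P.Y ρ (P.g x) z
    + C * (envelope P.Y ρ (P.g x) z - minValue P.Y (P.g x))

lemma Problem.Phi_eq (C ρ σ : ℝ) (x : Vec m) (y z : Vec n) :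
    P.Phi C ρ σ x y z = P.merit C ρ σ x y z / σ := by
  rw [Problem.Phi, Problem.merit]; ring

lemma norm_sub_sq_le_three {k : ℕ} (a b c : Vec k) :
    ‖a + b - c‖ ^ 2 ≤ 3 * (‖a‖ ^ 2 + ‖b‖ ^ 2 + ‖c‖ ^ 2) := by
  have h1 := (norm_sub_le (a + b) c).trans (add_le_add_left (norm_add_le a b) _)
  have h2 := pow_le_pow_left₀ (norm_nonneg _) h1 2
  have := sq_nonneg (‖a‖ - ‖b‖)
  have := sq_nonneg (‖a‖ - ‖c‖)
  have := sq_nonneg (‖b‖ - ‖c‖)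
  linarith

namespace Problem.Tame

lemma merit_step (hP : P.Tame ρ L q Cf s) {C σ : ℝ} (hC : 4 ≤ C) (hσ : σ ∈ Set.Icc 0 s)
    {x x' : Vec m} {y y' z z' : Vec n} (hx : x ∈ P.X) (hx' : x' ∈ P.X) (hz : z ∈ P.Y) :
    P.merit C ρ σ x' y' z' ≤ P.merit C ρ σ x y z
      + ⟪gradX (P.h σ) x (prox P.Y ρ (P.h σ x) y) - gradX P.g x (prox P.Y ρ (P.g x) z),
          x' - x⟫_ℝ
      + 2 * C * L * ‖x' - x‖ ^ 2
      + C * (L * (2 * (2 / q) * (‖ρ⁻¹ * ‖z - prox P.Y ρ (P.g x) z‖‖ + 2 * L * ‖x' - x‖))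
        * ‖x' - x‖)
      + (⟪ρ⁻¹ • (y - prox P.Y ρ (P.h σ x) y), y' - y⟫_ℝ + ‖y' - y‖ ^ 2 / (2 * ρ))
      + (C - 1) * (⟪ρ⁻¹ • (z - prox P.Y ρ (P.g x) z), z' - z⟫_ℝ
        + ‖z' - z‖ ^ 2 / (2 * ρ)) := by
  have hne : P.Y.Nonempty := ⟨z, hz⟩
  have h1 := hP.envelope_step (hP.smooth_h σ hσ) hx hx' hne y y'
  have h2 := hP.envelope_step hP.smooth_g hx hx' hne z z'
  have h3 := hP.minValue_step (hσ.1.trans hσ.2) hx hx' hz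
  have hρ := hP.ρ_pos
  rw [Real.norm_of_nonneg (show 0 ≤ ρ⁻¹ * ‖z - prox P.Y ρ (P.g x) z‖ by positivity),
    inner_sub_left]
  have h4 := mul_le_mul_of_nonneg_left h2 (show 0 ≤ C - 1 by linarith)
  have h5 := mul_le_mul_of_nonneg_left h3 (show 0 ≤ C by linarith)
  simp only [Problem.merit]
  linarith

lemma merit_le (hP : P.Tame ρ L q Cf s) {C σ : ℝ} (hC : 4 ≤ C) (hσ : σ ∈ Set.Icc 0 s)
    {x x' : Vec m} {y z : Vec n} (hx : x ∈ P.X) (hx' : x' ∈ P.X) (hy : y ∈ P.Y)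
    (hz : z ∈ P.Y) (y' z' : Vec n) :
    P.merit C ρ σ x' y' z' ≤ σ * Cf
      + 3 / (2 * ρ) * ((2 / q) ^ 2 * (ρ⁻¹ * ‖y - prox P.Y ρ (P.h σ x) y‖) ^ 2
        + 4 * (2 / q) ^ 2 * L ^ 2 * ‖x' - x‖ ^ 2 + ‖y' - y‖ ^ 2)
      + (C - 1) * (3 / (2 * ρ) * ((2 / q) ^ 2 * (ρ⁻¹ * ‖z - prox P.Y ρ (P.g x) z‖) ^ 2
        + 4 * (2 / q) ^ 2 * L ^ 2 * ‖x' - x‖ ^ 2 + ‖z' - z‖ ^ 2)) := by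
  have h1 := hP.envelope_h_le hx hx' hσ hy y'
  have h2 := hP.envelope_h_le hx hx' (s_nonneg_mem (hσ.1.trans hσ.2)) hz z'
  rw [h_zero, h_zero] at h2
  have h3 := mul_le_mul_of_nonneg_left h2 (show 0 ≤ C - 1 by linarith)
  simp only [Problem.merit]
  linarith

lemma merit_penalty (hP : P.Tame ρ L q Cf s) (C : ℝ) {σ σ' : ℝ} (hσ : σ ∈ Set.Icc 0 s)
    (hσ' : σ' ∈ Set.Icc 0 s) (hle : σ' ≤ σ) {x : Vec m} (hx : x ∈ P.X) (hne : P.Y.Nonempty)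
    (y z : Vec n) :
    P.merit C ρ σ' x y z ≤ P.merit C ρ σ x y z + (σ - σ') * Cf := by
  have hw := hP.prox_h_mem hx hne hσ y
  have h1 := envelope_le hP.ρ_pos hP.compact_Y ((hP.smooth_h σ' hσ').continuousOn_right hx) y hw
  have h2 := envelope_eq hP.ρ_pos hP.compact_Y hne ((hP.smooth_h σ hσ).continuousOn_right hx) y
  have h3 := mul_le_mul_of_nonneg_left (neg_le.1 (abs_le.1 (hP.bound_f x hx _ hw)).1)
    (sub_nonneg.2 hle)
  have h4 : ∀ w, P.h σ' x w = P.h σ x w + (σ - σ') * -P.f x w := fun w => by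
    simp only [Problem.h]; ring
  rw [h4] at h1
  simp only [Problem.merit]
  linarith

end Problem.Tame

lemma inner_smul_avg_le {k : ℕ} {ρ β : ℝ} (hρ : 0 < ρ) (hβ : 0 ≤ β) (y y' w w' : Vec k)
    (hy' : y' = (1 - β) • y + β • w') :
    ⟪ρ⁻¹ • (y - w), y' - y⟫_ℝ ≤ -(β * ρ * ‖ρ⁻¹ • (y - w)‖ ^ 2)
      + β * (‖ρ⁻¹ • (y - w)‖ * ‖w' - w‖) := by
  have e : y' - y = (-(β * ρ)) • (ρ⁻¹ • (y - w)) + β • (w' - w) := by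
    rw [hy', smul_smul, show -(β * ρ) * ρ⁻¹ = -β by field_simp]
    module
  rw [e, inner_add_right, inner_smul_right _ _ (-(β * ρ)), inner_smul_right _ _ β,
    real_inner_self_eq_norm_sq]
  have := mul_le_mul_of_nonneg_left (real_inner_le_norm (ρ⁻¹ • (y - w)) (w' - w)) hβ
  linarith

lemma norm_avg_sub_le {k : ℕ} {ρ β : ℝ} (hρ : 0 < ρ) (hβ : 0 ≤ β) (y y' w w' : Vec k)
    (hy' : y' = (1 - β) • y + β • w') :
    ‖y' - y‖ ≤ β * (ρ * ‖ρ⁻¹ • (y - w)‖ + ‖w' - w‖) := by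
  have e : y' - y = β • ((w' - w) - (y - w)) := by rw [hy']; module
  rw [e, norm_smul, Real.norm_of_nonneg hβ, norm_smul, norm_inv, Real.norm_of_nonneg hρ.le,
    mul_inv_cancel_left₀ hρ.ne']
  refine mul_le_mul_of_nonneg_left ((norm_sub_le _ _).trans ?_) hβ
  rw [add_comm]

/-- The one-step inequality along a path: `st` and `st'` are consecutive states and `G` is the
direction used for the outer variable. -/
lemma weightedResidual_add_potential_le {A : Params} {k : ℕ} {C Cw : ℝ}
    (hP : P.Tame A.ρ L q Cf s)
    (hS : StepSmall C Cw A.ρ L (2 / q) (A.α k) (A.β k) (A.σ k) (A.σ (k + 1)) (rate A k)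
      (rate A (k + 1))) (hσ : A.σ k ≤ s) {st st' : State m n} {G : Vec m}
    (hx : st.x ∈ P.X) (hy : st.y ∈ P.Y) (hz : st.z ∈ P.Y) (hwy : st'.wy ∈ P.Y)
    (hwz : st'.wz ∈ P.Y) (hx' : st'.x = proj P.X (st.x - A.α k • G))
    (hy' : st'.y = (1 - A.β k) • st.y + A.β k • st'.wy)
    (hz' : st'.z = (1 - A.β k) • st.z + A.β k • st'.wz) :
    weightedResidual P A k st + potential P A (k + 1) st' C Cw
      ≤ P.Phi C A.ρ (A.σ k) st.x st.y st.z
        + Cw * rate A k / (A.σ k * A.ρ) * (1 + rate A k)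
          * (‖st'.wy - proxY P A k st‖ ^ 2 + ‖st'.wz - proxZ P A st‖ ^ 2)
        + (2 + 120 * Cw) * Cf * ((A.σ k - A.σ (k + 1)) / A.σ (k + 1))
        + 4 * (A.α k / A.σ k)
          * ‖G - (gradX (P.h (A.σ k)) st.x st'.wy - gradX P.g st.x st'.wz)‖ ^ 2 := by
  have hXne : P.X.Nonempty := ⟨_, hx⟩
  have hYne : P.Y.Nonempty := ⟨_, hy⟩
  have hmx' : st'.x ∈ P.X := hx' ▸ proj_mem hP.closed_X hXne _
  have hρ := hS.ρ_pos
  have hα := hS.α_pos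
  have hσm : A.σ k ∈ Set.Icc 0 s := ⟨hS.σ_pos.le, hσ⟩
  have hσm' : A.σ (k + 1) ∈ Set.Icc 0 s := ⟨hS.σ'_pos.le, hS.σ_le.trans hσ⟩
  have hCf : 0 ≤ Cf := (abs_nonneg _).trans (hP.bound_f _ hx _ hy)
  have hpy : proxY P A k st ∈ P.Y := hP.prox_h_mem hx hYne hσm _
  have hpz : proxZ P A st ∈ P.Y := hP.prox_g_mem hx hYne _
  have hstep := hP.merit_step (x := st.x) (x' := st'.x) (y := st.y) (y' := st'.y) (z := st.z)
    (z' := st'.z) hS.C_ge hσm hx hmx' hz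
  have hgap := hP.merit_le hS.C_ge hσm hx hmx' hy hz st'.y st'.z
  have hpen := hP.merit_penalty C hσm hσm' hS.σ_le hmx' hYne st'.y st'.z
  have hdy := hP.prox_h_drift hx hmx' hYne st.y st'.y hσm hσm' hS.σ_le
  have hdz := hP.prox_g_drift hx hmx' hYne st.z st'.z
  have nrm : ∀ v : Vec n, A.ρ⁻¹ * ‖v‖ = ‖A.ρ⁻¹ • v‖ := fun v => by
    rw [norm_smul, norm_inv, Real.norm_of_nonneg hρ.le]
  rw [nrm, norm_norm] at hstep
  rw [nrm, nrm] at hgap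
  change _ ≤ _ + ⟪gradX (P.h (A.σ k)) st.x (proxY P A k st) - gradX P.g st.x (proxZ P A st),
    st'.x - st.x⟫_ℝ + _ + C * (L * (2 * (2 / q) * (‖resZ P A st‖ + _)) * _)
    + (⟪resY P A k st, _⟫_ℝ + _) + (C - 1) * (⟪resZ P A st, _⟫_ℝ + _) at hstep
  change _ ≤ _ + 3 / (2 * A.ρ) * ((2 / q) ^ 2 * ‖resY P A k st‖ ^ 2 + _ + _)
    + (C - 1) * (3 / (2 * A.ρ) * ((2 / q) ^ 2 * ‖resZ P A st‖ ^ 2 + _ + _)) at hgap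
  change ‖proxY P A (k + 1) st' - proxY P A k st‖ ^ 2 ≤ _ at hdy
  change ‖proxZ P A st' - proxZ P A st‖ ^ 2 ≤ _ at hdz
  set G₀ := gradX (P.h (A.σ k)) st.x (proxY P A k st) - gradX P.g st.x (proxZ P A st) with hG₀
  have hip : ⟪G₀, st'.x - st.x⟫_ℝ
      ≤ -(‖st'.x - st.x‖ ^ 2 / A.α k) + ‖G - G₀‖ * ‖st'.x - st.x‖ := by
    have h1 := inner_sub_proj_le hP.closed_X hP.convex_X hXne (st.x - A.α k • G) hx
    rw [← hx'] at h1
    have h2 : ‖st'.x - st.x‖ ^ 2 + A.α k * ⟪G, st'.x - st.x⟫_ℝ ≤ 0 := by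
      rw [← real_inner_self_eq_norm_sq]
      simp only [inner_sub_left, inner_sub_right, inner_smul_left, conj_trivial] at h1 ⊢
      linarith
    have h3 := real_inner_le_norm (G₀ - G) (st'.x - st.x)
    rw [inner_sub_left, norm_sub_rev] at h3
    have h4 : ⟪G, st'.x - st.x⟫_ℝ ≤ -(‖st'.x - st.x‖ ^ 2 / A.α k) := by
      rw [le_neg, div_le_iff₀ hα]
      linarith
    linarith
  have hDx : A.α k * ‖resX P A k st‖ ≤ ‖st'.x - st.x‖ + A.α k * ‖G - G₀‖ := by
    have h1 : A.α k * ‖resX P A k st‖ = ‖st.x - xHat P A k st‖ := by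
      rw [resX, norm_smul, norm_inv, Real.norm_of_nonneg hα.le, mul_inv_cancel_left₀ hα.ne']
    have h2 := norm_sub_le_norm_sub_add_norm_sub st.x st'.x (xHat P A k st)
    have h3 : ‖st'.x - xHat P A k st‖ ≤ A.α k * ‖G - G₀‖ := by
      rw [hx', xHat]
      refine (norm_proj_sub_proj_le hP.closed_X hP.convex_X hXne _ _).trans_eq ?_
      rw [sub_sub_sub_cancel_left, ← smul_sub, norm_smul, Real.norm_of_nonneg hα.le,
        norm_sub_rev]
    rw [h1]
    rw [norm_sub_rev st.x st'.x] at h2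
    linarith
  have hgg : ‖G - G₀‖ ^ 2 ≤ 3 * (‖G - (gradX (P.h (A.σ k)) st.x st'.wy
      - gradX P.g st.x st'.wz)‖ ^ 2 + L ^ 2 * ‖st'.wy - proxY P A k st‖ ^ 2
      + L ^ 2 * ‖st'.wz - proxZ P A st‖ ^ 2) := by
    have e : G - G₀ = (G - (gradX (P.h (A.σ k)) st.x st'.wy - gradX P.g st.x st'.wz))
        + (gradX (P.h (A.σ k)) st.x st'.wy - gradX (P.h (A.σ k)) st.x (proxY P A k st))
        - (gradX P.g st.x st'.wz - gradX P.g st.x (proxZ P A st)) := by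
      rw [hG₀]; abel
    rw [e]
    refine (norm_sub_sq_le_three _ _ _).trans ?_
    have l1 := (hP.smooth_h _ hσm).gradX_lip hP.convex_X hP.convex_Y hP.L_pos.le hx hx hpy hwy
    have l2 := hP.smooth_g.gradX_lip hP.convex_X hP.convex_Y hP.L_pos.le hx hx hpz hwz
    rw [sub_self, norm_zero, zero_add] at l1 l2
    have l3 := pow_le_pow_left₀ (norm_nonneg _) l1 2
    have l4 := pow_le_pow_left₀ (norm_nonneg _) l2 2
    rw [mul_pow] at l3 l4
    linarith
  have hβ := hS.β_pos.le
  have hmerit := hS.merit_le hstep hip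
    (inner_smul_avg_le hρ hβ st.y st'.y (proxY P A k st) st'.wy hy')
    (inner_smul_avg_le hρ hβ st.z st'.z (proxZ P A st) st'.wz hz')
  have hΦ := hS.merit_div_le hmerit hpen hgap
  have ty : ‖st'.wy - proxY P A (k + 1) st'‖ ≤ ‖st'.wy - proxY P A k st‖
      + ‖proxY P A (k + 1) st' - proxY P A k st‖ := by
    rw [norm_sub_rev (proxY P A (k + 1) st')]
    exact norm_sub_le_norm_sub_add_norm_sub _ _ _
  have tz : ‖st'.wz - proxZ P A st'‖ ≤ ‖st'.wz - proxZ P A st‖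
      + ‖proxZ P A st' - proxZ P A st‖ := by
    rw [norm_sub_rev (proxZ P A st')]
    exact norm_sub_le_norm_sub_add_norm_sub _ _ _
  have hW := hS.tracking_le hCf (norm_nonneg _) (norm_nonneg _) ty tz hdy hdz
  have htot := hS.total_le (norm_nonneg _) (norm_nonneg _) (norm_nonneg _) hΦ hW hDx hgg
    (norm_avg_sub_le hρ hβ st.y st'.y (proxY P A k st) st'.wy hy')
    (norm_avg_sub_le hρ hβ st.z st'.z (proxZ P A st) st'.wz hz')
  rw [potential, weightedResidual, Problem.Phi_eq, Problem.Phi_eq]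
  exact htot

end OneStep

end BilevelSGD

namespace BilevelSGD

open scoped InnerProductSpace

/-! ### Contraction of the inner loop -/

section Contraction

variable {m n : ℕ} {P : Problem m n} {φ : Vec m → Vec n → ℝ} {ρ L q Cf s : ℝ}

/-- The error of a noiseless gradient step on the proximal objective. -/
noncomputable def stepError (φ : Vec m → Vec n → ℝ) (ρ γ : ℝ) (x : Vec m) (u w : Vec n) : Vec n :=
  u - w - γ • (gradY φ x u - gradY φ x w + ρ⁻¹ • (u - w))

namespace Problem.Tame

lemma norm_stepError_sq_le (hP : P.Tame ρ L q Cf s) (hφ : SmoothOn P.X P.Y φ L) {γ : ℝ}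
    (hγ : 0 ≤ γ) (hγρ : γ / ρ ≤ 1 / 2) {x : Vec m} (hx : x ∈ P.X) {u w : Vec n} (hu : u ∈ P.Y)
    (hw : w ∈ P.Y) : ‖stepError φ ρ γ x u w‖ ^ 2 ≤ (1 - γ / ρ) * ‖u - w‖ ^ 2 := by
  have hρ := hP.ρ_pos
  have hlip := hφ.gradY_lip hP.convex_X hP.convex_Y hP.L_pos.le hx hx hw hu
  rw [sub_self, norm_zero, zero_add] at hlip
  rw [stepError]
  set d := u - w
  set e := gradY φ x u - gradY φ x w
  have h1 := neg_le.1 (neg_le_of_abs_le (abs_real_inner_le_norm d e))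
  have h2 : ‖e + ρ⁻¹ • d‖ ≤ (L + ρ⁻¹) * ‖d‖ := by
    refine (norm_add_le _ _).trans ?_
    rw [norm_smul, norm_inv, Real.norm_of_nonneg hρ.le]
    linarith
  have h3 : ⟪d, e + ρ⁻¹ • d⟫_ℝ = ⟪d, e⟫_ℝ + ρ⁻¹ * ‖d‖ ^ 2 := by
    rw [inner_add_right, inner_smul_right, real_inner_self_eq_norm_sq]
  have h4 := mul_le_mul_of_nonneg_left hlip (norm_nonneg d)
  have h5 := pow_le_pow_left₀ (norm_nonneg _) h2 2
  rw [norm_sub_sq_real, inner_smul_right, norm_smul, mul_pow, Real.norm_of_nonneg hγ, h3]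
  have h6 : ‖d‖ ^ 2 - 2 * (γ * (⟪d, e⟫_ℝ + ρ⁻¹ * ‖d‖ ^ 2)) + γ ^ 2 * ‖e + ρ⁻¹ • d‖ ^ 2
      ≤ ‖d‖ ^ 2 - 2 * (γ * (-(L * ‖d‖ ^ 2) + ρ⁻¹ * ‖d‖ ^ 2))
        + γ ^ 2 * ((L + ρ⁻¹) * ‖d‖) ^ 2 := by
    have q1 := mul_le_mul_of_nonneg_left h5 (sq_nonneg γ)
    have q2 := mul_le_mul_of_nonneg_left (show -(L * ‖d‖ ^ 2) ≤ ⟪d, e⟫_ℝ by linarith) hγ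
    linarith
  refine h6.trans ?_
  have e1 : ‖d‖ ^ 2 - 2 * (γ * (-(L * ‖d‖ ^ 2) + ρ⁻¹ * ‖d‖ ^ 2)) + γ ^ 2 * ((L + ρ⁻¹) * ‖d‖) ^ 2
      = (1 - 2 * (γ / ρ) * (1 - ρ * L) + (γ / ρ) ^ 2 * (1 + ρ * L) ^ 2) * ‖d‖ ^ 2 := by
    field_simp; ring
  rw [e1]
  refine mul_le_mul_of_nonneg_right ?_ (sq_nonneg _)
  have hg : 0 ≤ γ / ρ := by positivity
  have hl := hP.ρL_le
  have hl0 : 0 ≤ ρ * L := mul_nonneg hρ.le hP.L_pos.le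
  have q1 : (1 + ρ * L) ^ 2 ≤ (9 / 8) ^ 2 := pow_le_pow_left₀ (by positivity) (by linarith) 2
  have q2 := mul_le_mul_of_nonneg_left q1 (sq_nonneg (γ / ρ))
  have q3 := mul_le_mul_of_nonneg_left hl hg
  have q4 := mul_le_mul_of_nonneg_left hγρ hg
  linarith

/-- One noisy inner step. -/
lemma norm_inner_step_sq_le (hP : P.Tame ρ L q Cf s) (hφ : SmoothOn P.X P.Y φ L) {γ : ℝ}
    (hγ : 0 ≤ γ) (hγρ : γ / ρ ≤ 1 / 2) {x : Vec m} (hx : x ∈ P.X) {u : Vec n} (hu : u ∈ P.Y)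
    (θ N : Vec n) :
    ‖proj P.Y (u - γ • (gradY φ x u + N + ρ⁻¹ • (u - θ))) - prox P.Y ρ (φ x) θ‖ ^ 2
      ≤ (1 - γ / ρ) * ‖u - prox P.Y ρ (φ x) θ‖ ^ 2
        - 2 * γ * ⟪stepError φ ρ γ x u (prox P.Y ρ (φ x) θ), N⟫_ℝ + γ ^ 2 * ‖N‖ ^ 2 := by
  have hw := prox_mem (ρ := ρ) hP.compact_Y ⟨u, hu⟩ (hφ.continuousOn_right hx) θ
  have hv : ∀ v ∈ P.Y, _ := fun v hv =>
    hφ.prox_inner_nonneg hP.compact_Y hP.convex_Y hP.ρ_pos hx θ (q := v) hv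
  set w := prox P.Y ρ (φ x) θ
  have h1 := proj_sub_smul_eq hP.compact_Y.isClosed hP.convex_Y hw hv hγ
  have h2 := norm_proj_sub_proj_le hP.compact_Y.isClosed hP.convex_Y ⟨u, hu⟩
    (u - γ • (gradY φ x u + N + ρ⁻¹ • (u - θ))) (w - γ • (gradY φ x w + ρ⁻¹ • (w - θ)))
  rw [h1] at h2
  refine (pow_le_pow_left₀ (norm_nonneg _) h2 2).trans ?_
  have e : u - γ • (gradY φ x u + N + ρ⁻¹ • (u - θ)) - (w - γ • (gradY φ x w + ρ⁻¹ • (w - θ)))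
      = stepError φ ρ γ x u w - γ • N := by
    rw [stepError]; module
  rw [e, norm_sub_sq_real, inner_smul_right, norm_smul, mul_pow, Real.norm_of_nonneg hγ]
  have := hP.norm_stepError_sq_le hφ hγ hγρ hx hu hw
  linarith

end Problem.Tame

end Contraction

/-! ### Continuity of the maps built from the problem data -/

section Continuity

lemma measurable_comp_of_continuousOn {Ω A B : Type*} [MeasurableSpace Ω] [TopologicalSpace A]
    [MeasurableSpace A] [OpensMeasurableSpace A] [TopologicalSpace B] [MeasurableSpace B]
    [BorelSpace B] {F : A → B} {S : Set A} (hF : ContinuousOn F S) {f : Ω → A}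
    (hf : Measurable f) (hS : ∀ ω, f ω ∈ S) : Measurable fun ω => F (f ω) :=
  (continuousOn_iff_continuous_domRestrict.1 hF).measurable.comp (hf.subtype_mk (h := hS))

lemma continuousOn_minValue {A B : Type*} [TopologicalSpace A] [TopologicalSpace B]
    {S : Set A} {Y : Set B} (hY : IsCompact Y) {F : A → B → ℝ}
    (hF : ContinuousOn (fun p : A × B => F p.1 p.2) (S ×ˢ Y)) :
    ContinuousOn (fun a => minValue Y (F a)) S := by
  rw [continuousOn_iff_continuous_domRestrict]
  have : CompactSpace Y := isCompact_iff_compactSpace.1 hY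
  have h : Continuous fun p : S × Y => F p.1 p.2 :=
    hF.comp_continuous (f := fun p : S × Y => ((p.1 : A), (p.2 : B))) (by fun_prop)
      fun p => ⟨p.1.2, p.2.2⟩
  have key := IsCompact.continuous_sInf (f := fun (a : S) (b : Y) => F a b) isCompact_univ h
  simp only [Set.image_univ] at key
  exact key

variable {m n : ℕ} {X : Set (Vec m)} {Y : Set (Vec n)} {φ : Vec m → Vec n → ℝ} {L ρ : ℝ}

lemma continuousOn_of_lip {A B : Type*} [SeminormedAddCommGroup A] [SeminormedAddCommGroup B]
    {k : ℕ} {S : Set (A × B)} {F : A × B → Vec k} {c : ℝ}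
    (h : ∀ p ∈ S, ∀ p' ∈ S, ‖F p' - F p‖ ≤ c * (‖p'.1 - p.1‖ + ‖p'.2 - p.2‖)) :
    ContinuousOn F S := by
  intro p hp
  rw [ContinuousWithinAt, tendsto_iff_norm_sub_tendsto_zero]
  have hc : Continuous fun p' : A × B => c * (‖p'.1 - p.1‖ + ‖p'.2 - p.2‖) := by fun_prop
  have hl := (hc.tendsto p).mono_left (nhdsWithin_le_nhds (s := S))
  simp only [sub_self, norm_zero, add_zero, mul_zero] at hl
  refine squeeze_zero' (Filter.Eventually.of_forall fun _ => norm_nonneg _) ?_ hl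
  filter_upwards [self_mem_nhdsWithin] with p' hp' using h p hp p' hp'

lemma SmoothOn.continuousOn_gradX (h : SmoothOn X Y φ L) (hX : Convex ℝ X) (hY : Convex ℝ Y)
    (hL : 0 ≤ L) : ContinuousOn (fun p : Vec m × Vec n => gradX φ p.1 p.2) (X ×ˢ Y) :=
  continuousOn_of_lip fun _ hp _ hp' => h.gradX_lip hX hY hL hp.1 hp'.1 hp.2 hp'.2

lemma SmoothOn.continuousOn_gradY (h : SmoothOn X Y φ L) (hX : Convex ℝ X) (hY : Convex ℝ Y)
    (hL : 0 ≤ L) : ContinuousOn (fun p : Vec m × Vec n => gradY φ p.1 p.2) (X ×ˢ Y) :=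
  continuousOn_of_lip fun _ hp _ hp' => h.gradY_lip hX hY hL hp.1 hp'.1 hp.2 hp'.2

lemma SmoothOn.continuousOn_prox (h : SmoothOn X Y φ L) (hX : Convex ℝ X) (hY : IsCompact Y)
    (hYc : Convex ℝ Y) (hne : Y.Nonempty) (hL : 0 ≤ L) (hρ : 0 < ρ) (hρL : ρ * L ≤ 1 / 8) :
    ContinuousOn (fun p : Vec m × Vec n => prox Y ρ (φ p.1) p.2) (X ×ˢ Set.univ) := by
  refine continuousOn_of_lip (c := 2) fun p hp p' hp' => ?_
  have h1 := h.prox_lip hX hY hYc hL hρ (hρL.trans (by norm_num)) hp.1 hp'.1 hne p.2 p'.2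
  have h2 := mul_le_mul_of_nonneg_right (hρL.trans (by norm_num : (1 / 8 : ℝ) ≤ 1))
    (norm_nonneg (p'.1 - p.1))
  linarith

lemma SmoothOn.continuousOn_envelope (h : SmoothOn X Y φ L) (hY : IsCompact Y) :
    ContinuousOn (fun p : Vec m × Vec n => envelope Y ρ (φ p.1) p.2) (X ×ˢ Set.univ) := by
  apply continuousOn_minValue (F := fun (p : Vec m × Vec n) w => φ p.1 w + ‖w - p.2‖ ^ 2 / (2 * ρ))
    hY
  refine ContinuousOn.add ?_ (by fun_prop)
  exact h.continuousOn.comp (f := fun p : (Vec m × Vec n) × Vec n => (p.1.1, p.2)) (by fun_prop)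
    fun p hp => ⟨hp.1.1, hp.2⟩

lemma SmoothOn.continuousOn_minValue (h : SmoothOn X Y φ L) (hY : IsCompact Y) :
    ContinuousOn (fun x => minValue Y (φ x)) X :=
  BilevelSGD.continuousOn_minValue (F := φ) hY h.continuousOn

end Continuity

/-! ### The iterates: membership and measurability -/

section Iterates

variable {m n : ℕ} {Zf Zg : Type*} {P : Problem m n} {A : Params}
  {Gf : Oracle m n Zf} {Gg : Oracle m n Zg}

/-- The components of a state lie in the domains. -/
structure State.Mem (st : State m n) (P : Problem m n) : Prop where
  x : st.x ∈ P.X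
  y : st.y ∈ P.Y
  z : st.z ∈ P.Y
  wy : st.wy ∈ P.Y
  wz : st.wz ∈ P.Y

lemma innerU_mem (hY : IsClosed P.Y) {st : State m n} (hst : st.Mem P) (k : ℕ)
    (d : ℕ → Draw Zf Zg) : ∀ t, innerU P A Gf Gg k st d t ∈ P.Y
  | 0 => hst.wy
  | _ + 1 => proj_mem hY ⟨_, hst.y⟩ _

lemma innerV_mem (hY : IsClosed P.Y) {st : State m n} (hst : st.Mem P) (k : ℕ)
    (d : ℕ → Draw Zf Zg) : ∀ t, innerV P A Gg k st d t ∈ P.Y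
  | 0 => hst.wz
  | _ + 1 => proj_mem hY ⟨_, hst.y⟩ _

lemma iterate_mem (hX : IsClosed P.X) (hY : IsClosed P.Y) (hYc : Convex ℝ P.Y)
    (hβ : ∀ k, 0 < A.β k) (hβ1 : ∀ k, A.β k ≤ 1) {x₀ : Vec m} {y₀ z₀ : Vec n} (hx₀ : x₀ ∈ P.X)
    (hy₀ : y₀ ∈ P.Y) (hz₀ : z₀ ∈ P.Y) (S : SampleIndex → Draw Zf Zg) :
    ∀ k, (iterate P A Gf Gg x₀ y₀ z₀ S k).Mem P
  | 0 => ⟨hx₀, hy₀, hz₀, hy₀, hz₀⟩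
  | k + 1 => by
    have ih := iterate_mem hX hY hYc hβ hβ1 hx₀ hy₀ hz₀ S k
    have hu := innerU_mem (A := A) (Gf := Gf) (Gg := Gg) hY ih k
      (fun t => S (Sum.inl (k, t))) (A.T k)
    have hv := innerV_mem (A := A) (Gg := Gg) hY ih k (fun t => S (Sum.inl (k, t))) (A.T k)
    exact ⟨proj_mem hX ⟨_, hx₀⟩ _,
      hYc ih.y hu (sub_nonneg.2 (hβ1 k)) (hβ k).le (by ring),
      hYc ih.z hv (sub_nonneg.2 (hβ1 k)) (hβ k).le (by ring), hu, hv⟩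

/-- The components of a random state are measurable. -/
structure State.Meas {Ω : Type*} (mΩ : MeasurableSpace Ω) (st : Ω → State m n) : Prop where
  x : Measurable fun ω => (st ω).x
  y : Measurable fun ω => (st ω).y
  z : Measurable fun ω => (st ω).z
  wy : Measurable fun ω => (st ω).wy
  wz : Measurable fun ω => (st ω).wz

variable {Ω : Type*} {mΩ : MeasurableSpace Ω} [MeasurableSpace Zf] [MeasurableSpace Zg]

lemma measurable_innerU (hp : Measurable (proj P.Y))
    (hGf : Measurable fun p : Vec m × Vec n × Zf => Gf.dy p.1 p.2.1 p.2.2)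
    (hGg : Measurable fun p : Vec m × Vec n × Zg => Gg.dy p.1 p.2.1 p.2.2)
    {st : Ω → State m n} (hst : State.Meas mΩ st) (k : ℕ) {d : ℕ → Ω → Draw Zf Zg} :
    ∀ t, (∀ i < t, Measurable (d i)) →
      Measurable fun ω => innerU P A Gf Gg k (st ω) (fun i => d i ω) t
  | 0, _ => hst.wy
  | t + 1, hd => by
    have ih := measurable_innerU hp hGf hGg hst k t fun i hi => hd i (hi.trans t.lt_succ_self)
    have hdt := hd t t.lt_succ_self
    have h1 := hGf.comp (hst.x.prodMk (ih.prodMk hdt.fst))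
    have h2 := hGg.comp (hst.x.prodMk (ih.prodMk hdt.snd.fst))
    exact hp.comp (ih.sub ((((h1.const_smul (A.σ k)).add h2).add
      ((ih.sub hst.y).const_smul A.ρ⁻¹)).const_smul (A.γ k)))

lemma measurable_innerV (hp : Measurable (proj P.Y))
    (hGg : Measurable fun p : Vec m × Vec n × Zg => Gg.dy p.1 p.2.1 p.2.2)
    {st : Ω → State m n} (hst : State.Meas mΩ st) (k : ℕ) {d : ℕ → Ω → Draw Zf Zg} :
    ∀ t, (∀ i < t, Measurable (d i)) →
      Measurable fun ω => innerV P A Gg k (st ω) (fun i => d i ω) t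
  | 0, _ => hst.wz
  | t + 1, hd => by
    have ih := measurable_innerV hp hGg hst k t fun i hi => hd i (hi.trans t.lt_succ_self)
    have h2 := hGg.comp (hst.x.prodMk (ih.prodMk (hd t t.lt_succ_self).snd.snd))
    exact hp.comp (ih.sub ((h2.add ((ih.sub hst.z).const_smul A.ρ⁻¹)).const_smul (A.γ k)))

/-- The outer iteration to which a draw belongs. -/
def outerIdx : SampleIndex → ℕ := Sum.elim Prod.fst Prod.fst

lemma measurable_iterate (hpX : Measurable (proj P.X)) (hpY : Measurable (proj P.Y))
    (hGf : Measurable fun p : Vec m × Vec n × Zf => Gf.dy p.1 p.2.1 p.2.2)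
    (hGg : Measurable fun p : Vec m × Vec n × Zg => Gg.dy p.1 p.2.1 p.2.2)
    (hGf' : Measurable fun p : Vec m × Vec n × Zf => Gf.dx p.1 p.2.1 p.2.2)
    (hGg' : Measurable fun p : Vec m × Vec n × Zg => Gg.dx p.1 p.2.1 p.2.2)
    (x₀ : Vec m) (y₀ z₀ : Vec n) {S : SampleIndex → Ω → Draw Zf Zg} :
    ∀ k, (∀ i, outerIdx i < k → Measurable (S i)) →
      State.Meas mΩ fun ω => iterate P A Gf Gg x₀ y₀ z₀ (fun i => S i ω) k
  | 0, _ => ⟨measurable_const, measurable_const, measurable_const, measurable_const,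
      measurable_const⟩
  | k + 1, hS => by
    have ih := measurable_iterate hpX hpY hGf hGg hGf' hGg' x₀ y₀ z₀ k
      fun i hi => hS i (hi.trans k.lt_succ_self)
    have hd : ∀ t, Measurable (S (Sum.inl (k, t))) := fun t => hS _ k.lt_succ_self
    have he : ∀ t, Measurable (S (Sum.inr (k, t))) := fun t => hS _ k.lt_succ_self
    have hu := measurable_innerU (A := A) hpY hGf hGg ih k
      (d := fun t => S (Sum.inl (k, t))) (A.T k) fun i _ => hd i
    have hv := measurable_innerV (A := A) hpY hGg ih k
      (d := fun t => S (Sum.inl (k, t))) (A.T k) fun i _ => hd i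
    refine ⟨?_, (ih.y.const_smul (1 - A.β k)).add (hu.const_smul (A.β k)),
      (ih.z.const_smul (1 - A.β k)).add (hv.const_smul (A.β k)), hu, hv⟩
    refine hpX.comp (ih.x.sub ((measurable_const_smul (A.α k / A.M k : ℝ)).comp
      (Finset.measurable_fun_sum _ fun j _ => ?_)))
    exact (((hGf'.comp (ih.x.prodMk (hu.prodMk (he j).fst))).const_smul (A.σ k)).add
      (hGg'.comp (ih.x.prodMk (hu.prodMk (he j).snd.fst)))).sub
      (hGg'.comp (ih.x.prodMk (hv.prodMk (he j).snd.snd)))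

end Iterates

end BilevelSGD

namespace BilevelSGD

open scoped InnerProductSpace

/-! ### Centred noise, conditionally on a past -/

section Noise

variable {Ω : Type*} {m mΩ : MeasurableSpace Ω} {Pr : Measure Ω} {k : ℕ}

lemma integrable_inner_of_sq {a N : Ω → Vec k} (ha : AEStronglyMeasurable a Pr)
    (hN : AEStronglyMeasurable N Pr) (ha2 : Integrable (fun ω => ‖a ω‖ ^ 2) Pr)
    (hN2 : Integrable (fun ω => ‖N ω‖ ^ 2) Pr) : Integrable (fun ω => ⟪a ω, N ω⟫_ℝ) Pr := by
  refine (ha2.add hN2).mono' (ha.inner hN) (Filter.Eventually.of_forall fun ω => ?_)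
  have h := abs_real_inner_le_norm (a ω) (N ω)
  have := sq_nonneg (‖a ω‖ - ‖N ω‖)
  have := sq_nonneg (‖a ω‖ + ‖N ω‖)
  rw [Real.norm_eq_abs, Pi.add_apply]
  linarith

/-- `N` is square integrable with second moment at most `v`, and orthogonal to every square
integrable vector that is measurable with respect to the past `m`. -/
structure IsNoise (m : MeasurableSpace Ω) {mΩ : MeasurableSpace Ω} (Pr : Measure Ω)
    (N : Ω → Vec k) (v : ℝ) : Prop where
  le : m ≤ mΩ
  aesm : AEStronglyMeasurable N Pr
  integrable_sq : Integrable (fun ω => ‖N ω‖ ^ 2) Pr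
  integral_sq_le : ∫ ω, ‖N ω‖ ^ 2 ∂Pr ≤ v
  orth : ∀ a : Ω → Vec k, Measurable[m] a → Integrable (fun ω => ‖a ω‖ ^ 2) Pr →
    ∫ ω, ⟪a ω, N ω⟫_ℝ ∂Pr = 0

namespace IsNoise

variable {N N' : Ω → Vec k} {v v' : ℝ}

lemma integrable_inner (h : IsNoise m Pr N v) {a : Ω → Vec k} (ha : Measurable[m] a)
    (ha2 : Integrable (fun ω => ‖a ω‖ ^ 2) Pr) : Integrable (fun ω => ⟪a ω, N ω⟫_ℝ) Pr :=
  integrable_inner_of_sq (ha.mono h.le le_rfl).aestronglyMeasurable h.aesm ha2 h.integrable_sq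

lemma smul (h : IsNoise m Pr N v) (c : ℝ) : IsNoise m Pr (fun ω => c • N ω) (c ^ 2 * v) where
  le := h.le
  aesm := h.aesm.const_smul c
  integrable_sq := by
    simp only [norm_smul, mul_pow, Real.norm_eq_abs, sq_abs]
    exact h.integrable_sq.const_mul _
  integral_sq_le := by
    simp only [norm_smul, mul_pow, Real.norm_eq_abs, sq_abs]
    rw [integral_const_mul]
    exact mul_le_mul_of_nonneg_left h.integral_sq_le (sq_nonneg c)
  orth a ha ha2 := by
    simp only [inner_smul_right]
    rw [integral_const_mul, h.orth a ha ha2, mul_zero]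

lemma add (h : IsNoise m Pr N v) (h' : IsNoise m Pr N' v') :
    IsNoise m Pr (fun ω => N ω + N' ω) (2 * v + 2 * v') := by
  have hb : ∀ ω, ‖N ω + N' ω‖ ^ 2 ≤ 2 * ‖N ω‖ ^ 2 + 2 * ‖N' ω‖ ^ 2 := fun ω => by
    have h1 := pow_le_pow_left₀ (norm_nonneg _) (norm_add_le (N ω) (N' ω)) 2
    have := sq_nonneg (‖N ω‖ - ‖N' ω‖)
    linarith
  have hi : Integrable (fun ω => 2 * ‖N ω‖ ^ 2 + 2 * ‖N' ω‖ ^ 2) Pr :=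
    (h.integrable_sq.const_mul 2).add (h'.integrable_sq.const_mul 2)
  have hi' : Integrable (fun ω => ‖N ω + N' ω‖ ^ 2) Pr :=
    hi.mono' ((h.aesm.add h'.aesm).norm.pow 2)
      (Filter.Eventually.of_forall fun ω => by
        rw [Real.norm_of_nonneg (sq_nonneg _)]; exact hb ω)
  refine ⟨h.le, h.aesm.add h'.aesm, hi', (integral_mono hi' hi hb).trans ?_, fun a ha ha2 => ?_⟩
  · rw [integral_add (h.integrable_sq.const_mul 2) (h'.integrable_sq.const_mul 2),
      integral_const_mul, integral_const_mul]
    linarith [h.integral_sq_le, h'.integral_sq_le]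
  · simp only [inner_add_right]
    rw [integral_add (h.integrable_inner ha ha2) (h'.integrable_inner ha ha2), h.orth a ha ha2,
      h'.orth a ha ha2, add_zero]

lemma neg (h : IsNoise m Pr N v) : IsNoise m Pr (fun ω => -N ω) v := by
  have := h.smul (-1)
  simpa using this

lemma mono (h : IsNoise m Pr N v) (hv : v ≤ v') : IsNoise m Pr N v' :=
  ⟨h.le, h.aesm, h.integrable_sq, h.integral_sq_le.trans hv, h.orth⟩

/-- Second moment of a sum of successively orthogonal noises. -/
lemma integral_sum_sq_le {N : ℕ → Ω → Vec k} {ℱ : ℕ → MeasurableSpace Ω} (M : ℕ)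
    (h : ∀ j < M, IsNoise (ℱ j) Pr (N j) v)
    (hN : ∀ j < M, ∀ i < j, Measurable[ℱ j] (N i)) :
    Integrable (fun ω => ‖∑ j ∈ Finset.range M, N j ω‖ ^ 2) Pr ∧
      ∫ ω, ‖∑ j ∈ Finset.range M, N j ω‖ ^ 2 ∂Pr ≤ M * v := by
  induction M with
  | zero => simp
  | succ M ih =>
    obtain ⟨ih1, ih2⟩ := ih (fun j hj => h j (hj.trans M.lt_succ_self))
      (fun j hj => hN j (hj.trans M.lt_succ_self))
    have hM := h M M.lt_succ_self
    have hS : Measurable[ℱ M] fun ω => ∑ j ∈ Finset.range M, N j ω :=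
      Finset.measurable_fun_sum _ fun i hi => hN M M.lt_succ_self i (Finset.mem_range.1 hi)
    have e : ∀ ω, ‖∑ j ∈ Finset.range (M + 1), N j ω‖ ^ 2
        = ‖∑ j ∈ Finset.range M, N j ω‖ ^ 2 + 2 * ⟪∑ j ∈ Finset.range M, N j ω, N M ω⟫_ℝ
          + ‖N M ω‖ ^ 2 := fun ω => by
      rw [Finset.sum_range_succ, norm_add_sq_real]
    simp only [e]
    have i1 := (hM.integrable_inner hS ih1).const_mul 2
    have i2 : Integrable (fun ω => ‖∑ j ∈ Finset.range M, N j ω‖ ^ 2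
      + 2 * ⟪∑ j ∈ Finset.range M, N j ω, N M ω⟫_ℝ) Pr := ih1.add i1
    refine ⟨i2.add hM.integrable_sq, ?_⟩
    rw [integral_add i2 hM.integrable_sq, integral_add ih1 i1, integral_const_mul,
      hM.orth _ hS ih1]
    push_cast
    linarith [hM.integral_sq_le]

end IsNoise

/-- Noise produced from a past `W` and a fresh sample `Z`. -/
lemma noise_of_indepFun [IsProbabilityMeasure Pr] {β ζ : Type*} {mβ : MeasurableSpace β}
    {mζ : MeasurableSpace ζ} {W : Ω → β} {Z : Ω → ζ} (hW : Measurable W) (hZ : Measurable Z)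
    (hind : IndepFun W Z Pr) {N : β → ζ → Vec k} (hN : Measurable (Function.uncurry N)) {v : ℝ}
    (hi : ∀ b, Integrable (N b) (Pr.map Z)) (h0 : ∀ b, ∫ z, N b z ∂(Pr.map Z) = 0)
    (hi2 : ∀ b, Integrable (fun z => ‖N b z‖ ^ 2) (Pr.map Z))
    (hv : ∀ b, ∫ z, ‖N b z‖ ^ 2 ∂(Pr.map Z) ≤ v) :
    Integrable (fun ω => ‖N (W ω) (Z ω)‖ ^ 2) Pr ∧ ∫ ω, ‖N (W ω) (Z ω)‖ ^ 2 ∂Pr ≤ v ∧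
      ∀ a : β → Vec k, Measurable a → Integrable (fun ω => ‖a (W ω)‖ ^ 2) Pr →
        ∫ ω, ⟪a (W ω), N (W ω) (Z ω)⟫_ℝ ∂Pr = 0 := by
  have hWZ : Measurable fun ω => (W ω, Z ω) := hW.prodMk hZ
  have hmap := (indepFun_iff_map_prod_eq_prod_map_map hW.aemeasurable hZ.aemeasurable).1 hind
  have : IsProbabilityMeasure (Pr.map W) := Measure.isProbabilityMeasure_map hW.aemeasurable
  have : IsProbabilityMeasure (Pr.map Z) := Measure.isProbabilityMeasure_map hZ.aemeasurable
  have hf : StronglyMeasurable fun p : β × ζ => ‖N p.1 p.2‖ ^ 2 :=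
    (hN.norm.pow_const 2).stronglyMeasurable
  have hnn : ∀ b, 0 ≤ ∫ z, ‖N b z‖ ^ 2 ∂(Pr.map Z) := fun b => integral_nonneg fun _ => sq_nonneg _
  have hint : Integrable (fun p : β × ζ => ‖N p.1 p.2‖ ^ 2) ((Pr.map W).prod (Pr.map Z)) := by
    refine (integrable_prod_iff hf.aestronglyMeasurable).2
      ⟨Filter.Eventually.of_forall hi2, ?_⟩
    simp only [norm_pow, norm_norm]
    exact (integrable_const v).mono' hf.integral_prod_right'.aestronglyMeasurable
      (Filter.Eventually.of_forall fun b => by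
        rw [Real.norm_of_nonneg (hnn b)]; exact hv b)
  have hint' : Integrable (fun ω => ‖N (W ω) (Z ω)‖ ^ 2) Pr := by
    rw [← hmap] at hint
    exact hint.comp_measurable hWZ
  have hval : ∫ ω, ‖N (W ω) (Z ω)‖ ^ 2 ∂Pr = ∫ b, ∫ z, ‖N b z‖ ^ 2 ∂(Pr.map Z) ∂(Pr.map W) := by
    rw [← integral_prod _ hint, ← hmap,
      integral_map hWZ.aemeasurable hf.aestronglyMeasurable]
  refine ⟨hint', ?_, fun a ha ha2 => ?_⟩
  · rw [hval]
    refine (integral_mono hint.integral_prod_left (integrable_const v) hv).trans_eq ?_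
    simp
  · have hm : Measurable fun p : β × ζ => ⟪a p.1, N p.1 p.2⟫_ℝ :=
      (ha.comp measurable_fst).inner hN
    have hin : Integrable (fun ω => ⟪a (W ω), N (W ω) (Z ω)⟫_ℝ) Pr :=
      integrable_inner_of_sq (ha.comp hW).aestronglyMeasurable
        (hN.comp hWZ).aestronglyMeasurable ha2 hint'
    have hin' : Integrable (fun p : β × ζ => ⟪a p.1, N p.1 p.2⟫_ℝ)
        ((Pr.map W).prod (Pr.map Z)) := by
      rw [← hmap]
      exact (integrable_map_measure hm.aestronglyMeasurable hWZ.aemeasurable).2 hin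
    have e : ∫ ω, ⟪a (W ω), N (W ω) (Z ω)⟫_ℝ ∂Pr
        = ∫ p, ⟪a p.1, N p.1 p.2⟫_ℝ ∂((Pr.map W).prod (Pr.map Z)) := by
      rw [← hmap, integral_map hWZ.aemeasurable hm.aestronglyMeasurable]
    rw [e, integral_prod _ hin']
    simp only [integral_inner (hi _), h0, inner_zero_right, integral_zero]

/-- A measurable family of unbiased estimators of a vector field with variance at most `v`. -/
structure IsEstimator {p n : ℕ} {Z : Type*} [MeasurableSpace Z] (Q : Measure Z) (X : Set (Vec p))
    (Y : Set (Vec n)) (G : Vec p → Vec n → Z → Vec k) (g : Vec p → Vec n → Vec k) (v : ℝ) :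
    Prop where
  meas : Measurable fun q : Vec p × Vec n × Z => G q.1 q.2.1 q.2.2
  cont : ContinuousOn (fun q : Vec p × Vec n => g q.1 q.2) (X ×ˢ Y)
  integrable : ∀ x ∈ X, ∀ y ∈ Y, Integrable (G x y) Q
  mean : ∀ x ∈ X, ∀ y ∈ Y, ∫ ζ, G x y ζ ∂Q = g x y
  integrable_sq : ∀ x ∈ X, ∀ y ∈ Y, Integrable (fun ζ => ‖G x y ζ - g x y‖ ^ 2) Q
  variance_le : ∀ x ∈ X, ∀ y ∈ Y, ∫ ζ, ‖G x y ζ - g x y‖ ^ 2 ∂Q ≤ v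

lemma IsEstimator.measurable_sub {p n : ℕ} {Z : Type*} [MeasurableSpace Z] {Q : Measure Z}
    {X : Set (Vec p)} {Y : Set (Vec n)} {G : Vec p → Vec n → Z → Vec k}
    {g : Vec p → Vec n → Vec k} {v : ℝ} (h : IsEstimator Q X Y G g v)
    {Ω' : Type*} [MeasurableSpace Ω'] {x : Ω' → Vec p} {y : Ω' → Vec n} {z : Ω' → Z}
    (hx : Measurable x) (hy : Measurable y) (hz : Measurable z) (hxm : ∀ ω, x ω ∈ X)
    (hym : ∀ ω, y ω ∈ Y) : Measurable fun ω => G (x ω) (y ω) (z ω) - g (x ω) (y ω) :=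
  (h.meas.comp (hx.prodMk (hy.prodMk hz))).sub
    (measurable_comp_of_continuousOn h.cont (hx.prodMk hy) fun ω => ⟨hxm ω, hym ω⟩)

lemma IsEstimator.isNoise [IsProbabilityMeasure Pr] {p n : ℕ} {Z : Type*} [MeasurableSpace Z]
    {Q : Measure Z} {X : Set (Vec p)} {Y : Set (Vec n)} {G : Vec p → Vec n → Z → Vec k}
    {g : Vec p → Vec n → Vec k} {v : ℝ} (h : IsEstimator Q X Y G g v) (hm : m ≤ mΩ)
    {x : Ω → Vec p} {y : Ω → Vec n} {z : Ω → Z} (hx : Measurable[m] x) (hy : Measurable[m] y)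
    (hz : Measurable z) (hxm : ∀ ω, x ω ∈ X) (hym : ∀ ω, y ω ∈ Y)
    (hind : Indep m (MeasurableSpace.comap z inferInstance) Pr) (hQ : Pr.map z = Q) :
    IsNoise m Pr (fun ω => G (x ω) (y ω) (z ω) - g (x ω) (y ω)) v := by
  have hprob : IsProbabilityMeasure (Pr.map z) := Measure.isProbabilityMeasure_map hz.aemeasurable
  have hid : @IndepFun Ω Ω Z mΩ m _ id z Pr := by
    refine (@IndepFun_iff_Indep Ω Ω Z mΩ m _ id z Pr).2 ?_
    rw [MeasurableSpace.comap_id]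
    exact hind
  have hNm : Measurable[m.prod inferInstance]
      (Function.uncurry fun (ω : Ω) (ζ : Z) => G (x ω) (y ω) ζ - g (x ω) (y ω)) := by
    let _ : MeasurableSpace Ω := m
    exact h.measurable_sub (hx.comp measurable_fst) (hy.comp measurable_fst) measurable_snd
      (fun p => hxm p.1) fun p => hym p.1
  obtain ⟨h1, h2, h3⟩ := noise_of_indepFun (mβ := m) (v := v)
    (N := fun ω ζ => G (x ω) (y ω) ζ - g (x ω) (y ω)) (measurable_id'' hm) hz hid hNm
    (fun ω => by rw [hQ] at hprob ⊢; exact (h.integrable _ (hxm ω) _ (hym ω)).sub (integrable_const _))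
    (fun ω => by
      rw [hQ] at hprob ⊢
      rw [integral_sub (h.integrable _ (hxm ω) _ (hym ω)) (integrable_const _),
        h.mean _ (hxm ω) _ (hym ω)]
      simp)
    (fun ω => by rw [hQ]; exact h.integrable_sq _ (hxm ω) _ (hym ω))
    (fun ω => by rw [hQ]; exact h.variance_le _ (hxm ω) _ (hym ω))
  exact ⟨hm, (h.measurable_sub (hx.mono hm le_rfl) (hy.mono hm le_rfl) hz hxm hym
    ).aestronglyMeasurable, h1, h2, h3⟩

lemma Oracle.IsUnbiased.estimator_dx {p n : ℕ} {Z : Type*} [MeasurableSpace Z] {Gr : Oracle p n Z}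
    {Q : Measure Z} [IsProbabilityMeasure Q] {X : Set (Vec p)} {Y : Set (Vec n)}
    {φ : Vec p → Vec n → ℝ} {s : ℝ} (h : Gr.IsUnbiased Q X Y φ s)
    (hc : ContinuousOn (fun q : Vec p × Vec n => gradX φ q.1 q.2) (X ×ˢ Y)) :
    IsEstimator Q X Y Gr.dx (gradX φ) (s ^ 2) := by
  have hi : ∀ x ∈ X, ∀ y ∈ Y, Integrable (fun ζ => ‖Gr.dx x y ζ - gradX φ x y‖ ^ 2) Q := by
    intro x hx y hy
    refine (h.integrable_sq x hx y hy).mono'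
      ((((h.integrable_dx x hx y hy).sub (integrable_const _)).aestronglyMeasurable).norm.pow 2)
      (Filter.Eventually.of_forall fun ζ => ?_)
    rw [Real.norm_of_nonneg (sq_nonneg _)]
    exact le_add_of_nonneg_right (sq_nonneg _)
  refine ⟨h.measurable_dx, hc, h.integrable_dx, h.mean_dx, hi, fun x hx y hy =>
    le_trans (integral_mono (hi x hx y hy) (h.integrable_sq x hx y hy) fun ζ => ?_)
      (h.variance_le x hx y hy)⟩
  exact le_add_of_nonneg_right (sq_nonneg _)

lemma Oracle.IsUnbiased.estimator_dy {p n : ℕ} {Z : Type*} [MeasurableSpace Z] {Gr : Oracle p n Z}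
    {Q : Measure Z} [IsProbabilityMeasure Q] {X : Set (Vec p)} {Y : Set (Vec n)}
    {φ : Vec p → Vec n → ℝ} {s : ℝ} (h : Gr.IsUnbiased Q X Y φ s)
    (hc : ContinuousOn (fun q : Vec p × Vec n => gradY φ q.1 q.2) (X ×ˢ Y)) :
    IsEstimator Q X Y Gr.dy (gradY φ) (s ^ 2) := by
  have hi : ∀ x ∈ X, ∀ y ∈ Y, Integrable (fun ζ => ‖Gr.dy x y ζ - gradY φ x y‖ ^ 2) Q := by
    intro x hx y hy
    refine (h.integrable_sq x hx y hy).mono'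
      ((((h.integrable_dy x hx y hy).sub (integrable_const _)).aestronglyMeasurable).norm.pow 2)
      (Filter.Eventually.of_forall fun ζ => ?_)
    rw [Real.norm_of_nonneg (sq_nonneg _)]
    exact le_add_of_nonneg_left (sq_nonneg _)
  refine ⟨h.measurable_dy, hc, h.integrable_dy, h.mean_dy, hi, fun x hx y hy =>
    le_trans (integral_mono (hi x hx y hy) (h.integrable_sq x hx y hy) fun ζ => ?_)
      (h.variance_le x hx y hy)⟩
  exact le_add_of_nonneg_left (sq_nonneg _)

end Noise

/-! ### The σ-algebras generated by sets of draws -/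

section Past

variable {Ω Zf Zg : Type*} {mΩ : MeasurableSpace Ω} [MeasurableSpace Zf] [MeasurableSpace Zg]
  {Pr : Measure Ω} {Qf : Measure Zf} {Qg : Measure Zg} {S : SampleIndex → Ω → Draw Zf Zg}

/-- The σ-algebra generated by the draws with index in `I`. -/
@[reducible] def drawsIn (S : SampleIndex → Ω → Draw Zf Zg) (I : Set SampleIndex) : MeasurableSpace Ω :=
  ⨆ i ∈ I, MeasurableSpace.comap (S i) inferInstance

lemma measurable_drawsIn {I : Set SampleIndex} {i : SampleIndex} (hi : i ∈ I) :
    Measurable[drawsIn S I] (S i) :=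
  measurable_iff_comap_le.2
    (le_iSup₂ (f := fun i (_ : i ∈ I) => MeasurableSpace.comap (S i) inferInstance) i hi)

lemma IsSampling.drawsIn_le (h : IsSampling Pr Qf Qg S) (I : Set SampleIndex) :
    drawsIn S I ≤ mΩ :=
  iSup₂_le fun i _ => (h.measurable i).comap_le

lemma IsSampling.indep_drawsIn (h : IsSampling Pr Qf Qg S) {I : Set SampleIndex} {i : SampleIndex}
    (hi : i ∉ I) {Z : Type*} [MeasurableSpace Z] {r : Draw Zf Zg → Z} (hr : Measurable r) :
    Indep (drawsIn S I) (MeasurableSpace.comap (fun ω => r (S i ω)) inferInstance) Pr := by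
  have key := indep_iSup_of_disjoint (fun i => (h.measurable i).comap_le) h.indep
    (S := I) (T := {i}) (Set.disjoint_singleton_right.2 hi)
  refine indep_of_indep_of_le_right key ?_
  rw [iSup_singleton, ← Function.comp_def, ← MeasurableSpace.comap_comp]
  exact MeasurableSpace.comap_mono hr.comap_le

end Past

end BilevelSGD

namespace BilevelSGD

open scoped InnerProductSpace

/-! ### Expected contraction -/

lemma linear_recursion_le {e : ℕ → ℝ} {g b : ℝ} (hg : 0 ≤ g) (hb : 0 ≤ b) (he : 0 ≤ e 0)
    (T : ℕ) (hT : T * g ≤ 1) (h : ∀ t < T, e (t + 1) ≤ (1 - g) * e t + b) :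
    e T ≤ (1 - T * g / 2) * e 0 + T * b := by
  induction T with
  | zero => simp
  | succ T ih =>
    push_cast at hT ⊢
    have hTg : T * g ≤ 1 := by linarith
    have h0 : 0 ≤ T * g := by positivity
    have h1 := ih hTg fun t ht => h t (ht.trans T.lt_succ_self)
    have h2 := h T T.lt_succ_self
    have h3 := mul_le_mul_of_nonneg_left h1 (show 0 ≤ 1 - g by linarith)
    have h4 : 0 ≤ g * e 0 * (1 - T * g) :=
      mul_nonneg (mul_nonneg hg he) (by linarith)
    have h5 : 0 ≤ g * (T * b) := by positivity
    linarith

section Expected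

variable {Ω : Type*} {ℱ mΩ : MeasurableSpace Ω} {Pr : Measure Ω} [IsProbabilityMeasure Pr]
  {m n : ℕ} {P : Problem m n} {φ : Vec m → Vec n → ℝ} {ρ L q Cf s : ℝ}

lemma integrable_norm_sub_sq {Y : Set (Vec n)} (hY : IsCompact Y) {u w : Ω → Vec n}
    (hu : Measurable u) (hw : Measurable w) (hum : ∀ ω, u ω ∈ Y) (hwm : ∀ ω, w ω ∈ Y) :
    Integrable (fun ω => ‖u ω - w ω‖ ^ 2) Pr := by
  obtain ⟨D, hD⟩ := hY.isBounded.exists_norm_le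
  refine Integrable.of_bound ((hu.sub hw).norm.pow_const 2).aestronglyMeasurable ((D + D) ^ 2)
    (Filter.Eventually.of_forall fun ω => ?_)
  rw [Real.norm_of_nonneg (sq_nonneg _)]
  exact pow_le_pow_left₀ (norm_nonneg _)
    ((norm_sub_le _ _).trans (add_le_add (hD _ (hum ω)) (hD _ (hwm ω)))) 2

lemma Problem.Tame.measurable_prox {Ω : Type*} {_ : MeasurableSpace Ω} (hP : P.Tame ρ L q Cf s)
    (hφ : SmoothOn P.X P.Y φ L) (hne : P.Y.Nonempty) {x : Ω → Vec m} {θ : Ω → Vec n}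
    (hx : Measurable x) (hθ : Measurable θ) (hxm : ∀ ω, x ω ∈ P.X) :
    Measurable fun ω => prox P.Y ρ (φ (x ω)) (θ ω) :=
  measurable_comp_of_continuousOn
    (hφ.continuousOn_prox hP.convex_X hP.compact_Y hP.convex_Y hne hP.L_pos.le hP.ρ_pos hP.ρL_le)
    (hx.prodMk hθ) fun ω => ⟨hxm ω, trivial⟩

lemma Problem.Tame.measurable_stepError {Ω : Type*} {_ : MeasurableSpace Ω} (hP : P.Tame ρ L q Cf s)
    (hφ : SmoothOn P.X P.Y φ L) (γ : ℝ) {x : Ω → Vec m} {u w : Ω → Vec n}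
    (hx : Measurable x) (hu : Measurable u) (hw : Measurable w) (hxm : ∀ ω, x ω ∈ P.X)
    (hum : ∀ ω, u ω ∈ P.Y) (hwm : ∀ ω, w ω ∈ P.Y) :
    Measurable fun ω => stepError φ ρ γ (x ω) (u ω) (w ω) := by
  have hc := hφ.continuousOn_gradY hP.convex_X hP.convex_Y hP.L_pos.le
  have h1 := measurable_comp_of_continuousOn hc (hx.prodMk hu) fun ω => ⟨hxm ω, hum ω⟩
  have h2 := measurable_comp_of_continuousOn hc (hx.prodMk hw) fun ω => ⟨hxm ω, hwm ω⟩
  exact (hu.sub hw).sub (((h1.sub h2).add ((hu.sub hw).const_smul ρ⁻¹)).const_smul γ)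

lemma Problem.Tame.integral_inner_step_le (hP : P.Tame ρ L q Cf s) (hφ : SmoothOn P.X P.Y φ L)
    {γ : ℝ} (hγ : 0 ≤ γ) (hγρ : γ / ρ ≤ 1 / 2) {x : Ω → Vec m} {θ u N : Ω → Vec n} {v : ℝ}
    (hx : Measurable[ℱ] x) (hθ : Measurable[ℱ] θ) (hu : Measurable[ℱ] u)
    (hxm : ∀ ω, x ω ∈ P.X) (hum : ∀ ω, u ω ∈ P.Y) (hN : IsNoise ℱ Pr N v) :
    ∫ ω, ‖proj P.Y (u ω - γ • (gradY φ (x ω) (u ω) + N ω + ρ⁻¹ • (u ω - θ ω)))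
        - prox P.Y ρ (φ (x ω)) (θ ω)‖ ^ 2 ∂Pr
      ≤ (1 - γ / ρ) * ∫ ω, ‖u ω - prox P.Y ρ (φ (x ω)) (θ ω)‖ ^ 2 ∂Pr + γ ^ 2 * v := by
  obtain ⟨ω₀⟩ : Nonempty Ω := Pr.nonempty_of_neZero
  have hne : P.Y.Nonempty := ⟨_, hum ω₀⟩
  have hw : Measurable[ℱ] fun ω => prox P.Y ρ (φ (x ω)) (θ ω) :=
    hP.measurable_prox hφ hne hx hθ hxm
  have hwm : ∀ ω, prox P.Y ρ (φ (x ω)) (θ ω) ∈ P.Y := fun ω =>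
    prox_mem hP.compact_Y hne (hφ.continuousOn_right (hxm ω)) _
  have ha : Measurable[ℱ] fun ω => stepError φ ρ γ (x ω) (u ω) (prox P.Y ρ (φ (x ω)) (θ ω)) :=
    hP.measurable_stepError hφ γ hx hu hw hxm hum hwm
  have i1 := integrable_norm_sub_sq (Pr := Pr) hP.compact_Y (hu.mono hN.le le_rfl)
    (hw.mono hN.le le_rfl) hum hwm
  have ha2 : Integrable (fun ω => ‖stepError φ ρ γ (x ω) (u ω)
      (prox P.Y ρ (φ (x ω)) (θ ω))‖ ^ 2) Pr := by
    refine (i1.const_mul (1 - γ / ρ)).mono'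
      ((ha.mono hN.le le_rfl).norm.pow_const 2).aestronglyMeasurable
      (Filter.Eventually.of_forall fun ω => ?_)
    rw [Real.norm_of_nonneg (sq_nonneg _)]
    exact hP.norm_stepError_sq_le hφ hγ hγρ (hxm ω) (hum ω) (hwm ω)
  have i2 := (hN.integrable_inner ha ha2).const_mul (2 * γ)
  have i3 := hN.integrable_sq.const_mul (γ ^ 2)
  have i4 := (i1.const_mul (1 - γ / ρ)).sub i2
  refine (integral_mono_of_nonneg (Filter.Eventually.of_forall fun _ => sq_nonneg _)
    (i4.add i3) (Filter.Eventually.of_forall fun ω =>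
      hP.norm_inner_step_sq_le hφ hγ hγρ (hxm ω) (hum ω) (θ ω) (N ω))).trans ?_
  have e := integral_add i4 i3
  have e' := integral_sub (i1.const_mul (1 - γ / ρ)) i2
  simp only [Pi.add_apply, Pi.sub_apply, integral_const_mul] at e e' ⊢
  rw [e, e', hN.orth _ ha ha2]
  have := mul_le_mul_of_nonneg_left hN.integral_sq_le (sq_nonneg γ)
  linarith

end Expected

/-! ### Runs of the algorithm -/

section Run

variable {m n : ℕ} {Ω Zf Zg : Type*} {mΩ : MeasurableSpace Ω} [MeasurableSpace Zf]
  [MeasurableSpace Zg]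

/-- The random states of the algorithm. -/
noncomputable def path (P : Problem m n) (A : Params) (Gf : Oracle m n Zf) (Gg : Oracle m n Zg)
    (x₀ : Vec m) (y₀ z₀ : Vec n) (S : SampleIndex → Ω → Draw Zf Zg) (k : ℕ) (ω : Ω) : State m n :=
  iterate P A Gf Gg x₀ y₀ z₀ (fun i => S i ω) k

/-- Standing assumptions on a run of the algorithm. -/
structure IsRun (Pr : Measure Ω) (Qf : Measure Zf) (Qg : Measure Zg) (P : Problem m n)
    (A : Params) (Gf : Oracle m n Zf) (Gg : Oracle m n Zg) (S : SampleIndex → Ω → Draw Zf Zg)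
    (x₀ : Vec m) (y₀ z₀ : Vec n) (L q Cf sf sg : ℝ) : Prop where
  tame : P.Tame A.ρ L q Cf (A.σ 0)
  diff_f : ∀ x ∈ P.X, ∀ y ∈ P.Y, DifferentiableAt ℝ (joint P.f) (WithLp.toLp 2 (x, y))
  sampling : IsSampling Pr Qf Qg S
  fdx : IsEstimator Qf P.X P.Y Gf.dx (gradX P.f) (sf ^ 2)
  fdy : IsEstimator Qf P.X P.Y Gf.dy (gradY P.f) (sf ^ 2)
  gdx : IsEstimator Qg P.X P.Y Gg.dx (gradX P.g) (sg ^ 2)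
  gdy : IsEstimator Qg P.X P.Y Gg.dy (gradY P.g) (sg ^ 2)
  σ_mem : ∀ k, A.σ k ∈ Set.Icc 0 (A.σ 0)
  β_pos : ∀ k, 0 < A.β k
  β_le_one : ∀ k, A.β k ≤ 1
  γ_pos : ∀ k, 0 < A.γ k
  T_pos : ∀ k, 1 ≤ A.T k
  M_pos : ∀ k, 1 ≤ A.M k
  rate_le : ∀ k, rate A k ≤ 1 / 8
  x₀_mem : x₀ ∈ P.X
  y₀_mem : y₀ ∈ P.Y
  z₀_mem : z₀ ∈ P.Y

/-- Indices drawn before inner step `t` of iteration `k`. -/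
def pastInner (k t : ℕ) : Set SampleIndex :=
  {i | outerIdx i < k ∨ ∃ r < t, i = Sum.inl (k, r)}

/-- Indices drawn before batch element `j` of iteration `k`. -/
def pastBatch (k j : ℕ) : Set SampleIndex :=
  {i | outerIdx i < k ∨ (∃ r, i = Sum.inl (k, r)) ∨ ∃ r < j, i = Sum.inr (k, r)}

lemma not_mem_pastInner (k t : ℕ) : Sum.inl (k, t) ∉ pastInner k t := by
  rintro (h | ⟨r, hr, h⟩)
  · exact lt_irrefl k h
  · simp only [Sum.inl.injEq, Prod.mk.injEq, true_and] at h
    omega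

lemma not_mem_pastBatch (k j : ℕ) : Sum.inr (k, j) ∉ pastBatch k j := by
  rintro (h | ⟨r, h⟩ | ⟨r, hr, h⟩)
  · exact lt_irrefl k h
  · simp at h
  · simp only [Sum.inr.injEq, Prod.mk.injEq, true_and] at h
    omega

namespace IsRun

variable {Pr : Measure Ω} {Qf : Measure Zf} {Qg : Measure Zg} {P : Problem m n} {A : Params}
  {Gf : Oracle m n Zf} {Gg : Oracle m n Zg} {S : SampleIndex → Ω → Draw Zf Zg}
  {x₀ : Vec m} {y₀ z₀ : Vec n} {L q Cf sf sg : ℝ}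

lemma nonempty_Y (h : IsRun Pr Qf Qg P A Gf Gg S x₀ y₀ z₀ L q Cf sf sg) : P.Y.Nonempty :=
  ⟨y₀, h.y₀_mem⟩

lemma nonempty_X (h : IsRun Pr Qf Qg P A Gf Gg S x₀ y₀ z₀ L q Cf sf sg) : P.X.Nonempty :=
  ⟨x₀, h.x₀_mem⟩

lemma measurable_projX (h : IsRun Pr Qf Qg P A Gf Gg S x₀ y₀ z₀ L q Cf sf sg) :
    Measurable (proj P.X) :=
  (continuous_proj h.tame.closed_X h.tame.convex_X h.nonempty_X).measurable

lemma measurable_projY (h : IsRun Pr Qf Qg P A Gf Gg S x₀ y₀ z₀ L q Cf sf sg) :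
    Measurable (proj P.Y) :=
  (continuous_proj h.tame.compact_Y.isClosed h.tame.convex_Y h.nonempty_Y).measurable

lemma mem (h : IsRun Pr Qf Qg P A Gf Gg S x₀ y₀ z₀ L q Cf sf sg) (k : ℕ) (ω : Ω) :
    (path P A Gf Gg x₀ y₀ z₀ S k ω).Mem P :=
  iterate_mem h.tame.closed_X h.tame.compact_Y.isClosed h.tame.convex_Y h.β_pos h.β_le_one
    h.x₀_mem h.y₀_mem h.z₀_mem _ k

lemma meas (h : IsRun Pr Qf Qg P A Gf Gg S x₀ y₀ z₀ L q Cf sf sg) {ℱ : MeasurableSpace Ω} (k : ℕ)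
    (hS : ∀ i, outerIdx i < k → Measurable[ℱ] (S i)) :
    State.Meas ℱ (path P A Gf Gg x₀ y₀ z₀ S k) :=
  measurable_iterate h.measurable_projX h.measurable_projY h.fdy.meas h.gdy.meas h.fdx.meas
    h.gdx.meas x₀ y₀ z₀ k hS

lemma meas_self (h : IsRun Pr Qf Qg P A Gf Gg S x₀ y₀ z₀ L q Cf sf sg) (k : ℕ) :
    State.Meas mΩ (path P A Gf Gg x₀ y₀ z₀ S k) :=
  h.meas k fun i _ => h.sampling.measurable i

lemma proxY_mem (h : IsRun Pr Qf Qg P A Gf Gg S x₀ y₀ z₀ L q Cf sf sg) (k : ℕ) (ω : Ω) :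
    proxY P A k (path P A Gf Gg x₀ y₀ z₀ S k ω) ∈ P.Y :=
  h.tame.prox_h_mem (h.mem k ω).x h.nonempty_Y (h.σ_mem k) _

lemma proxZ_mem (h : IsRun Pr Qf Qg P A Gf Gg S x₀ y₀ z₀ L q Cf sf sg) (k : ℕ) (ω : Ω) :
    proxZ P A (path P A Gf Gg x₀ y₀ z₀ S k ω) ∈ P.Y :=
  h.tame.prox_g_mem (h.mem k ω).x h.nonempty_Y _

lemma measurable_proxY (h : IsRun Pr Qf Qg P A Gf Gg S x₀ y₀ z₀ L q Cf sf sg) (k : ℕ) :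
    Measurable fun ω => proxY P A k (path P A Gf Gg x₀ y₀ z₀ S k ω) :=
  h.tame.measurable_prox (h.tame.smooth_h _ (h.σ_mem k)) h.nonempty_Y (h.meas_self k).x
    (h.meas_self k).y fun ω => (h.mem k ω).x

lemma measurable_proxZ (h : IsRun Pr Qf Qg P A Gf Gg S x₀ y₀ z₀ L q Cf sf sg) (k : ℕ) :
    Measurable fun ω => proxZ P A (path P A Gf Gg x₀ y₀ z₀ S k ω) :=
  h.tame.measurable_prox h.tame.smooth_g h.nonempty_Y (h.meas_self k).x
    (h.meas_self k).z fun ω => (h.mem k ω).x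

lemma rate_eq (A : Params) (k : ℕ) : 2 * rate A k = A.T k * (A.γ k / A.ρ) / 2 := by
  rw [rate]; ring

lemma step_ratio_le (h : IsRun Pr Qf Qg P A Gf Gg S x₀ y₀ z₀ L q Cf sf sg) (k : ℕ) :
    (A.T k : ℝ) * (A.γ k / A.ρ) ≤ 1 / 2 := by
  have := h.rate_le k
  have := rate_eq A k
  linarith

lemma gamma_div_le (h : IsRun Pr Qf Qg P A Gf Gg S x₀ y₀ z₀ L q Cf sf sg) (k : ℕ) :
    A.γ k / A.ρ ≤ 1 / 2 := by
  refine le_trans ?_ (h.step_ratio_le k)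
  refine le_mul_of_one_le_left (div_nonneg (h.γ_pos k).le h.tame.ρ_pos.le) ?_
  exact_mod_cast h.T_pos k

variable [IsProbabilityMeasure Pr]

lemma integral_wy_le (h : IsRun Pr Qf Qg P A Gf Gg S x₀ y₀ z₀ L q Cf sf sg) (k : ℕ) :
    ∫ ω, ‖(path P A Gf Gg x₀ y₀ z₀ S (k + 1) ω).wy
        - proxY P A k (path P A Gf Gg x₀ y₀ z₀ S k ω)‖ ^ 2 ∂Pr
      ≤ (1 - 2 * rate A k) * ∫ ω, ‖(path P A Gf Gg x₀ y₀ z₀ S k ω).wy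
          - proxY P A k (path P A Gf Gg x₀ y₀ z₀ S k ω)‖ ^ 2 ∂Pr
        + A.T k * (A.γ k ^ 2 * (2 * (A.σ k ^ 2 * sf ^ 2) + 2 * sg ^ 2)) := by
  set u : ℕ → Ω → Vec n := fun t ω => innerU P A Gf Gg k (path P A Gf Gg x₀ y₀ z₀ S k ω)
    (fun t => S (Sum.inl (k, t)) ω) t
  rw [rate_eq]
  refine linear_recursion_le (e := fun t => ∫ ω, ‖u t ω
      - proxY P A k (path P A Gf Gg x₀ y₀ z₀ S k ω)‖ ^ 2 ∂Pr)
    (div_nonneg (h.γ_pos k).le h.tame.ρ_pos.le) (by positivity)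
    (integral_nonneg fun _ => sq_nonneg _) (A.T k) ((h.step_ratio_le k).trans (by norm_num))
    fun t _ => ?_
  have hle := h.sampling.drawsIn_le (pastInner k t)
  have hst : State.Meas (drawsIn S (pastInner k t)) (path P A Gf Gg x₀ y₀ z₀ S k) :=
    h.meas k fun i hi => measurable_drawsIn (Or.inl hi)
  have hu : Measurable[drawsIn S (pastInner k t)] (u t) :=
    measurable_innerU h.measurable_projY h.fdy.meas h.gdy.meas hst k
      (d := fun t => S (Sum.inl (k, t))) t fun r hr => measurable_drawsIn (Or.inr ⟨r, hr, rfl⟩)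
  have hum : ∀ ω, u t ω ∈ P.Y := fun ω => innerU_mem h.tame.compact_Y.isClosed (h.mem k ω) k _ t
  have hxm := fun ω => (h.mem k ω).x
  have hS := h.sampling.measurable (Sum.inl (k, t))
  have nf := h.fdy.isNoise hle hst.x hu hS.fst hxm hum
    (h.sampling.indep_drawsIn (not_mem_pastInner k t) measurable_fst) (h.sampling.law_f _)
  have ng := h.gdy.isNoise hle hst.x hu hS.snd.fst hxm hum
    (h.sampling.indep_drawsIn (not_mem_pastInner k t) measurable_snd.fst) (h.sampling.law_g _)
  have key := h.tame.integral_inner_step_le (h.tame.smooth_h _ (h.σ_mem k)) (h.γ_pos k).le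
    (h.gamma_div_le k) hst.x hst.y hu hxm hum ((nf.smul (A.σ k)).add ng)
  refine le_trans (le_of_eq ?_) key
  refine integral_congr_ae (Filter.Eventually.of_forall fun ω => ?_)
  have e := gradY_h (h.diff_f _ (hxm ω) _ (hum ω)) (h.tame.smooth_g.differentiableAt (hxm ω) (hum ω))
    (A.σ k)
  have e2 : ∀ a b c d : Vec n, A.σ k • b + d + (A.σ k • (a - b) + (c - d)) = A.σ k • a + c :=
    fun a b c d => by module
  simp only [e, e2]
  rfl

lemma integral_wz_le (h : IsRun Pr Qf Qg P A Gf Gg S x₀ y₀ z₀ L q Cf sf sg) (k : ℕ) :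
    ∫ ω, ‖(path P A Gf Gg x₀ y₀ z₀ S (k + 1) ω).wz
        - proxZ P A (path P A Gf Gg x₀ y₀ z₀ S k ω)‖ ^ 2 ∂Pr
      ≤ (1 - 2 * rate A k) * ∫ ω, ‖(path P A Gf Gg x₀ y₀ z₀ S k ω).wz
          - proxZ P A (path P A Gf Gg x₀ y₀ z₀ S k ω)‖ ^ 2 ∂Pr
        + A.T k * (A.γ k ^ 2 * sg ^ 2) := by
  set u : ℕ → Ω → Vec n := fun t ω => innerV P A Gg k (path P A Gf Gg x₀ y₀ z₀ S k ω)
    (fun t => S (Sum.inl (k, t)) ω) t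
  rw [rate_eq]
  refine linear_recursion_le (e := fun t => ∫ ω, ‖u t ω
      - proxZ P A (path P A Gf Gg x₀ y₀ z₀ S k ω)‖ ^ 2 ∂Pr)
    (div_nonneg (h.γ_pos k).le h.tame.ρ_pos.le) (by positivity)
    (integral_nonneg fun _ => sq_nonneg _) (A.T k) ((h.step_ratio_le k).trans (by norm_num))
    fun t _ => ?_
  have hle := h.sampling.drawsIn_le (pastInner k t)
  have hst : State.Meas (drawsIn S (pastInner k t)) (path P A Gf Gg x₀ y₀ z₀ S k) :=
    h.meas k fun i hi => measurable_drawsIn (Or.inl hi)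
  have hu : Measurable[drawsIn S (pastInner k t)] (u t) :=
    measurable_innerV h.measurable_projY h.gdy.meas hst k
      (d := fun t => S (Sum.inl (k, t))) t fun r hr => measurable_drawsIn (Or.inr ⟨r, hr, rfl⟩)
  have hum : ∀ ω, u t ω ∈ P.Y := fun ω => innerV_mem h.tame.compact_Y.isClosed (h.mem k ω) k _ t
  have hxm := fun ω => (h.mem k ω).x
  have hS := h.sampling.measurable (Sum.inl (k, t))
  have ng := h.gdy.isNoise hle hst.x hu hS.snd.snd hxm hum
    (h.sampling.indep_drawsIn (not_mem_pastInner k t) measurable_snd.snd) (h.sampling.law_g' _)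
  have key := h.tame.integral_inner_step_le h.tame.smooth_g (h.γ_pos k).le
    (h.gamma_div_le k) hst.x hst.z hu hxm hum ng
  refine le_trans (le_of_eq ?_) key
  refine integral_congr_ae (Filter.Eventually.of_forall fun ω => ?_)
  simp only [add_sub_cancel]
  rfl

end IsRun

end Run

end BilevelSGD

namespace BilevelSGD

open scoped InnerProductSpace

section Descent

variable {m n : ℕ} {Ω Zf Zg : Type*} {P : Problem m n}
  {A : Params} {Gf : Oracle m n Zf} {Gg : Oracle m n Zg} {S : SampleIndex → Ω → Draw Zf Zg}
  {x₀ : Vec m} {y₀ z₀ : Vec n} {L q Cf sf sg : ℝ}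

/-- The batch direction used for the outer variable at iteration `k`. -/
noncomputable def batchDir (A : Params) (Gf : Oracle m n Zf) (Gg : Oracle m n Zg) (k : ℕ)
    (st st' : State m n) (e : ℕ → Draw Zf Zg) : Vec m :=
  (A.M k : ℝ)⁻¹ • ∑ j ∈ Finset.range (A.M k),
    (A.σ k • Gf.dx st.x st'.wy (e j).1 + Gg.dx st.x st'.wy (e j).2.1
      - Gg.dx st.x st'.wz (e j).2.2)

lemma path_succ_x (k : ℕ) (ω : Ω) : (path P A Gf Gg x₀ y₀ z₀ S (k + 1) ω).x
    = proj P.X ((path P A Gf Gg x₀ y₀ z₀ S k ω).x - A.α k • batchDir A Gf Gg k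
      (path P A Gf Gg x₀ y₀ z₀ S k ω) (path P A Gf Gg x₀ y₀ z₀ S (k + 1) ω)
      (fun j => S (Sum.inr (k, j)) ω)) := by
  rw [batchDir, smul_smul, ← div_eq_mul_inv]
  rfl

/-- The error of the batch direction with respect to the exact partial gradients. -/
noncomputable def batchErr (P : Problem m n) (A : Params) (Gf : Oracle m n Zf)
    (Gg : Oracle m n Zg) (x₀ : Vec m) (y₀ z₀ : Vec n) (S : SampleIndex → Ω → Draw Zf Zg) (k : ℕ)
    (ω : Ω) : Vec m :=
  batchDir A Gf Gg k (path P A Gf Gg x₀ y₀ z₀ S k ω) (path P A Gf Gg x₀ y₀ z₀ S (k + 1) ω)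
      (fun j => S (Sum.inr (k, j)) ω)
    - (gradX (P.h (A.σ k)) (path P A Gf Gg x₀ y₀ z₀ S k ω).x
        (path P A Gf Gg x₀ y₀ z₀ S (k + 1) ω).wy
      - gradX P.g (path P A Gf Gg x₀ y₀ z₀ S k ω).x (path P A Gf Gg x₀ y₀ z₀ S (k + 1) ω).wz)

lemma Problem.Tame.abs_merit_le {ρ s : ℝ} (hP : P.Tame ρ L q Cf s) {C D σ : ℝ}
    (hC : 1 ≤ C) (hσ : σ ∈ Set.Icc 0 s) (hD : ∀ v ∈ P.Y, ‖v‖ ≤ D) {x : Vec m} (hx : x ∈ P.X)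
    {y z : Vec n} (hy : y ∈ P.Y) (hz : z ∈ P.Y) :
    |P.merit C ρ σ x y z| ≤ σ * Cf + C * ((D + D) ^ 2 / (2 * ρ)) := by
  have hY := hP.compact_Y
  have hne : P.Y.Nonempty := ⟨y, hy⟩
  have hcg := hP.smooth_g.continuousOn_right hx
  have hch := (hP.smooth_h σ hσ).continuousOn_right hx
  obtain ⟨v, hv⟩ := exists_mem_argminSet hY hne hcg
  have hb : ∀ w ∈ P.Y, ‖v - w‖ ^ 2 / (2 * ρ) ≤ (D + D) ^ 2 / (2 * ρ) := fun w hw =>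
    div_le_div_of_nonneg_right (pow_le_pow_left₀ (norm_nonneg _)
      ((norm_sub_le _ _).trans (add_le_add (hD v hv.1) (hD w hw))) 2)
      (mul_nonneg zero_le_two hP.ρ_pos.le)
  have g1 := minValue_le_envelope hP.ρ_pos hY hne hcg z
  have g2 := envelope_le hP.ρ_pos hY hcg z hv.1
  have h2 := envelope_le hP.ρ_pos hY hch y hv.1
  have h1 := envelope_eq hP.ρ_pos hY hne hch y
  have hw := hP.prox_h_mem hx hne hσ y
  set w := prox P.Y ρ (P.h σ x) y
  have f1 := mul_le_mul_of_nonneg_left (abs_le.1 (hP.bound_f x hx w hw)).1 hσ.1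
  have f2 := mul_le_mul_of_nonneg_left (abs_le.1 (hP.bound_f x hx v hv.1)).2 hσ.1
  have hg := hv.2 w hw
  have hp : 0 ≤ ‖w - y‖ ^ 2 / (2 * ρ) :=
    div_nonneg (sq_nonneg _) (mul_nonneg zero_le_two hP.ρ_pos.le)
  have b1 := hb y hy
  have b2 := hb z hz
  have hB : 0 ≤ (D + D) ^ 2 / (2 * ρ) :=
    div_nonneg (sq_nonneg _) (mul_nonneg zero_le_two hP.ρ_pos.le)
  rw [minValue_eq hv] at g1
  simp only [Problem.merit, minValue_eq hv]
  simp only [Problem.h] at h1 h2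
  set E := envelope P.Y ρ (P.g x) z
  have c1 := mul_nonneg (sub_nonneg.2 hC) (sub_nonneg.2 g1)
  have c2 := mul_le_mul_of_nonneg_left (show E - P.g x v ≤ (D + D) ^ 2 / (2 * ρ) by linarith)
    (sub_nonneg.2 hC)
  have c3 : 0 ≤ (C - 1) * ((D + D) ^ 2 / (2 * ρ)) := mul_nonneg (sub_nonneg.2 hC) hB
  rw [abs_le]
  constructor <;> linarith

variable {mΩ : MeasurableSpace Ω} [MeasurableSpace Zf] [MeasurableSpace Zg] {Pr : Measure Ω}
  {Qf : Measure Zf} {Qg : Measure Zg}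

namespace IsRun

lemma measurable_Phi (h : IsRun Pr Qf Qg P A Gf Gg S x₀ y₀ z₀ L q Cf sf sg) (C : ℝ) (k : ℕ) :
    Measurable fun ω => P.Phi C A.ρ (A.σ k) (path P A Gf Gg x₀ y₀ z₀ S k ω).x
      (path P A Gf Gg x₀ y₀ z₀ S k ω).y (path P A Gf Gg x₀ y₀ z₀ S k ω).z := by
  have hs := h.meas_self k
  have hxm : ∀ ω, (path P A Gf Gg x₀ y₀ z₀ S k ω).x ∈ P.X := fun ω => (h.mem k ω).x
  have hY := h.tame.compact_Y
  have h1 := measurable_comp_of_continuousOn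
    ((h.tame.smooth_h _ (h.σ_mem k)).continuousOn_envelope (ρ := A.ρ) hY) (hs.x.prodMk hs.y)
    fun ω => ⟨hxm ω, trivial⟩
  have h2 := measurable_comp_of_continuousOn
    (h.tame.smooth_g.continuousOn_envelope (ρ := A.ρ) hY) (hs.x.prodMk hs.z)
    fun ω => ⟨hxm ω, trivial⟩
  have h3 := measurable_comp_of_continuousOn (h.tame.smooth_g.continuousOn_minValue hY) hs.x hxm
  exact ((h1.sub h2).div_const _).add ((h2.sub h3).const_mul _)

lemma measurable_weightedResidual (h : IsRun Pr Qf Qg P A Gf Gg S x₀ y₀ z₀ L q Cf sf sg) (k : ℕ) :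
    Measurable fun ω => weightedResidual P A k (path P A Gf Gg x₀ y₀ z₀ S k ω) := by
  have hs := h.meas_self k
  have hxm : ∀ ω, (path P A Gf Gg x₀ y₀ z₀ S k ω).x ∈ P.X := fun ω => (h.mem k ω).x
  have hy := h.measurable_proxY k
  have hz := h.measurable_proxZ k
  have h1 := measurable_comp_of_continuousOn
    ((h.tame.smooth_h _ (h.σ_mem k)).continuousOn_gradX h.tame.convex_X h.tame.convex_Y
      h.tame.L_pos.le) (hs.x.prodMk hy) fun ω => ⟨hxm ω, h.proxY_mem k ω⟩
  have h2 := measurable_comp_of_continuousOn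
    (h.tame.smooth_g.continuousOn_gradX h.tame.convex_X h.tame.convex_Y
      h.tame.L_pos.le) (hs.x.prodMk hz) fun ω => ⟨hxm ω, h.proxZ_mem k ω⟩
  have h3 := h.measurable_projX.comp (hs.x.sub ((h1.sub h2).const_smul (A.α k)))
  exact (((hs.x.sub h3).const_smul (A.α k)⁻¹).norm.pow_const 2 |>.const_mul _).add
    (((((hs.y.sub hy).const_smul A.ρ⁻¹).norm.pow_const 2).add
      (((hs.z.sub hz).const_smul A.ρ⁻¹).norm.pow_const 2)).const_mul _)

variable [IsProbabilityMeasure Pr]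

lemma batchErr_sq (h : IsRun Pr Qf Qg P A Gf Gg S x₀ y₀ z₀ L q Cf sf sg) (k : ℕ) :
    Integrable (fun ω => ‖batchErr P A Gf Gg x₀ y₀ z₀ S k ω‖ ^ 2) Pr ∧
      ∫ ω, ‖batchErr P A Gf Gg x₀ y₀ z₀ S k ω‖ ^ 2 ∂Pr
        ≤ 6 * (A.σ k ^ 2 * sf ^ 2 + sg ^ 2) / A.M k := by
  set x : Ω → Vec m := fun ω => (path P A Gf Gg x₀ y₀ z₀ S k ω).x
  set wy : Ω → Vec n := fun ω => (path P A Gf Gg x₀ y₀ z₀ S (k + 1) ω).wy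
  set wz : Ω → Vec n := fun ω => (path P A Gf Gg x₀ y₀ z₀ S (k + 1) ω).wz
  set N : ℕ → Ω → Vec m := fun j ω =>
    A.σ k • (Gf.dx (x ω) (wy ω) (S (Sum.inr (k, j)) ω).1 - gradX P.f (x ω) (wy ω))
      + (Gg.dx (x ω) (wy ω) (S (Sum.inr (k, j)) ω).2.1 - gradX P.g (x ω) (wy ω))
      + -(Gg.dx (x ω) (wz ω) (S (Sum.inr (k, j)) ω).2.2 - gradX P.g (x ω) (wz ω))
  have hxm : ∀ ω, x ω ∈ P.X := fun ω => (h.mem k ω).x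
  have hym : ∀ ω, wy ω ∈ P.Y := fun ω => (h.mem (k + 1) ω).wy
  have hzm : ∀ ω, wz ω ∈ P.Y := fun ω => (h.mem (k + 1) ω).wz
  have hst : ∀ j, State.Meas (drawsIn S (pastBatch k j)) (path P A Gf Gg x₀ y₀ z₀ S k) :=
    fun j => h.meas k fun i hi => measurable_drawsIn (Or.inl hi)
  have hy : ∀ j, Measurable[drawsIn S (pastBatch k j)] wy := fun j =>
    measurable_innerU h.measurable_projY h.fdy.meas h.gdy.meas (hst j) k
      (d := fun t => S (Sum.inl (k, t))) (A.T k)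
      fun r _ => measurable_drawsIn (Or.inr (Or.inl ⟨r, rfl⟩))
  have hz : ∀ j, Measurable[drawsIn S (pastBatch k j)] wz := fun j =>
    measurable_innerV h.measurable_projY h.gdy.meas (hst j) k
      (d := fun t => S (Sum.inl (k, t))) (A.T k)
      fun r _ => measurable_drawsIn (Or.inr (Or.inl ⟨r, rfl⟩))
  have hnoise : ∀ j < A.M k, IsNoise (drawsIn S (pastBatch k j)) Pr (N j)
      (6 * (A.σ k ^ 2 * sf ^ 2 + sg ^ 2)) := by
    intro j _
    have hle := h.sampling.drawsIn_le (pastBatch k j)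
    have hS := h.sampling.measurable (Sum.inr (k, j))
    have hn := not_mem_pastBatch k j
    have n1 := h.fdx.isNoise hle (hst j).x (hy j) hS.fst hxm hym
      (h.sampling.indep_drawsIn hn measurable_fst) (h.sampling.law_f _)
    have n2 := h.gdx.isNoise hle (hst j).x (hy j) hS.snd.fst hxm hym
      (h.sampling.indep_drawsIn hn measurable_snd.fst) (h.sampling.law_g _)
    have n3 := h.gdx.isNoise hle (hst j).x (hz j) hS.snd.snd hxm hzm
      (h.sampling.indep_drawsIn hn measurable_snd.snd) (h.sampling.law_g' _)
    refine (((n1.smul (A.σ k)).add n2).add n3.neg).mono ?_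
    have : 0 ≤ A.σ k ^ 2 * sf ^ 2 := by positivity
    linarith
  have hmeas : ∀ j < A.M k, ∀ i < j, Measurable[drawsIn S (pastBatch k j)] (N i) := by
    intro j _ i hi
    have hS : Measurable[drawsIn S (pastBatch k j)] (S (Sum.inr (k, i))) :=
      measurable_drawsIn (Or.inr (Or.inr ⟨i, hi, rfl⟩))
    let _ : MeasurableSpace Ω := drawsIn S (pastBatch k j)
    exact (((h.fdx.measurable_sub (hst j).x (hy j) hS.fst hxm hym).const_smul (A.σ k)).add
      (h.gdx.measurable_sub (hst j).x (hy j) hS.snd.fst hxm hym)).add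
      (h.gdx.measurable_sub (hst j).x (hz j) hS.snd.snd hxm hzm).neg
  obtain ⟨h1, h2⟩ := IsNoise.integral_sum_sq_le (A.M k) hnoise hmeas
  have hM : (0 : ℝ) < A.M k := by exact_mod_cast h.M_pos k
  have e : ∀ ω, ‖batchErr P A Gf Gg x₀ y₀ z₀ S k ω‖ ^ 2
      = ((A.M k : ℝ) ^ 2)⁻¹ * ‖∑ j ∈ Finset.range (A.M k), N j ω‖ ^ 2 := fun ω => by
    rw [← inv_pow, ← Real.norm_of_nonneg (inv_nonneg.2 hM.le), ← mul_pow, ← norm_smul]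
    congr 2
    have e1 : ∑ j ∈ Finset.range (A.M k), N j ω = ∑ j ∈ Finset.range (A.M k),
        (A.σ k • Gf.dx (x ω) (wy ω) (S (Sum.inr (k, j)) ω).1
          + Gg.dx (x ω) (wy ω) (S (Sum.inr (k, j)) ω).2.1
          - Gg.dx (x ω) (wz ω) (S (Sum.inr (k, j)) ω).2.2)
        - (A.M k : ℝ) • (A.σ k • gradX P.f (x ω) (wy ω) + gradX P.g (x ω) (wy ω)
          - gradX P.g (x ω) (wz ω)) := by
      have e2 : (A.M k : ℝ) • (A.σ k • gradX P.f (x ω) (wy ω) + gradX P.g (x ω) (wy ω)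
          - gradX P.g (x ω) (wz ω)) = ∑ _j ∈ Finset.range (A.M k),
          (A.σ k • gradX P.f (x ω) (wy ω) + gradX P.g (x ω) (wy ω)
          - gradX P.g (x ω) (wz ω)) := by
        rw [Finset.sum_const, Finset.card_range, Nat.cast_smul_eq_nsmul]
      rw [e2, ← Finset.sum_sub_distrib]
      refine Finset.sum_congr rfl fun j _ => ?_
      simp only [N]
      module
    rw [batchErr, gradX_h (h.diff_f _ (hxm ω) _ (hym ω))
      (h.tame.smooth_g.differentiableAt (hxm ω) (hym ω)), e1, smul_sub, smul_smul,
      inv_mul_cancel₀ hM.ne', one_smul]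
    rfl
  simp only [e]
  refine ⟨h1.const_mul _, ?_⟩
  rw [integral_const_mul]
  refine (mul_le_mul_of_nonneg_left h2 (by positivity)).trans_eq ?_
  field_simp

lemma integrable_Phi (h : IsRun Pr Qf Qg P A Gf Gg S x₀ y₀ z₀ L q Cf sf sg) {C : ℝ} (hC : 1 ≤ C)
    (k : ℕ) : Integrable (fun ω => P.Phi C A.ρ (A.σ k) (path P A Gf Gg x₀ y₀ z₀ S k ω).x
      (path P A Gf Gg x₀ y₀ z₀ S k ω).y (path P A Gf Gg x₀ y₀ z₀ S k ω).z) Pr := by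
  obtain ⟨D, hD⟩ := h.tame.compact_Y.isBounded.exists_norm_le
  refine Integrable.of_bound (h.measurable_Phi C k).aestronglyMeasurable
    ((A.σ k * Cf + C * ((D + D) ^ 2 / (2 * A.ρ))) / A.σ k)
    (Filter.Eventually.of_forall fun ω => ?_)
  have hm := h.mem k ω
  rw [Problem.Phi_eq, norm_div, Real.norm_of_nonneg (h.σ_mem k).1, Real.norm_eq_abs]
  exact div_le_div_of_nonneg_right (h.tame.abs_merit_le hC (h.σ_mem k) hD hm.x hm.y hm.z)
    (h.σ_mem k).1

lemma integrable_track (h : IsRun Pr Qf Qg P A Gf Gg S x₀ y₀ z₀ L q Cf sf sg) (j k : ℕ) :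
    Integrable (fun ω => ‖(path P A Gf Gg x₀ y₀ z₀ S j ω).wy
        - proxY P A k (path P A Gf Gg x₀ y₀ z₀ S k ω)‖ ^ 2) Pr ∧
      Integrable (fun ω => ‖(path P A Gf Gg x₀ y₀ z₀ S j ω).wz
        - proxZ P A (path P A Gf Gg x₀ y₀ z₀ S k ω)‖ ^ 2) Pr :=
  ⟨integrable_norm_sub_sq h.tame.compact_Y (h.meas_self j).wy (h.measurable_proxY k)
    (fun ω => (h.mem j ω).wy) (h.proxY_mem k),
  integrable_norm_sub_sq h.tame.compact_Y (h.meas_self j).wz (h.measurable_proxZ k)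
    (fun ω => (h.mem j ω).wz) (h.proxZ_mem k)⟩

lemma integrable_potential (h : IsRun Pr Qf Qg P A Gf Gg S x₀ y₀ z₀ L q Cf sf sg) {C : ℝ}
    (hC : 1 ≤ C) (Cw : ℝ) (k : ℕ) :
    Integrable (fun ω => potential P A k (path P A Gf Gg x₀ y₀ z₀ S k ω) C Cw) Pr :=
  (h.integrable_Phi hC k).add
    (((h.integrable_track k k).1.add (h.integrable_track k k).2).const_mul _)

/-- Expected decrease of the potential over one outer iteration. -/
lemma expected_descent (h : IsRun Pr Qf Qg P A Gf Gg S x₀ y₀ z₀ L q Cf sf sg) {C Cw : ℝ} (k : ℕ)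
    (hS : StepSmall C Cw A.ρ L (2 / q) (A.α k) (A.β k) (A.σ k) (A.σ (k + 1)) (rate A k)
      (rate A (k + 1))) :
    Integrable (fun ω => weightedResidual P A k (path P A Gf Gg x₀ y₀ z₀ S k ω)) Pr ∧
      ∫ ω, weightedResidual P A k (path P A Gf Gg x₀ y₀ z₀ S k ω) ∂Pr
        + ∫ ω, potential P A (k + 1) (path P A Gf Gg x₀ y₀ z₀ S (k + 1) ω) C Cw ∂Pr
      ≤ ∫ ω, potential P A k (path P A Gf Gg x₀ y₀ z₀ S k ω) C Cw ∂Pr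
        + (2 + 120 * Cw) * Cf * ((A.σ k - A.σ (k + 1)) / A.σ (k + 1))
        + (24 * (A.α k / A.σ k / A.M k)
          + 6 * (Cw * rate A k / (A.σ k * A.ρ)) * (A.T k * A.γ k ^ 2))
          * (A.σ k ^ 2 * sf ^ 2 + sg ^ 2) := by
  have hC : 1 ≤ C := by linarith [hS.C_ge]
  have hpath := fun ω => weightedResidual_add_potential_le h.tame hS (h.σ_mem k).2
    (h.mem k ω).x (h.mem k ω).y (h.mem k ω).z (h.mem (k + 1) ω).wy (h.mem (k + 1) ω).wz
    (path_succ_x k ω) rfl rfl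
  have hσ := hS.σ_pos
  have hα := hS.α_pos
  have hρ := hS.ρ_pos
  have hl := hS.lam_pos
  have hCw := hS.Cw_ge
  have hβ := hS.β_pos
  set c := Cw * rate A k / (A.σ k * A.ρ) with hc
  have hc0 : 0 ≤ c := by positivity
  obtain ⟨iy, iz⟩ := h.integrable_track (k + 1) k
  obtain ⟨jy, jz⟩ := h.integrable_track k k
  obtain ⟨iN, hN⟩ := h.batchErr_sq k
  have iΦ := h.integrable_Phi hC k
  have iV := h.integrable_potential hC Cw (k + 1)
  set D := (2 + 120 * Cw) * Cf * ((A.σ k - A.σ (k + 1)) / A.σ (k + 1))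
  have i1 := iΦ.add ((iy.add iz).const_mul (c * (1 + rate A k)))
  have i2 := i1.add (integrable_const D)
  have i3 := i2.add (iN.const_mul (4 * (A.α k / A.σ k)))
  have iR : Integrable (fun ω => weightedResidual P A k (path P A Gf Gg x₀ y₀ z₀ S k ω)) Pr := by
    refine (i3.sub iV).mono' (h.measurable_weightedResidual k).aestronglyMeasurable
      (Filter.Eventually.of_forall fun ω => ?_)
    rw [Real.norm_of_nonneg (by rw [weightedResidual]; positivity)]
    exact le_sub_iff_add_le.2 (hpath ω)
  refine ⟨iR, ?_⟩
  have hint := integral_mono (iR.add iV) i3 hpath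
  have e0 := integral_add iR iV
  have e1 := integral_add i2 (iN.const_mul (4 * (A.α k / A.σ k)))
  have e2 := integral_add i1 (integrable_const D)
  have e3 := integral_add iΦ ((iy.add iz).const_mul (c * (1 + rate A k)))
  have e4 := integral_add iy iz
  have e5 := integral_add iΦ ((jy.add jz).const_mul c)
  have e6 := integral_add jy jz
  have hpot : ∫ ω, potential P A k (path P A Gf Gg x₀ y₀ z₀ S k ω) C Cw ∂Pr
      = ∫ ω, P.Phi C A.ρ (A.σ k) (path P A Gf Gg x₀ y₀ z₀ S k ω).x
        (path P A Gf Gg x₀ y₀ z₀ S k ω).y (path P A Gf Gg x₀ y₀ z₀ S k ω).z ∂Pr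
      + c * (∫ ω, ‖(path P A Gf Gg x₀ y₀ z₀ S k ω).wy
          - proxY P A k (path P A Gf Gg x₀ y₀ z₀ S k ω)‖ ^ 2 ∂Pr
        + ∫ ω, ‖(path P A Gf Gg x₀ y₀ z₀ S k ω).wz
          - proxZ P A (path P A Gf Gg x₀ y₀ z₀ S k ω)‖ ^ 2 ∂Pr) := by
    simp only [Pi.add_apply, integral_const_mul] at e5 e6
    rw [← e6, ← e5]
    rfl
  simp only [Pi.add_apply, integral_const_mul, integral_const, probReal_univ, one_smul]
    at hint e0 e1 e2 e3 e4
  rw [hpot]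
  have hy := h.integral_wy_le k
  have hz := h.integral_wz_le k
  set Iy := ∫ ω, ‖(path P A Gf Gg x₀ y₀ z₀ S k ω).wy
    - proxY P A k (path P A Gf Gg x₀ y₀ z₀ S k ω)‖ ^ 2 ∂Pr
  set Iz := ∫ ω, ‖(path P A Gf Gg x₀ y₀ z₀ S k ω).wz
    - proxZ P A (path P A Gf Gg x₀ y₀ z₀ S k ω)‖ ^ 2 ∂Pr
  set Jy := ∫ ω, ‖(path P A Gf Gg x₀ y₀ z₀ S (k + 1) ω).wy
    - proxY P A k (path P A Gf Gg x₀ y₀ z₀ S k ω)‖ ^ 2 ∂Pr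
  set Jz := ∫ ω, ‖(path P A Gf Gg x₀ y₀ z₀ S (k + 1) ω).wz
    - proxZ P A (path P A Gf Gg x₀ y₀ z₀ S k ω)‖ ^ 2 ∂Pr
  have hI : 0 ≤ Iy + Iz := add_nonneg (integral_nonneg fun _ => sq_nonneg _)
    (integral_nonneg fun _ => sq_nonneg _)
  set v := A.σ k ^ 2 * sf ^ 2 + sg ^ 2 with hv
  have hsf : 0 ≤ A.σ k ^ 2 * sf ^ 2 := by positivity
  have hT : 0 ≤ (A.T k : ℝ) * A.γ k ^ 2 := by positivity
  have hJ : (1 + rate A k) * (Jy + Jz) ≤ (Iy + Iz) + 6 * (A.T k * A.γ k ^ 2) * v := by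
    have q0 : Jy + Jz ≤ (1 - 2 * rate A k) * (Iy + Iz) + 3 * ((A.T k * A.γ k ^ 2) * v) := by
      have := mul_nonneg hT hsf
      rw [hv]
      linarith
    have q1 := mul_le_mul_of_nonneg_left q0 (show 0 ≤ 1 + rate A k by positivity)
    have q2 : 0 ≤ (rate A k + 2 * rate A k ^ 2) * (Iy + Iz) := by positivity
    have q3 : 0 ≤ (1 - rate A k) * ((A.T k * A.γ k ^ 2) * v) :=
      mul_nonneg (by linarith [hS.lam_le]) (mul_nonneg hT (by positivity))
    linarith
  have hJ' := mul_le_mul_of_nonneg_left hJ hc0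
  have hN' := mul_le_mul_of_nonneg_left hN (show 0 ≤ 4 * (A.α k / A.σ k) by positivity)
  have eN : 4 * (A.α k / A.σ k) * (6 * v / A.M k) = 24 * (A.α k / A.σ k / A.M k) * v := by ring
  have hbatch : ∫ ω, ‖batchDir A Gf Gg k (path P A Gf Gg x₀ y₀ z₀ S k ω)
      (path P A Gf Gg x₀ y₀ z₀ S (k + 1) ω) (fun j => S (Sum.inr (k, j)) ω)
    - (gradX (P.h (A.σ k)) (path P A Gf Gg x₀ y₀ z₀ S k ω).x
        (path P A Gf Gg x₀ y₀ z₀ S (k + 1) ω).wy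
      - gradX P.g (path P A Gf Gg x₀ y₀ z₀ S k ω).x
        (path P A Gf Gg x₀ y₀ z₀ S (k + 1) ω).wz)‖ ^ 2 ∂Pr
    = ∫ ω, ‖batchErr P A Gf Gg x₀ y₀ z₀ S k ω‖ ^ 2 ∂Pr := rfl
  rw [e0, e1, e2, e3, e4] at hint
  rw [eN] at hN'
  linarith

end IsRun

end Descent

end BilevelSGD

namespace BilevelSGD

/-! ### From the step-size conditions to the standing assumptions -/

section Constants

variable {m n : ℕ} {P : Problem m n} {A : Params} {lf lg μ δ D Cf σmax C Cw : ℝ}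

lemma Params.Admissible.σ_mem (hA : A.Admissible σmax) (k : ℕ) : A.σ k ∈ Set.Icc 0 (A.σ 0) :=
  ⟨(hA.σ_pos k).le, antitone_nat_of_succ_le hA.σ_anti k.zero_le⟩

lemma Problem.Regular.tame (hR : P.Regular lf lg D Cf) (hμ : 0 < μ) (hδ : 0 < δ)
    (hρμ : A.ρ * μ ≤ 1) (hEB : P.ProxErrorBound A.ρ μ δ σmax) (hA : A.Admissible σmax)
    (hne : P.Y.Nonempty) (hρ : A.ρ < 1 / 16 / lg) (hσ : A.σ 0 < 1 * lg / lf) :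
    P.Tame A.ρ (2 * lg) (min μ (δ / D)) Cf (A.σ 0) := by
  have hlg := hR.lg_pos
  have hD := hR.D_pos
  have hρ0 := hA.ρ_pos
  have hY : IsCompact P.Y := Metric.isCompact_of_isClosed_isBounded hR.closed_Y
    (isBounded_iff_forall_norm_le.2 ⟨D, hR.bound_Y⟩)
  have hq : 0 < min μ (δ / D) := lt_min hμ (by positivity)
  have hsm : ∀ σ ∈ Set.Icc 0 (A.σ 0), SmoothOn P.X P.Y (P.h σ) (2 * lg) := fun σ h =>
    (hR.smooth_f.const_mul_add hR.smooth_g h.1).mono (by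
      have h1 := h.2.trans hσ.le
      rw [one_mul, le_div_iff₀ hR.lf_pos] at h1
      linarith)
  refine ⟨hR.closed_X, hR.convex_X, hY, hR.convex_Y, hρ0, by positivity, ?_, hq, ?_,
    hR.smooth_g.mono (by linarith), hsm, hR.bound_f, ?_⟩
  · rw [lt_div_iff₀ hlg] at hρ
    linarith
  · exact (mul_le_mul_of_nonneg_left (min_le_left _ _) hρ0.le).trans hρμ
  · intro x hx σ hσm y hy
    have hc := (hsm σ hσm).continuousOn_right hx
    have hp := prox_mem_proxSet (ρ := A.ρ) hY hne hc y
    have h1 := hEB x hx σ ⟨hσm.1, hσm.2.trans (hA.σ_le 0)⟩ y hy _ hp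
    set d := A.ρ⁻¹ * ‖y - prox P.Y A.ρ (P.h σ x) y‖
    have hd : 0 ≤ d := by positivity
    rcases le_or_gt d δ with hle | hlt
    · have h2 : Metric.infDist y (P.solSet x σ) ≤ d / μ := by
        rw [le_div_iff₀ hμ]
        linarith [h1 hle]
      refine h2.trans ?_
      rw [div_eq_inv_mul, ← one_div]
      exact mul_le_mul_of_nonneg_right
        (div_le_div₀ zero_le_two one_le_two hq (min_le_left _ _)) hd
    · obtain ⟨p, hp⟩ := exists_mem_argminSet hY hne hc
      have h2 := Metric.infDist_le_dist_of_mem (x := y) (show p ∈ P.solSet x σ from hp)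
      rw [dist_eq_norm] at h2
      have h3 := norm_sub_le y p
      have h4 := hR.bound_Y y hy
      have h5 := hR.bound_Y p hp.1
      have h6 : 2 / (δ / D) * d ≤ 2 / min μ (δ / D) * d :=
        mul_le_mul_of_nonneg_right
          (div_le_div_of_nonneg_left zero_le_two hq (min_le_right _ _)) hd
      have h7 : 2 * D ≤ 2 / (δ / D) * d := by
        rw [div_div_eq_mul_div, div_mul_eq_mul_div, le_div_iff₀ hδ]
        exact mul_le_mul_of_nonneg_left hlt.le (by positivity)
      linarith

/-- Scalar smallness conditions from bounds on the parameters. -/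
lemma stepSmall_of_bounds {C Cw ρ L q w α β σ σ' lam lam' : ℝ} (hC : 4 ≤ C) (hCw : 1 ≤ Cw)
    (hρ : 0 < ρ) (hL : 0 < L) (hq : 0 < q) (hα : 0 < α) (hβ : 0 < β) (hβ1 : β ≤ 1) (hσ' : 0 < σ')
    (hlam : 0 < lam) (hσ : σ' ≤ σ) (hw0 : 0 ≤ w) (hw : w ≤ q ^ 2)
    (hρq : ρ * q ≤ 1) (hr : ρ * L ≤ 1 / 8) (hα5 : α ≤ 1 / (4 * C + 30 * Cw) * ρ)
    (hα6 : α ≤ 1 / (16 * C ^ 2) * ρ ^ 3 * w * β)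
    (hτ : (σ - σ') / σ' ≤ 1 / (96 * C) * ρ ^ 2 * w * β)
    (hβ4 : β ≤ 1 / (8 * (4 * C + 240 * Cw))) (hβl : β ≤ 4 / (25 * C) * lam ^ 2)
    (hαl : α ≤ 4 / (25 * C) * ρ * lam ^ 2) (hl : lam ≤ 1 / 16)
    (hgr : lam' ≤ (1 + lam / 8) * lam) :
    StepSmall C Cw ρ L (2 / q) α β σ σ' lam lam' := by
  have hC0 : 0 < C := by linarith
  have hr0 : 0 < ρ * L := by positivity
  have hr2 : (ρ * L) ^ 2 ≤ (1 / 8) ^ 2 := pow_le_pow_left₀ hr0.le hr 2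
  have hρq2 : ρ ^ 2 * w ≤ 1 := by
    have h1 := mul_le_mul_of_nonneg_left hw (sq_nonneg ρ)
    have h2 := pow_le_pow_left₀ (by positivity) hρq 2
    linarith [mul_pow ρ q 2]
  have hκw : (2 / q) ^ 2 * w ≤ 4 := by
    have h1 := mul_le_mul_of_nonneg_left hw (sq_nonneg (2 / q))
    have e : (2 / q) ^ 2 * q ^ 2 = 4 := by field_simp; ring
    linarith
  have hκw' : ρ * (2 / q) * w ≤ 2 := by
    have h1 := mul_le_mul_of_nonneg_left hw (show 0 ≤ ρ * (2 / q) by positivity)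
    have e : ρ * (2 / q) * q ^ 2 = 2 * (ρ * q) := by field_simp
    linarith
  have hα5' : (4 * C + 30 * Cw) * α ≤ ρ := by
    have h1 := mul_le_mul_of_nonneg_left hα5 (show 0 ≤ 4 * C + 30 * Cw by positivity)
    rwa [← mul_assoc, mul_one_div_cancel (by positivity), one_mul] at h1
  have hα6' : 16 * C ^ 2 * α ≤ ρ ^ 3 * w * β := by
    have h1 := mul_le_mul_of_nonneg_left hα6 (show 0 ≤ 16 * C ^ 2 by positivity)
    have e : 16 * C ^ 2 * (1 / (16 * C ^ 2) * ρ ^ 3 * w * β) = ρ ^ 3 * w * β := by field_simp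
    linarith
  have hLα : (4 * C + 30 * Cw) * (L * α) ≤ 1 / 8 := by
    have := mul_le_mul_of_nonneg_left hα5' hL.le
    linarith
  have hCLα : 0 ≤ C * (L * α) := by positivity
  have hCwLα : 0 ≤ Cw * (L * α) := by positivity
  refine ⟨hC, hCw, hρ, hL, hα, hβ, hσ', hlam, hσ, ?_, ?_, ?_, ?_, ?_, ?_,
    by linarith, ?_, ?_, ?_, hgr⟩
  · linarith
  · have h1 := mul_le_mul_of_nonneg_left hα6' (show 0 ≤ L ^ 2 * (2 / q) by positivity)
    have h2 : L ^ 2 * (2 / q) * (ρ ^ 3 * w * β) ≤ 1 / 32 := by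
      have e : L ^ 2 * (2 / q) * (ρ ^ 3 * w * β) = (ρ * L) ^ 2 * (ρ * (2 / q) * w) * β := by ring
      rw [e]
      have h3 := mul_le_mul hr2 hκw' (by positivity) (by norm_num)
      have h4 := mul_le_mul h3 hβ1 hβ.le (by norm_num)
      linarith
    have h5 : 0 ≤ L ^ 2 * (2 / q) * α * C := by positivity
    have h6 := mul_le_mul_of_nonneg_left hC h5
    linarith
  · have h1 := mul_le_mul_of_nonneg_left hα6' (show 0 ≤ L ^ 2 * (2 / q) ^ 2 by positivity)
    have e : L ^ 2 * (2 / q) ^ 2 * (ρ ^ 3 * w * β)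
      = (ρ * L) ^ 2 * ((2 / q) ^ 2 * w) * (ρ * β) := by ring
    have h3 := mul_le_mul hr2 hκw (by positivity) (by norm_num)
    have h4 := mul_le_mul_of_nonneg_right h3 (show 0 ≤ ρ * β by positivity)
    linarith
  · have h1 := mul_le_mul_of_nonneg_left hτ (show 0 ≤ 3 * C / (2 * ρ) * (2 / q) ^ 2 by positivity)
    have e : 3 * C / (2 * ρ) * (2 / q) ^ 2 * (1 / (96 * C) * ρ ^ 2 * w * β)
      = 1 / 64 * ((2 / q) ^ 2 * w) * (ρ * β) := by field_simp; ring
    have h4 := mul_le_mul_of_nonneg_right hκw (show 0 ≤ ρ * β by positivity)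
    linarith
  · have h1 := mul_le_mul_of_nonneg_right hr2 hβ.le
    have h2 : α ≤ ρ := by nlinarith
    have h3 := mul_le_mul_of_nonneg_right h2 (show 0 ≤ ρ * β * L ^ 2 by positivity)
    linarith
  · have h1 := mul_le_mul_of_nonneg_right hρq2 hβ.le
    have h2 : 1 / (96 * C) ≤ 1 := by rw [div_le_one (by positivity)]; linarith
    have h3 : 4 / (25 * C) ≤ 1 := by rw [div_le_one (by positivity)]; linarith
    have h4 : 1 / (96 * C) * ρ ^ 2 * w * β ≤ β := by
      have := mul_le_mul h2 h1 (by positivity) zero_le_one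
      linarith
    have h5 := mul_le_mul_of_nonneg_right h3 (sq_nonneg lam)
    have h6 := mul_le_mul_of_nonneg_left hl hlam.le
    linarith
  · have h1 := mul_le_mul_of_nonneg_right hr (show 0 ≤ Cw * (L * α) by positivity)
    linarith
  · rw [le_div_iff₀ (by positivity)] at hβ4
    linarith
  · have h1 : (C + 1) * (β / ρ) ≤ 1 / 5 * (lam ^ 2 / ρ) := by
      have h2 := mul_le_mul_of_nonneg_left hβl (show 0 ≤ (C + 1) / ρ by positivity)
      have e : (C + 1) / ρ * (4 / (25 * C) * lam ^ 2)
        = (4 * (C + 1) / (25 * C)) * (lam ^ 2 / ρ) := by ring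
      have h3 : 4 * (C + 1) / (25 * C) ≤ 1 / 5 := by
        rw [div_le_div_iff₀ (by positivity) (by norm_num)]
        linarith
      have h4 := mul_le_mul_of_nonneg_right h3 (show 0 ≤ lam ^ 2 / ρ by positivity)
      have e2 : (C + 1) * (β / ρ) = (C + 1) / ρ * β := by ring
      linarith
    have h2 : 4 * α * L ^ 2 ≤ 1 / 20 * (lam ^ 2 / ρ) := by
      have h3 := mul_le_mul_of_nonneg_left hαl (show 0 ≤ 4 * L ^ 2 by positivity)
      have e : 4 * L ^ 2 * (4 / (25 * C) * ρ * lam ^ 2)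
        = 16 / (25 * C) * (ρ * L) ^ 2 * (lam ^ 2 / ρ) := by field_simp; ring
      have h4 : 16 / (25 * C) ≤ 1 := by rw [div_le_one (by positivity)]; linarith
      have h5 := mul_le_mul h4 hr2 (sq_nonneg _) zero_le_one
      have h6 := mul_le_mul_of_nonneg_right h5 (show 0 ≤ lam ^ 2 / ρ by positivity)
      have : 0 ≤ lam ^ 2 / ρ := by positivity
      linarith
    have h3 : lam ^ 2 / ρ ≤ Cw * (lam ^ 2 / ρ) := le_mul_of_one_le_left (by positivity) hCw
    have e : Cw * lam ^ 2 / (4 * ρ) = 1 / 4 * (Cw * (lam ^ 2 / ρ)) := by field_simp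
    rw [e]
    linarith

lemma stepSmall_of_conditions (hlg : 0 < lg) (hD : 0 < D) (hμ : 0 < μ) (hδ : 0 < δ)
    (hρμ : A.ρ * μ ≤ 1) (hA : A.Admissible σmax) (hC : 4 ≤ C) (hCw : 1 ≤ Cw)
    (hS : A.StepConditions lf lg μ δ D 1 (1 / 16) (1 / 4) (1 / (8 * (4 * C + 240 * Cw)))
      (1 / (4 * C + 30 * Cw)) (1 / (16 * C ^ 2)) (1 / (96 * C)) (1 / (100 * C)) (1 / 32)) (k : ℕ) :
    rate A k ≤ 1 / 16 ∧ StepSmall C Cw A.ρ (2 * lg) (2 / min μ (δ / D)) (A.α k) (A.β k) (A.σ k)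
      (A.σ (k + 1)) (rate A k) (rate A (k + 1)) := by
  have hρ := hA.ρ_pos
  have hα := hA.α_pos k
  have hβ := hA.β_pos k
  have hβ1 := hA.β_le_one k
  have hγ := hA.γ_pos k
  have hT : (0 : ℝ) < A.T k := by exact_mod_cast hA.T_pos k
  have hT' : (0 : ℝ) < A.T (k + 1) := by exact_mod_cast hA.T_pos (k + 1)
  have hl : 0 < rate A k := by rw [rate]; positivity
  have eT : (A.T k : ℝ) * A.γ k = 4 * A.ρ * rate A k := by rw [rate]; field_simp
  have eT' : (A.T (k + 1) : ℝ) * A.γ (k + 1) = 4 * A.ρ * rate A (k + 1) := by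
    rw [rate]; field_simp
  have hq : 0 < min μ (δ / D) := lt_min hμ (by positivity)
  have hρq : A.ρ * min μ (δ / D) ≤ 1 :=
    (mul_le_mul_of_nonneg_left (min_le_left _ _) hρ.le).trans hρμ
  have hw : min (μ ^ 2) (δ ^ 2 / D ^ 2) ≤ min μ (δ / D) ^ 2 := by
    rcases min_choice μ (δ / D) with h | h <;> rw [h]
    · exact min_le_left _ _
    · rw [div_pow]; exact min_le_right _ _
  have hw0 : 0 ≤ min (μ ^ 2) (δ ^ 2 / D ^ 2) := by positivity
  have hr : A.ρ * (2 * lg) ≤ 1 / 8 := by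
    have := hS.ρ_lt
    rw [lt_div_iff₀ hlg] at this
    linarith
  have hin := hS.inner_lt k
  have hαβ := hS.α_le_β k
  have hdec := hS.σ_decay k
  have hcomp := hS.compact k
  have hgr := hS.inner_growth k
  have hα5 : A.α k ≤ 1 / (4 * C + 30 * Cw) * A.ρ := by
    refine (hS.α_le k).trans (mul_le_of_le_one_right (by positivity) (inv_le_one_of_one_le₀ ?_))
    have : 0 ≤ lg / μ := by positivity
    linarith
  have hβ0 : 0 ≤ A.ρ * A.β k := by positivity
  have hmax : A.ρ * (A.ρ * A.β k + A.α k) ≤ 1 / (100 * C) * (4 * A.ρ * rate A k) ^ 2 := by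
    refine (mul_le_mul_of_nonneg_right (le_max_right 1 A.ρ) (by positivity)).trans
      (hcomp.trans_eq ?_)
    rw [← eT]; ring
  have hlam : rate A k ≤ 1 / 16 := by
    rw [eT] at hin
    have : A.ρ * rate A k ≤ A.ρ * (1 / 16) := by linarith
    exact le_of_mul_le_mul_left this hρ
  refine ⟨hlam, stepSmall_of_bounds hC hCw hρ (by positivity) hq hα hβ hβ1 (hA.σ_pos (k + 1)) hl
    (hA.σ_anti k) hw0 hw hρq hr hα5 hαβ hdec (hS.β_le k) ?_ ?_ hlam ?_⟩
  · have h1 : A.ρ ^ 2 * A.β k ≤ A.ρ ^ 2 * (4 / (25 * C) * rate A k ^ 2) := by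
      have : 0 ≤ A.ρ * A.α k := by positivity
      have e : A.ρ ^ 2 * (4 / (25 * C) * rate A k ^ 2)
        = 1 / (100 * C) * (4 * A.ρ * rate A k) ^ 2 := by field_simp; ring
      rw [e]
      linarith
    exact le_of_mul_le_mul_left h1 (by positivity)
  · have h1 : A.ρ * A.α k ≤ A.ρ * (4 / (25 * C) * A.ρ * rate A k ^ 2) := by
      have : 0 ≤ A.ρ * (A.ρ * A.β k) := by positivity
      have e : A.ρ * (4 / (25 * C) * A.ρ * rate A k ^ 2)
        = 1 / (100 * C) * (4 * A.ρ * rate A k) ^ 2 := by field_simp; ring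
      rw [e]
      linarith
    exact le_of_mul_le_mul_left h1 hρ
  · have h1 : A.ρ * rate A (k + 1) ≤ A.ρ * ((1 + rate A k / 8) * rate A k) := by
      rw [eT, eT'] at hgr
      have e : 4 * A.ρ * rate A k / A.ρ = 4 * rate A k := by field_simp
      rw [e] at hgr
      linarith
    exact le_of_mul_le_mul_left h1 hρ

end Constants

section Main

open scoped InnerProductSpace

variable {m n : ℕ} {Ω Zf Zg : Type*} {mΩ : MeasurableSpace Ω} [MeasurableSpace Zf]
  [MeasurableSpace Zg] {Pr : Measure Ω} [IsProbabilityMeasure Pr] {Qf : Measure Zf}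
  {Qg : Measure Zg} {P : Problem m n}
  {A : Params} {Gf : Oracle m n Zf} {Gg : Oracle m n Zg} {S : SampleIndex → Ω → Draw Zf Zg}
  {x₀ : Vec m} {y₀ z₀ : Vec n} {lf lg μ δ D σmax q Cf sf sg : ℝ}

lemma Problem.Regular.isRun (hR : P.Regular lf lg D Cf)
    (htame : P.Tame A.ρ (2 * lg) q Cf (A.σ 0)) (hGf : Gf.IsUnbiased Qf P.X P.Y P.f sf)
    (hGg : Gg.IsUnbiased Qg P.X P.Y P.g sg) (hS : IsSampling Pr Qf Qg S)
    (hA : A.Admissible σmax) (hrate : ∀ k, rate A k ≤ 1 / 8) (hx₀ : x₀ ∈ P.X) (hy₀ : y₀ ∈ P.Y)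
    (hz₀ : z₀ ∈ P.Y) : IsRun Pr Qf Qg P A Gf Gg S x₀ y₀ z₀ (2 * lg) q Cf sf sg := by
  have : IsProbabilityMeasure Qf := by
    rw [← hS.law_f (Sum.inl (0, 0))]
    exact Measure.isProbabilityMeasure_map (hS.measurable _).fst.aemeasurable
  have : IsProbabilityMeasure Qg := by
    rw [← hS.law_g (Sum.inl (0, 0))]
    exact Measure.isProbabilityMeasure_map (hS.measurable _).snd.fst.aemeasurable
  exact ⟨htame, fun x hx y hy => hR.smooth_f.differentiableAt hx hy, hS,
    hGf.estimator_dx (hR.smooth_f.continuousOn_gradX hR.convex_X hR.convex_Y hR.lf_pos.le),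
    hGf.estimator_dy (hR.smooth_f.continuousOn_gradY hR.convex_X hR.convex_Y hR.lf_pos.le),
    hGg.estimator_dx (hR.smooth_g.continuousOn_gradX hR.convex_X hR.convex_Y hR.lg_pos.le),
    hGg.estimator_dy (hR.smooth_g.continuousOn_gradY hR.convex_X hR.convex_Y hR.lg_pos.le),
    hA.σ_mem, hA.β_pos, hA.β_le_one, hA.γ_pos, hA.T_pos, hA.M_pos, hrate, hx₀, hy₀, hz₀⟩

lemma noise_coefficient_le {ρ α σ γ T M Cw c v : ℝ} (hρ : 0 < ρ) (hα : 0 < α) (hσ : 0 < σ)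
    (hγ : 0 < γ) (hT : 0 < T) (hM : 0 < M) (hCw : 1 ≤ Cw) (hc : 0 ≤ c) (hv : 0 ≤ v) :
    (24 * (α / σ / M) + 6 * (Cw * (T * γ / (4 * ρ)) / (σ * ρ)) * (T * γ ^ 2)) * v
      ≤ 24 * (c + Cw) / ρ * (σ⁻¹ * (max 1 ρ * (α / M) + ρ⁻¹ * T ^ 2 * γ ^ 3) * v) := by
  have h1 : 24 * (α / σ / M) ≤ 24 * (c + Cw) / ρ * (σ⁻¹ * (max 1 ρ * (α / M))) := by
    have e : 24 * (c + Cw) / ρ * (σ⁻¹ * (max 1 ρ * (α / M)))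
      = 24 * (α / σ / M) * ((c + Cw) * (max 1 ρ / ρ)) := by field_simp
    rw [e]
    refine le_mul_of_one_le_right (by positivity) (one_le_mul_of_one_le_of_one_le (by linarith) ?_)
    rw [one_le_div hρ]
    exact le_max_right _ _
  have h2 : 6 * (Cw * (T * γ / (4 * ρ)) / (σ * ρ)) * (T * γ ^ 2)
      ≤ 24 * (c + Cw) / ρ * (σ⁻¹ * (ρ⁻¹ * T ^ 2 * γ ^ 3)) := by
    have e1 : 6 * (Cw * (T * γ / (4 * ρ)) / (σ * ρ)) * (T * γ ^ 2)
      = 3 / 2 * Cw * (T ^ 2 * γ ^ 3 / (σ * ρ ^ 2)) := by field_simp; ring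
    have e2 : 24 * (c + Cw) / ρ * (σ⁻¹ * (ρ⁻¹ * T ^ 2 * γ ^ 3))
      = 24 * (c + Cw) * (T ^ 2 * γ ^ 3 / (σ * ρ ^ 2)) := by field_simp
    rw [e1, e2]
    exact mul_le_mul_of_nonneg_right (by linarith) (by positivity)
  have h3 := mul_le_mul_of_nonneg_right (add_le_add h1 h2) hv
  refine h3.trans_eq ?_
  ring

end Main

end BilevelSGD

theorem mainTheorem3 :
    ∀ C : ℝ, 4 ≤ C →
    ∃ Cw₀ B : ℝ, 0 < Cw₀ ∧ 0 < B ∧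
    ∀ Cw : ℝ, Cw₀ ≤ Cw →
    ∃ c₁ c₂ c₃ c₄ c₅ c₆ c₇ c₈ c₉ B' : ℝ,
      (0 < c₁ ∧ 0 < c₂ ∧ 0 < c₃ ∧ 0 < c₄ ∧ 0 < c₅ ∧ 0 < c₆ ∧ 0 < c₇ ∧ 0 < c₈ ∧ 0 < c₉ ∧ 0 < B') ∧
    ∀ (m n : ℕ) (Ω Zf Zg : Type*) [MeasurableSpace Ω] [MeasurableSpace Zf] [MeasurableSpace Zg]
      (Pr : MeasureTheory.Measure Ω) [MeasureTheory.IsProbabilityMeasure Pr]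
      (Qf : MeasureTheory.Measure Zf) (Qg : MeasureTheory.Measure Zg)
      (P : BilevelSGD.Problem m n) (A : BilevelSGD.Params)
      (Gf : BilevelSGD.Oracle m n Zf) (Gg : BilevelSGD.Oracle m n Zg)
      (S : BilevelSGD.SampleIndex → Ω → BilevelSGD.Draw Zf Zg)
      (lf lg μ δ σmax D Cf sf sg : ℝ)
      (x₀ : BilevelSGD.Vec m) (y₀ z₀ : BilevelSGD.Vec n),
      P.Regular lf lg D Cf →
      0 < μ → 0 < δ → A.ρ * μ ≤ 1 →
      P.ProxErrorBound A.ρ μ δ σmax →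
      Gf.IsUnbiased Qf P.X P.Y P.f sf →
      Gg.IsUnbiased Qg P.X P.Y P.g sg →
      BilevelSGD.IsSampling Pr Qf Qg S →
      A.Admissible σmax →
      A.StepConditions lf lg μ δ D c₁ c₂ c₃ c₄ c₅ c₆ c₇ c₈ c₉ →
      x₀ ∈ P.X → y₀ ∈ P.Y → z₀ ∈ P.Y →
      let it : ℕ → Ω → BilevelSGD.State m n := fun k ω =>
        BilevelSGD.iterate P A Gf Gg x₀ y₀ z₀ (fun i => S i ω) k
      let V : ℕ → Ω → ℝ := fun k ω => BilevelSGD.potential P A k (it k ω) C Cw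
      let R : ℕ → Ω → ℝ := fun k ω => BilevelSGD.weightedResidual P A k (it k ω)
      ∀ K : ℕ,
        MeasureTheory.Integrable (fun ω => ∑ k ∈ Finset.range K, R k ω) Pr ∧
        MeasureTheory.Integrable (fun ω => V 0 ω - V K ω) Pr ∧
        ∫ ω, ∑ k ∈ Finset.range K, R k ω ∂Pr
          ≤ ∫ ω, (V 0 ω - V K ω) ∂Pr
            + B' * Cf * ∑ k ∈ Finset.range K, (A.σ k - A.σ (k + 1)) / A.σ (k + 1)
            + B * (lg / μ + Cw) / A.ρ * ∑ k ∈ Finset.range K,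
                (A.σ k)⁻¹ * (max 1 A.ρ * (A.α k / A.M k)
                  + A.ρ⁻¹ * (A.T k : ℝ) ^ 2 * A.γ k ^ 3)
                * (A.σ k ^ 2 * sf ^ 2 + sg ^ 2) := by
  intro C hC
  refine ⟨1, 24, one_pos, by norm_num, fun Cw hCw => ⟨1, 1 / 16, 1 / 4,
    1 / (8 * (4 * C + 240 * Cw)), 1 / (4 * C + 30 * Cw), 1 / (16 * C ^ 2), 1 / (96 * C),
    1 / (100 * C), 1 / 32, 2 + 120 * Cw, ?_, ?_⟩⟩
  · have hC0 : 0 < C := by linarith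
    have hCw0 : 0 < Cw := by linarith
    refine ⟨?_, ?_, ?_, ?_, ?_, ?_, ?_, ?_, ?_, ?_⟩ <;> positivity
  intro m n Ω Zf Zg _ _ _ Pr _ Qf Qg P A Gf Gg S lf lg μ δ σmax D Cf sf sg x₀ y₀ z₀
    hR hμ hδ hρμ hEB hGf hGg hS hA hcond hx₀ hy₀ hz₀ it V R K
  have htame := hR.tame hμ hδ hρμ hEB hA ⟨y₀, hy₀⟩ hcond.ρ_lt (hcond.σ_lt 0)
  have hsmall := BilevelSGD.stepSmall_of_conditions hR.lg_pos hR.D_pos hμ hδ hρμ hA hC hCw hcond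
  have hrun := hR.isRun htame hGf hGg hS hA (fun k => (hsmall k).1.trans (by norm_num))
    hx₀ hy₀ hz₀
  have hdesc := fun k => hrun.expected_descent k (hsmall k).2
  have iR : ∀ k, Integrable (R k) Pr := fun k => (hdesc k).1
  have iV : ∀ k, Integrable (V k) Pr := fun k =>
    hrun.integrable_potential (by linarith) Cw k
  refine ⟨integrable_finsetSum _ fun k _ => iR k, (iV 0).sub (iV K), ?_⟩
  rw [integral_finsetSum _ fun k _ => iR k, integral_sub (iV 0) (iV K),
    ← Finset.sum_range_sub' (fun k => ∫ ω, V k ω ∂Pr), Finset.mul_sum, Finset.mul_sum,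
    ← Finset.sum_add_distrib, ← Finset.sum_add_distrib]
  refine Finset.sum_le_sum fun k _ => ?_
  have hT : (0 : ℝ) < A.T k := by exact_mod_cast hA.T_pos k
  have hM : (0 : ℝ) < A.M k := by exact_mod_cast hA.M_pos k
  have hnoise := BilevelSGD.noise_coefficient_le (v := A.σ k ^ 2 * sf ^ 2 + sg ^ 2) hA.ρ_pos
    (hA.α_pos k) (hA.σ_pos k) (hA.γ_pos k) hT hM hCw (div_pos hR.lg_pos hμ).le (by positivity)
  have hk : ∫ ω, R k ω ∂Pr + ∫ ω, V (k + 1) ω ∂Pr ≤ ∫ ω, V k ω ∂Pr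
      + (2 + 120 * Cw) * Cf * ((A.σ k - A.σ (k + 1)) / A.σ (k + 1))
      + (24 * (A.α k / A.σ k / A.M k)
        + 6 * (Cw * (A.T k * A.γ k / (4 * A.ρ)) / (A.σ k * A.ρ)) * (A.T k * A.γ k ^ 2))
        * (A.σ k ^ 2 * sf ^ 2 + sg ^ 2) := (hdesc k).2
  linarith
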